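/- Let $\alpha_1>\alpha_2>0$, $\beta_1>\beta_2>\beta_3>0$, $\delta>0$ and $\gamma>0$ be real numbers, and let $\mathcal P_{\alpha,\beta,\delta,\gamma}$ (the algebra associated with the Dynkin graph $E_7$) be the unital complex $*$-algebra with self-adjoint generators $p_1,p_2,q_1,q_2,q_3,s$ and relations $p_ip_j=\delta_{ij}p_i$, $q_iq_j=\delta_{ij}q_i$, $s^2=s$, $\alpha_1p_1+\alpha_2p_2+\beta_1q_1+\beta_2q_2+\beta_3q_3+\delta s=\gamma e$ (where $\delta_{ij}$ is the Kronecker symbol). A $*$-representation $\pi$ on a complex Hilbert space $H$ is a unital $*$-homomorphism into the bounded operators on $H$. It is irreducible if $H\neq 0$ and the only closed invariant subspaces are $0$ and $H$, and non-degenerate if $\pi(p_i)\ne0$, $\pi(q_j)\neq 0$ and $\pi(s)\ne0$ for all $i,j$, and $\sum_i\pi(p_i)\ne I$, $\sum_j\pi(q_j)\neq I$, $\pi(s)\neq I$. If $H$ is finite dimensional, the generalized dimension of $\pi$ is $$(\dim H;\ \operatorname{rank}\pi(p_2),\operatorname{rank}\pi(p_1);\ \operatorname{rank}\pi(q_3),\operatorname{rank}\pi(q_2),\operatorname{rank}\pi(q_1);\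 \operatorname{rank}\pi(s)).$$ Every irreducible non-degenerate $*$-representation of $\mathcal P_{\alpha,\beta,\delta,\gamma}$ is finite dimensional and has one of the generalized dimensions $(4;1,1;1,1,1;2)$, $(4;1,2;1,1,1;2)$, $(4;2,1;1,1,1;2)$. Moreover: 1. An irreducible non-degenerate $*$-representation of generalized dimension $(4;1,1;1,1,1;2)$ exists if and only if $\gamma>\delta+\beta_3$, $\delta+\alpha_1+\beta_1>2\gamma$, $\delta+\beta_2>\gamma$, $2\gamma>\delta+\alpha_2+\beta_1$, $\gamma>\beta_1$, $2\gamma>\delta+\alpha_1+\beta_2$ and $4\gamma=\alpha_1+\alpha_2+\beta_1+\beta_2+\beta_3+2\delta$. 2. An irreducible non-degenerate $*$-representation of generalized dimension $(4;1,2;1,1,1;2)$ exists if and only if $\alpha_1+\beta_2>\gamma$, $2\gamma>\alpha_1+\beta_1+\delta$, $\gamma>\alpha_1+\beta_3$, $2\gamma>\delta+\alpha_1+\beta_2+\beta_3$, $\delta+\alpha_1>\gamma$, $\delta+\alpha_1+\beta_1+\beta_3>2\gamma$ and $4\gamma=2\alpha_1+\alpha_2+\beta_1+\beta_2+\beta_3+2\delta$.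 3. An irreducible non-degenerate $*$-representation of generalized dimension $(4;2,1;1,1,1;2)$ exists if and only if $\gamma>\alpha_2+\beta_2$, $\delta+\alpha_2+\beta_3>\gamma$, $\alpha_2+\beta_1>\gamma$, $\delta+\alpha_2+\beta_1+\beta_2>2\gamma$, $\gamma>\delta+\alpha_2$, $2\gamma>\delta+\alpha_2+\beta_1+\beta_3$ and $4\gamma=\alpha_1+2\alpha_2+\beta_1+\beta_2+\beta_3+2\delta$. In each of these cases the representation is unique up to unitary equivalence. -/

import Mathlib

open scoped BigOperators

noncomputable section

namespace SpectralProblem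

/-- The generators `p_1, …, p_k, q_1, …, q_l, s_1, …, s_m`. -/
inductive Gen (k l m : ℕ) : Type
  | p (i : Fin k) : Gen k l m
  | q (j : Fin l) : Gen k l m
  | s (d : Fin m) : Gen k l m

variable {k l m : ℕ}

open FreeAlgebra in
/-- The defining relations: within each of the three families the generators are pairwise
orthogonal idempotents, and `∑ αᵢ pᵢ + ∑ βⱼ qⱼ + ∑ δ_d s_d = γ e`. -/
inductive Rel (α : Fin k → ℝ) (β : Fin l → ℝ) (δ : Fin m → ℝ) (γ : ℝ) :
    FreeAlgebra ℂ (Gen k l m) → FreeAlgebra ℂ (Gen k l m) → Prop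
  | p_mul (i j : Fin k) :
      Rel α β δ γ (ι ℂ (Gen.p i) * ι ℂ (Gen.p j)) (if i = j then ι ℂ (Gen.p i) else 0)
  | q_mul (i j : Fin l) :
      Rel α β δ γ (ι ℂ (Gen.q i) * ι ℂ (Gen.q j)) (if i = j then ι ℂ (Gen.q i) else 0)
  | s_mul (i j : Fin m) :
      Rel α β δ γ (ι ℂ (Gen.s i) * ι ℂ (Gen.s j)) (if i = j then ι ℂ (Gen.s i) else 0)
  | sum :
      Rel α β δ γ
        (∑ i, (α i : ℂ) • ι ℂ (Gen.p i) + ∑ j, (β j : ℂ) • ι ℂ (Gen.q j)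
          + ∑ d, (δ d : ℂ) • ι ℂ (Gen.s d))
        ((γ : ℂ) • 1)

/-- The unital associative complex algebra `𝒫_{α,β,δ,γ}`, given by generators and relations. -/
def P (α : Fin k → ℝ) (β : Fin l → ℝ) (δ : Fin m → ℝ) (γ : ℝ) : Type :=
  RingQuot (Rel α β δ γ)

section StarAlgebra

variable (α : Fin k → ℝ) (β : Fin l → ℝ) (δ : Fin m → ℝ) (γ : ℝ)

instance : Ring (P α β δ γ) := inferInstanceAs (Ring (RingQuot (Rel α β δ γ)))

instance : Algebra ℂ (P α β δ γ) := inferInstanceAs (Algebra ℂ (RingQuot (Rel α β δ γ)))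

/-- The canonical projection of the free algebra onto `𝒫_{α,β,δ,γ}`. -/
def P.mk : FreeAlgebra ℂ (Gen k l m) →ₐ[ℂ] P α β δ γ := RingQuot.mkAlgHom ℂ (Rel α β δ γ)

/-- The image of a generator in `𝒫_{α,β,δ,γ}`. -/
def P.gen (x : Gen k l m) : P α β δ γ := P.mk α β δ γ (FreeAlgebra.ι ℂ x)

/-- The opposite algebra of `A` with the complex conjugate scalar action. A conjugate-linear
anti-endomorphism of `A` is the same thing as an algebra homomorphism `A → ConjOp A`. -/
def ConjOp (A : Type*) : Type _ := Aᵐᵒᵖ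

instance (A : Type*) [Ring A] : Ring (ConjOp A) := inferInstanceAs (Ring Aᵐᵒᵖ)

instance (A : Type*) [Ring A] [Algebra ℂ A] : Algebra ℂ (ConjOp A) :=
  RingHom.toAlgebra' (((algebraMap ℂ Aᵐᵒᵖ).comp (starRingEnd ℂ) : ℂ →+* Aᵐᵒᵖ))
    (fun c x => Algebra.commutes (A := Aᵐᵒᵖ) ((starRingEnd ℂ) c) x)

/-- The identity map `A → ConjOp A`, a conjugate-linear anti-isomorphism. -/
def ConjOp.mk {A : Type*} (a : A) : ConjOp A := (MulOpposite.op a : Aᵐᵒᵖ)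

/-- The inverse of `ConjOp.mk`. -/
def ConjOp.out {A : Type*} (a : ConjOp A) : A := MulOpposite.unop (α := A) a

theorem ConjOp.mk_mul {A : Type*} [Ring A] (a b : A) :
    ConjOp.mk a * ConjOp.mk b = ConjOp.mk (b * a) := rfl

theorem ConjOp.mk_add {A : Type*} [Ring A] (a b : A) :
    ConjOp.mk a + ConjOp.mk b = ConjOp.mk (a + b) := rfl

theorem ConjOp.mk_zero {A : Type*} [Ring A] : ConjOp.mk (0 : A) = 0 := rfl

theorem ConjOp.mk_one {A : Type*} [Ring A] : ConjOp.mk (1 : A) = 1 := rfl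

theorem ConjOp.mk_sum {A ι : Type*} [Ring A] (t : Finset ι) (f : ι → A) :
    ∑ i ∈ t, ConjOp.mk (f i) = ConjOp.mk (∑ i ∈ t, f i) :=
  (map_sum (AddMonoidHom.mk' (ConjOp.mk (A := A)) fun _ _ => rfl) f t).symm

theorem ConjOp.algebraMap_def {A : Type*} [Ring A] [Algebra ℂ A] (c : ℂ) :
    algebraMap ℂ (ConjOp A) c = ConjOp.mk (algebraMap ℂ A ((starRingEnd ℂ) c)) := rfl

theorem ConjOp.smul_mk {A : Type*} [Ring A] [Algebra ℂ A] (c : ℂ) (x : A) :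
    c • ConjOp.mk x = ConjOp.mk (((starRingEnd ℂ) c) • x) := by
  rw [Algebra.smul_def, ConjOp.algebraMap_def, ConjOp.mk_mul, Algebra.smul_def, Algebra.commutes]

/-- The conjugate-linear anti-homomorphism on the free algebra that fixes the generators. -/
def starFree : FreeAlgebra ℂ (Gen k l m) →ₐ[ℂ] ConjOp (P α β δ γ) :=
  FreeAlgebra.lift ℂ (fun x => ConjOp.mk (P.gen α β δ γ x))

theorem starFree_ι (x : Gen k l m) :
    starFree α β δ γ (FreeAlgebra.ι ℂ x) = ConjOp.mk (P.gen α β δ γ x) :=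
  FreeAlgebra.lift_ι_apply _ _

theorem P.mk_rel {a b : FreeAlgebra ℂ (Gen k l m)} (h : Rel α β δ γ a b) :
    P.mk α β δ γ a = P.mk α β δ γ b :=
  RingQuot.mkAlgHom_rel ℂ h

theorem starFree_rel ⦃a b : FreeAlgebra ℂ (Gen k l m)⦄ (h : Rel α β δ γ a b) :
    starFree α β δ γ a = starFree α β δ γ b := by
  cases h with
  | p_mul i j =>
    have := P.mk_rel α β δ γ (Rel.p_mul j i)
    rw [map_mul] at this
    rw [map_mul, starFree_ι, starFree_ι, ConjOp.mk_mul, P.gen, P.gen, this]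
    by_cases hij : i = j
    · subst hij; simp [starFree_ι, P.gen]
    · simp [hij, Ne.symm hij, ConjOp.mk_zero]
  | q_mul i j =>
    have := P.mk_rel α β δ γ (Rel.q_mul j i)
    rw [map_mul] at this
    rw [map_mul, starFree_ι, starFree_ι, ConjOp.mk_mul, P.gen, P.gen, this]
    by_cases hij : i = j
    · subst hij; simp [starFree_ι, P.gen]
    · simp [hij, Ne.symm hij, ConjOp.mk_zero]
  | s_mul i j =>
    have := P.mk_rel α β δ γ (Rel.s_mul j i)
    rw [map_mul] at this
    rw [map_mul, starFree_ι, starFree_ι, ConjOp.mk_mul, P.gen, P.gen, this]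
    by_cases hij : i = j
    · subst hij; simp [starFree_ι, P.gen]
    · simp [hij, Ne.symm hij, ConjOp.mk_zero]
  | sum =>
    have := P.mk_rel α β δ γ Rel.sum
    simp only [map_add, map_sum, map_smul, map_one] at this
    simp only [map_add, map_sum, map_smul, map_one, starFree_ι, ConjOp.smul_mk, Complex.conj_ofReal,
      ← ConjOp.mk_one, ConjOp.mk_sum, ConjOp.mk_add, P.gen, this]

/-- The conjugate-linear anti-endomorphism of `𝒫_{α,β,δ,γ}` that fixes the generators. -/
def starHom : P α β δ γ →ₐ[ℂ] ConjOp (P α β δ γ) :=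
  RingQuot.liftAlgHom ℂ ⟨starFree α β δ γ, starFree_rel α β δ γ⟩

theorem starHom_mk (a : FreeAlgebra ℂ (Gen k l m)) :
    starHom α β δ γ (P.mk α β δ γ a) = starFree α β δ γ a :=
  RingQuot.liftAlgHom_mkAlgHom_apply ℂ _ _ a

theorem starHom_starHom (x : P α β δ γ) :
    (starHom α β δ γ (starHom α β δ γ x).out).out = x := by
  obtain ⟨a, rfl⟩ := RingQuot.mkAlgHom_surjective ℂ (Rel α β δ γ) x
  change (starHom α β δ γ (starHom α β δ γ (P.mk α β δ γ a)).out).out = P.mk α β δ γ a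
  induction a using FreeAlgebra.induction with
  | grade0 r =>
    rw [AlgHom.commutes, AlgHom.commutes, ConjOp.algebraMap_def]
    change (starHom α β δ γ (algebraMap ℂ (P α β δ γ) ((starRingEnd ℂ) r))).out = _
    rw [AlgHom.commutes, ConjOp.algebraMap_def, Complex.conj_conj]
    rfl
  | grade1 x =>
    rw [starHom_mk, starFree_ι]
    change (starHom α β δ γ (P.gen α β δ γ x)).out = _
    rw [P.gen, starHom_mk, starFree_ι]
    rfl
  | mul a b ha hb =>
    rw [map_mul, map_mul]
    change (starHom α β δ γ ((starHom α β δ γ (P.mk α β δ γ b)).out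
      * (starHom α β δ γ (P.mk α β δ γ a)).out)).out = _
    rw [map_mul]
    change (starHom α β δ γ (starHom α β δ γ (P.mk α β δ γ a)).out).out
      * (starHom α β δ γ (starHom α β δ γ (P.mk α β δ γ b)).out).out = _
    rw [ha, hb]
  | add a b ha hb =>
    rw [map_add, map_add]
    change (starHom α β δ γ ((starHom α β δ γ (P.mk α β δ γ a)).out
      + (starHom α β δ γ (P.mk α β δ γ b)).out)).out = _
    rw [map_add]
    change (starHom α β δ γ (starHom α β δ γ (P.mk α β δ γ a)).out).out
      + (starHom α β δ γ (starHom α β δ γ (P.mk α β δ γ b)).out).out = _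
    rw [ha, hb]

/-- The involution of `𝒫_{α,β,δ,γ}`. -/
instance : StarRing (P α β δ γ) where
  star x := (starHom α β δ γ x).out
  star_involutive := starHom_starHom α β δ γ
  star_mul a b := by
    rw [map_mul]
    rfl
  star_add a b := by
    rw [map_add]
    rfl

instance : StarModule ℂ (P α β δ γ) where
  star_smul c a := by
    change (starHom α β δ γ (c • a)).out = (starRingEnd ℂ) c • (starHom α β δ γ a).out
    rw [map_smul]
    exact congrArg ConjOp.out (ConjOp.smul_mk c (starHom α β δ γ a).out)

/-- The generators of `𝒫_{α,β,δ,γ}` are self-adjoint. -/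
theorem P.star_gen (x : Gen k l m) : star (P.gen α β δ γ x) = P.gen α β δ γ x := by
  change (starHom α β δ γ (P.mk α β δ γ (FreeAlgebra.ι ℂ x))).out = _
  rw [starHom_mk, starFree_ι]
  rfl

end StarAlgebra

section Representations

variable {α : Fin k → ℝ} {β : Fin l → ℝ} {δ : Fin m → ℝ} {γ : ℝ}
variable {H : Type*} [NormedAddCommGroup H] [InnerProductSpace ℂ H] [CompleteSpace H]
variable {H' : Type*} [NormedAddCommGroup H'] [InnerProductSpace ℂ H'] [CompleteSpace H']

/-- A `*`-representation of `𝒫_{α,β,δ,γ}` on the Hilbert space `H`: a unital `*`-homomorphism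
into the algebra of bounded operators on `H`. -/
abbrev StarRep (α : Fin k → ℝ) (β : Fin l → ℝ) (δ : Fin m → ℝ) (γ : ℝ)
    (H : Type*) [NormedAddCommGroup H] [InnerProductSpace ℂ H] [CompleteSpace H] :=
  P α β δ γ →⋆ₐ[ℂ] (H →L[ℂ] H)

namespace StarRep

/-- The image `π(x)` of a generator `x`. -/
def op (π : StarRep α β δ γ H) (x : Gen k l m) : H →L[ℂ] H := π (P.gen α β δ γ x)

/-- Irreducibility: `H ≠ 0`, and the only closed invariant subspaces are `0` and `H`. -/
def IsIrreducible (π : StarRep α β δ γ H) : Prop :=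
  Nontrivial H ∧
    ∀ K : Submodule ℂ H, IsClosed (K : Set H) → (∀ a, ∀ x ∈ K, π a x ∈ K) → K = ⊥ ∨ K = ⊤

/-- Non-degeneracy: no generator is represented by `0`, and none of the three families of
projections sums to the identity. -/
def IsNondegenerate (π : StarRep α β δ γ H) : Prop :=
  (∀ x : Gen k l m, π.op x ≠ 0) ∧
    ∑ i, π.op (.p i) ≠ 1 ∧ ∑ j, π.op (.q j) ≠ 1 ∧ ∑ d, π.op (.s d) ≠ 1

/-- `π` has generalized dimension `(n₀; a; b; c)`: `H` is finite dimensional of dimension `n₀`, and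
`a`, `b`, `c` list the ranks of the projections `π(pᵢ)`, `π(qⱼ)`, `π(s_d)`. Along each branch of the
star-shaped graph the entries are listed from the end vertex towards the root, that is, in the
order `(rank π(p_k), …, rank π(p_1))`, and likewise for the `q`'s and the `s`'s. -/
def HasGeneralizedDimension (π : StarRep α β δ γ H) (n₀ : ℕ)
    (a : Fin k → ℕ) (b : Fin l → ℕ) (c : Fin m → ℕ) : Prop :=
  FiniteDimensional ℂ H ∧ Module.finrank ℂ H = n₀ ∧
    (∀ i, Module.finrank ℂ (π.op (.p i.rev)).range = a i) ∧
    (∀ j, Module.finrank ℂ (π.op (.q j.rev)).range = b j) ∧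
    (∀ d, Module.finrank ℂ (π.op (.s d.rev)).range = c d)

/-- Unitary equivalence: there is a unitary `U : H → H'` that intertwines the representations. -/
def UnitarilyEquivalent (π : StarRep α β δ γ H) (π' : StarRep α β δ γ H') : Prop :=
  ∃ U : H ≃ₗᵢ[ℂ] H', ∀ a x, U (π a x) = π' a (U x)

end StarRep

/-- Up to unitary equivalence there is at most one irreducible non-degenerate `*`-representation of
`𝒫_{α,β,δ,γ}` of generalized dimension `(n₀; a; b; c)`. -/
def UniqueInDimension.{u, v} (α : Fin k → ℝ) (β : Fin l → ℝ) (δ : Fin m → ℝ) (γ : ℝ) (n₀ : ℕ)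
    (a : Fin k → ℕ) (b : Fin l → ℕ) (c : Fin m → ℕ) : Prop :=
  ∀ (H : Type u) [NormedAddCommGroup H] [InnerProductSpace ℂ H] [CompleteSpace H]
    (H' : Type v) [NormedAddCommGroup H'] [InnerProductSpace ℂ H'] [CompleteSpace H']
    (π : StarRep α β δ γ H) (π' : StarRep α β δ γ H'),
    π.IsIrreducible → π.IsNondegenerate → π.HasGeneralizedDimension n₀ a b c →
    π'.IsIrreducible → π'.IsNondegenerate → π'.HasGeneralizedDimension n₀ a b c →
    π.UnitarilyEquivalent π'

/-- There is a Hilbert space (in the universe `u`) with an irreducible non-degenerate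
`*`-representation of `𝒫_{α,β,δ,γ}` of generalized dimension `(n₀; a; b; c)`. -/
def ExistsInDimension.{u} (α : Fin k → ℝ) (β : Fin l → ℝ) (δ : Fin m → ℝ) (γ : ℝ) (n₀ : ℕ)
    (a : Fin k → ℕ) (b : Fin l → ℕ) (c : Fin m → ℕ) : Prop :=
  ∃ (H : Type u) (_ : NormedAddCommGroup H) (_ : InnerProductSpace ℂ H) (_ : CompleteSpace H)
    (π : StarRep α β δ γ H),
    π.IsIrreducible ∧ π.IsNondegenerate ∧ π.HasGeneralizedDimension n₀ a b c

end Representations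

end SpectralProblem

end

universe u v

open SpectralProblem

/-! Adjoin the complements 1 − ∑ pᵢ and 1 − ∑ qⱼ with coefficient 0. The relation becomes A + B + C
= γ, where A = ∑ aᵢEᵢ has three eigenvalues, B = ∑ bⱼFⱼ has four, and C = δs has two.

Dimensions. If Bξ = b₀ξ, then Aξ ≡ −Cξ modulo ξ, and the polynomial relations of A, B and C make the
span of ξ, Cξ, ACξ, CACξ, ACACξ, CACACξ invariant (`chainSpan_invariant`). Hence an irreducible
representation is finite dimensional. If ξ is moreover an eigenvector of the compression of s to the
range of F₀, then F₀ maps this span into the line through ξ (`map_chainSpan_mem_span`), so every Fⱼ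
has rank one and the dimension is 4. Since Eᵢ and s have no common eigenvector, s has rank 2, and
the three nonzero Eᵢ have ranks 1, 1, 2 in some order.

Normal form. Number the Eᵢ so that E₀ has rank 2, and put D = γ − a₀ − B = diag(dⱼ); then D − δs =
(a₁ − a₀)E₁ + (a₂ − a₀)E₂. If V has as columns an orthonormal basis of the range of s, in
coordinates with respect to an eigenbasis fⱼ of B, then V*V = 1 and V*D⁻¹V = δ⁻¹. Each row of V
defines a Hermitian 2×2 matrix of rank one, that is, a null vector of Minkowski space. Interpolating
the coordinates of these vectors at the points dⱼ yields R(t)² − Q(t) = ∏(t − dⱼ) · (t − (a₁ −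
a₀))(t − (a₂ − a₀)) with a monic cubic R and a positive definite quadratic Q
(`exists_sexticSplit_of_weights`), and ⟨fⱼ, s fⱼ⟩ = 2 dⱼ R(dⱼ) / (δ ∏_{k≠j}(dⱼ − dₖ)).

Uniqueness. The sextic determines R (`SexticSplit.cubic_unique`), hence the compression of s to the
range of F₀. The chain argument in the direct sum of two representations then shows that they have a
common vector state.

Inequalities. Positivity of ⟨fⱼ, s fⱼ⟩ fixes the signs of dⱼR(dⱼ), hence the position of the roots
of R. For two roots x, y of the sextic, R(x)R(y) plus or minus the polar form of Q is a product of
linear forms in the roots (`SexticSplit.pair`), while the product of these two expressions is the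
discriminant times (x − y)² (`SexticSplit.disc`). Hence the sign conditions are equivalent to linear
inequalities. Conversely these give the signs, and writing Q as (At + B)² + C² gives V, and with it
a representation, explicitly. -/

namespace SpectralProblem

/-! ### Finite dimensional invariant subspaces generated by an eigenvector of b -/

section Chain

variable {E : Type*} [AddCommGroup E] [Module ℂ E]

/-- The span of the vectors obtained from `ξ` by applying `c, a, c, a, c` in turn. -/
def chainSpan (a c : Module.End ℂ E) (ξ : E) : Submodule ℂ E :=
  Submodule.span ℂ {ξ, c ξ, a (c ξ), c (a (c ξ)), a (c (a (c ξ))), c (a (c (a (c ξ))))}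

theorem self_mem_chainSpan (a c : Module.End ℂ E) (ξ : E) : ξ ∈ chainSpan a c ξ :=
  Submodule.subset_span (by simp)

instance finiteDimensional_chainSpan (a c : Module.End ℂ E) (ξ : E) :
    FiniteDimensional ℂ (chainSpan a c ξ) :=
  FiniteDimensional.span_of_finite ℂ (by simp)

/-- The leading terms of `b v₁`, `b² v₁`, `b³ v₁` and `b⁴ v₁` along the chain. -/
theorem chain_leading_terms {a b c : Module.End ℂ E} {ξ : E} {δ γ lam k₀ k₁ k₂ : ℂ}
    (hb : ∀ x, b x = γ • x - a x - c x) (hc : ∀ x, c (c x) = δ • c x)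
    (ha : ∀ x, a (a (a x)) = k₂ • a (a x) + k₁ • a x + k₀ • x)
    (hξ : a ξ = lam • ξ - c ξ) {U : Submodule ℂ E}
    (h0 : ξ ∈ U) (h1 : c ξ ∈ U) (h2 : a (c ξ) ∈ U) :
    a (a (c ξ)) ∈ U ∧
    (c (a (c ξ)) ∈ U → b (b (b (c ξ))) + a (c (a (c ξ))) ∈ U ∧
      (a (c (a (c ξ))) ∈ U →
        b (b (b (c ξ))) ∈ U ∧ b (b (c ξ)) ∈ U ∧ b (c ξ) ∈ U ∧
        b (b (b (b (c ξ)))) - a (a (c (a (c ξ)))) - c (a (c (a (c ξ)))) ∈ U)) := by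
  have e2 : a (a ξ) = lam • a ξ - a (c ξ) := by
    conv_lhs => rw [hξ]
    rw [map_sub, map_smul]
  -- Since c ξ is a combination of ξ and a ξ, a² c ξ involves only powers of a up to the third, and
  -- the cubic relation of a lowers the degree.
  have e3 : a (a (c ξ)) = lam • a (a ξ) - (k₂ • a (a ξ) + k₁ • a ξ + k₀ • ξ) := by
    have : a (a (a ξ)) = lam • a (a ξ) - a (a (c ξ)) := by
      conv_lhs => rw [e2]
      rw [map_sub, map_smul]
    rw [← ha, this]; abel
  have m1 : a ξ ∈ U := by rw [hξ]; exact U.sub_mem (U.smul_mem _ h0) h1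
  have m2 : a (a ξ) ∈ U := by rw [e2]; exact U.sub_mem (U.smul_mem _ m1) h2
  have e4 : ∃ x₀ x₁ x₂ : ℂ, a (a (c ξ)) = x₀ • ξ + x₁ • c ξ + x₂ • a (c ξ) := by
    refine ⟨(lam - k₂) * lam * lam - k₁ * lam - k₀, -(lam - k₂) * lam + k₁, -(lam - k₂), ?_⟩
    rw [e3, e2, hξ]; module
  obtain ⟨x₀, x₁, x₂, e4⟩ := e4
  refine ⟨by rw [e4]; exact U.add_mem (U.add_mem (U.smul_mem _ h0)
    (U.smul_mem _ h1)) (U.smul_mem _ h2), fun h3 => ?_⟩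
  have b0 : b ξ = (γ - lam) • ξ := by rw [hb, hξ]; module
  have b1 : b (c ξ) = (γ - δ) • c ξ - a (c ξ) := by rw [hb, hc]; module
  have b2 : b (a (c ξ)) = -(x₀ • ξ) - x₁ • c ξ + (γ - x₂) • a (c ξ) - c (a (c ξ)) := by
    rw [hb, e4]; module
  have b3 : b (c (a (c ξ))) = (γ - δ) • c (a (c ξ)) - a (c (a (c ξ))) := by rw [hb, hc]; module
  -- Only the coefficient 1 of the last chain vector matters; the remaining coefficients are kept
  -- anonymous.
  have bb : ∃ y₀ y₁ y₂ : ℂ, b (b (c ξ)) = y₀ • ξ + y₁ • c ξ + y₂ • a (c ξ) + c (a (c ξ)) := by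
    refine ⟨x₀, (γ - δ) * (γ - δ) + x₁, -(γ - δ) - (γ - x₂), ?_⟩
    rw [b1, map_sub, map_smul, b1, b2]; module
  obtain ⟨y₀, y₁, y₂, bb⟩ := bb
  have bbb : ∃ y₀ y₁ y₂ y₃ : ℂ, b (b (b (c ξ))) =
      y₀ • ξ + y₁ • c ξ + y₂ • a (c ξ) + y₃ • c (a (c ξ)) - a (c (a (c ξ))) := by
    refine ⟨y₀ * (γ - lam) - y₂ * x₀, y₁ * (γ - δ) - y₂ * x₁, -y₁ + y₂ * (γ - x₂),
      -y₂ + (γ - δ), ?_⟩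
    rw [bb]; simp only [map_add, map_smul]; rw [b0, b1, b2, b3]; module
  obtain ⟨z₀, z₁, z₂, z₃, bbb⟩ := bbb
  have comb : ∀ y₀ y₁ y₂ y₃ : ℂ, y₀ • ξ + y₁ • c ξ + y₂ • a (c ξ) + y₃ • c (a (c ξ)) ∈ U :=
    fun y₀ y₁ y₂ y₃ => U.add_mem (U.add_mem (U.add_mem (U.smul_mem _ h0) (U.smul_mem _ h1))
      (U.smul_mem _ h2)) (U.smul_mem _ h3)
  refine ⟨?_, fun h4 => ⟨?_, ?_, ?_, ?_⟩⟩
  · rw [bbb, sub_add_cancel]; exact comb _ _ _ _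
  · rw [bbb]; exact U.sub_mem (comb _ _ _ _) h4
  · rw [bb]; simpa using comb y₀ y₁ y₂ 1
  · rw [b1]; exact U.sub_mem (U.smul_mem _ h1) h2
  · rw [bbb]; simp only [map_add, map_sub, map_smul]
    rw [b0, b1, b2, b3, hb (a (c (a (c ξ))))]
    have := U.add_mem (comb (z₀ * (γ - lam) - z₂ * x₀) (z₁ * (γ - δ) - z₂ * x₁)
      (-z₁ + z₂ * (γ - x₂)) (-z₂ + z₃ * (γ - δ))) (U.smul_mem (-z₃ - γ) h4)
    convert this using 1; module

/-- The chain of a vector with `b ξ = b₀ ξ` spans an invariant subspace. -/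
theorem chainSpan_invariant {a b c : Module.End ℂ E} {ξ : E} {δ γ lam k₀ k₁ k₂ : ℂ}
    {l₀ l₁ l₂ l₃ : ℂ}
    (hb : ∀ x, b x = γ • x - a x - c x) (hc : ∀ x, c (c x) = δ • c x)
    (ha : ∀ x, a (a (a x)) = k₂ • a (a x) + k₁ • a x + k₀ • x)
    (hb4 : ∀ x, b (b (b (b x))) = l₃ • b (b (b x)) + l₂ • b (b x) + l₁ • b x + l₀ • x)
    (hξ : a ξ = lam • ξ - c ξ) :
    (∀ x ∈ chainSpan a c ξ, a x ∈ chainSpan a c ξ) ∧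
      (∀ x ∈ chainSpan a c ξ, c x ∈ chainSpan a c ξ) := by
  have lift : ∀ (g : Module.End ℂ E) (S : Set E) (U : Submodule ℂ E), (∀ x ∈ S, g x ∈ U) →
      ∀ x ∈ Submodule.span ℂ S, g x ∈ U := fun g S U h x hx =>
    (Submodule.span_le (p := U.comap g)).2 h hx
  set U := Submodule.span ℂ {ξ, c ξ, a (c ξ), c (a (c ξ)), a (c (a (c ξ)))} with hU
  have m : ∀ x ∈ ({ξ, c ξ, a (c ξ), c (a (c ξ)), a (c (a (c ξ)))} : Set E), x ∈ U :=
    fun x hx => Submodule.subset_span hx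
  have m0 : ξ ∈ U := m _ (by simp)
  have m1 : c ξ ∈ U := m _ (by simp)
  have m2 : a (c ξ) ∈ U := m _ (by simp)
  have m3 : c (a (c ξ)) ∈ U := m _ (by simp)
  have m4 : a (c (a (c ξ))) ∈ U := m _ (by simp)
  have hUW : U ≤ chainSpan a c ξ := Submodule.span_mono (by
    intro x hx; simp only [Set.mem_insert_iff, Set.mem_singleton_iff] at hx ⊢; tauto)
  have m5 : c (a (c (a (c ξ)))) ∈ chainSpan a c ξ := Submodule.subset_span (by simp)
  obtain ⟨f2, f3⟩ := chain_leading_terms hb hc ha hξ m0 m1 m2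
  obtain ⟨-, f4⟩ := f3 m3
  obtain ⟨g3, g2, g1, g4⟩ := f4 m4
  rw [hb4] at g4
  -- The quartic relation of b, applied to c ξ, closes the chain: modulo U, a² c a c ξ equals −c a c
  -- a c ξ.
  have key : a (a (c (a (c ξ)))) + c (a (c (a (c ξ)))) ∈ U := by
    have := U.sub_mem (U.add_mem (U.add_mem (U.add_mem (U.smul_mem l₃ g3) (U.smul_mem l₂ g2))
      (U.smul_mem l₁ g1)) (U.smul_mem l₀ m1)) g4
    convert this using 1; abel
  have aU : ∀ x ∈ U, a x ∈ chainSpan a c ξ := by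
    refine lift a _ _ ?_
    rintro x (rfl | rfl | rfl | rfl | rfl)
    · rw [hξ]; exact hUW (U.sub_mem (U.smul_mem _ m0) m1)
    · exact hUW m2
    · exact hUW f2
    · exact hUW m4
    · have := (chainSpan a c ξ).sub_mem (hUW key) m5
      rwa [add_sub_cancel_right] at this
  refine ⟨lift a _ _ ?_, lift c _ _ ?_⟩
  · rintro x (rfl | rfl | rfl | rfl | rfl | rfl)
    · exact aU _ m0
    · exact aU _ m1
    · exact aU _ m2
    · exact aU _ m3
    · exact aU _ m4
    -- Applying a to `key` gives a³ c a c ξ + a c a c a c ξ, and the first term is reduced by the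
    -- cubic relation of a.
    · have h4 := aU _ m4
      have := (chainSpan a c ξ).sub_mem (aU _ key) ((chainSpan a c ξ).add_mem
        ((chainSpan a c ξ).add_mem ((chainSpan a c ξ).smul_mem k₂ h4)
          ((chainSpan a c ξ).smul_mem k₁ (hUW m4))) ((chainSpan a c ξ).smul_mem k₀ (hUW m3)))
      convert this using 1
      rw [map_add, ha]; abel
  · rintro x (rfl | rfl | rfl | rfl | rfl | rfl)
    · exact hUW m1
    · rw [hc]; exact hUW (U.smul_mem _ m1)
    · exact hUW m3
    · rw [hc]; exact hUW (U.smul_mem _ m3)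
    · exact m5
    · rw [hc]; exact (chainSpan a c ξ).smul_mem _ m5

/-- If `q` is the spectral projection of `b` at the eigenvalue of `ξ` and `ξ` is an eigenvector of
`q c`, then `q` maps the whole chain into the line through `ξ`. -/
theorem map_chainSpan_mem_span {a b c q : Module.End ℂ E} {ξ : E} {δ γ b₀ k₀ k₁ k₂ : ℂ}
    {κ l₀ l₁ l₂ x : ℂ} (hκ : κ ≠ 0)
    (hb : ∀ x, b x = γ • x - a x - c x) (hc : ∀ x, c (c x) = δ • c x)
    (ha : ∀ x, a (a (a x)) = k₂ • a (a x) + k₁ • a x + k₀ • x)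
    (hq : ∀ x, q x = κ • (b (b (b x)) + l₂ • b (b x) + l₁ • b x + l₀ • x))
    (hqb : ∀ x, q (b x) = b₀ • q x) (hbξ : b ξ = b₀ • ξ) (hqξ : q ξ = ξ)
    (hx : q (c ξ) = x • ξ) :
    ∀ y ∈ chainSpan a c ξ, q y ∈ Submodule.span ℂ {ξ} := by
  set L : Submodule ℂ E := (Submodule.span ℂ {ξ}).comap q with hL
  have mL : ∀ y, y ∈ L ↔ q y ∈ Submodule.span ℂ {ξ} := fun y => Iff.rfl
  have m0 : ξ ∈ L := by rw [mL, hqξ]; exact Submodule.mem_span_singleton_self ξ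
  have m1 : c ξ ∈ L := by
    rw [mL, hx]; exact Submodule.smul_mem _ _ (Submodule.mem_span_singleton_self ξ)
  -- Because q b = b₀ q, the operators q a and −q c differ by a multiple of q, so for y in L the
  -- conditions a y ∈ L and c y ∈ L are equivalent. This alternation carries the proof along the
  -- chain.
  have swap : ∀ y, q (a y) + q (c y) = (γ - b₀) • q y := fun y => by
    have := hqb y
    rw [hb, map_sub, map_sub, map_smul] at this
    rw [sub_smul, ← this]; abel
  have hac : ∀ y ∈ L, c y ∈ L → a y ∈ L := fun y hy h => by
    rw [mL, eq_sub_of_add_eq (swap y)]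
    exact Submodule.sub_mem _ (Submodule.smul_mem _ _ hy) h
  have hca : ∀ y ∈ L, a y ∈ L → c y ∈ L := fun y hy h => by
    rw [mL, eq_sub_of_add_eq' (swap y)]
    exact Submodule.sub_mem _ (Submodule.smul_mem _ _ hy) h
  have hcc : ∀ y, c y ∈ L → c (c y) ∈ L := fun y h => by rw [hc]; exact L.smul_mem _ h
  have hξ : a ξ = (γ - b₀) • ξ - c ξ := by
    have := hb ξ
    rw [hbξ] at this
    rw [sub_smul, this]; abel
  have m2 : a (c ξ) ∈ L := hac _ m1 (hcc _ m1)
  have m3 : c (a (c ξ)) ∈ L := hca _ m2 (chain_leading_terms hb hc ha hξ m0 m1 m2).1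
  have m4 : a (c (a (c ξ))) ∈ L := hac _ m3 (hcc _ m3)
  -- Here q enters as a cubic in b: q (c ξ) is a multiple of ξ, and its expansion along the chain
  -- expresses a c a c ξ through the first four chain vectors. These c maps into L.
  have m5 : c (a (c (a (c ξ)))) ∈ L := by
    set U := Submodule.span ℂ {ξ, c ξ, a (c ξ), c (a (c ξ))} with hU
    have n0 : ξ ∈ U := Submodule.subset_span (by simp)
    have n1 : c ξ ∈ U := Submodule.subset_span (by simp)
    have n2 : a (c ξ) ∈ U := Submodule.subset_span (by simp)
    have n3 : c (a (c ξ)) ∈ U := Submodule.subset_span (by simp)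
    have hcU : U ≤ L.comap c := by
      rw [hU, Submodule.span_le]
      rintro y (rfl | rfl | rfl | rfl)
      · exact m1
      · exact hcc _ m1
      · exact m3
      · exact hcc _ m3
    have lead := ((chain_leading_terms hb hc ha hξ n0 n1 n2).2 n3).1
    have b1 : b (c ξ) = (γ - δ) • c ξ - a (c ξ) := by rw [hb, hc]; module
    have u1 : b (c ξ) ∈ U := by rw [b1]; exact U.sub_mem (U.smul_mem _ n1) n2
    have u2 : b (b (c ξ)) ∈ U := by
      rw [b1, map_sub, map_smul, hb (a (c ξ))]
      exact U.sub_mem (U.smul_mem _ u1) (U.sub_mem (U.sub_mem (U.smul_mem _ n2)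
        (chain_leading_terms hb hc ha hξ n0 n1 n2).1) n3)
    have hq1 : κ⁻¹ • q (c ξ) + a (c (a (c ξ))) ∈ U := by
      rw [hq, smul_smul, inv_mul_cancel₀ hκ, one_smul]
      have := U.add_mem lead (U.add_mem (U.add_mem (U.smul_mem l₂ u2) (U.smul_mem l₁ u1))
        (U.smul_mem l₀ n1))
      convert this using 1; abel
    have := hcU hq1
    rw [Submodule.mem_comap, hx, map_add, map_smul, map_smul] at this
    have h2 := L.sub_mem this (L.smul_mem κ⁻¹ (L.smul_mem x m1))
    rwa [add_sub_cancel_left] at h2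
  intro y hy
  refine (Submodule.span_le (p := L)).2 ?_ hy
  rintro y (rfl | rfl | rfl | rfl | rfl | rfl) <;> assumption

end Chain

end SpectralProblem

namespace SpectralProblem

/-! ### Monic sextics written as the square of a cubic minus a quadratic -/

section Sextic

theorem quintic_coeff_eq_zero {k₀ k₁ k₂ k₃ k₄ k₅ : ℝ}
    (h : ∀ t : ℝ, k₅ * t ^ 5 + k₄ * t ^ 4 + k₃ * t ^ 3 + k₂ * t ^ 2 + k₁ * t + k₀ = 0) :
    k₅ = 0 ∧ k₄ = 0 ∧ k₃ = 0 ∧ k₂ = 0 ∧ k₁ = 0 ∧ k₀ = 0 := by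
  have h0 := h 0
  have h1 := h 1
  have h2 := h (-1)
  have h3 := h 2
  have h4 := h (-2)
  have h5 := h 3
  norm_num at h0 h1 h2 h3 h4 h5
  refine ⟨?_, ?_, ?_, ?_, ?_, ?_⟩ <;> linarith

/-- The sextic with roots `e₁, …, e₆` is `R² - Q` with the monic cubic
`R = t³ + c₂ t² + c₁ t + c₀` and the quadratic polynomial `Q = q₂ t² + 2 q₁ t + q₀`. -/
def SexticSplit (c₀ c₁ c₂ q₀ q₁ q₂ e₁ e₂ e₃ e₄ e₅ e₆ : ℝ) : Prop :=
  ∀ t : ℝ, (t ^ 3 + c₂ * t ^ 2 + c₁ * t + c₀) ^ 2 - (q₂ * t ^ 2 + 2 * q₁ * t + q₀) =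
    (t - e₁) * (t - e₂) * (t - e₃) * (t - e₄) * (t - e₅) * (t - e₆)

variable {c₀ c₁ c₂ q₀ q₁ q₂ e₁ e₂ e₃ e₄ e₅ e₆ : ℝ}

theorem SexticSplit.coeffs (h : SexticSplit c₀ c₁ c₂ q₀ q₁ q₂ e₁ e₂ e₃ e₄ e₅ e₆) :
    2 * c₂ = -(e₁ + e₂ + e₃ + e₄ + e₅ + e₆) ∧
    c₂ ^ 2 + 2 * c₁ = e₁ * e₂ + (e₁ + e₂) * e₃ + (e₁ + e₂ + e₃) * e₄ + (e₁ + e₂ + e₃ + e₄) * e₅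
      + (e₁ + e₂ + e₃ + e₄ + e₅) * e₆ ∧
    2 * c₀ + 2 * c₁ * c₂ = -(e₁ * e₂ * e₃ + (e₁ * e₂ + (e₁ + e₂) * e₃) * e₄
      + (e₁ * e₂ + (e₁ + e₂) * e₃ + (e₁ + e₂ + e₃) * e₄) * e₅
      + (e₁ * e₂ + (e₁ + e₂) * e₃ + (e₁ + e₂ + e₃) * e₄ + (e₁ + e₂ + e₃ + e₄) * e₅) * e₆) ∧
    c₁ ^ 2 + 2 * c₀ * c₂ - q₂ = e₁ * e₂ * e₃ * e₄
      + (e₁ * e₂ * e₃ + (e₁ * e₂ + (e₁ + e₂) * e₃) * e₄) * e₅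
      + (e₁ * e₂ * e₃ + (e₁ * e₂ + (e₁ + e₂) * e₃) * e₄
        + (e₁ * e₂ + (e₁ + e₂) * e₃ + (e₁ + e₂ + e₃) * e₄) * e₅) * e₆ ∧
    2 * c₀ * c₁ - 2 * q₁ = -(e₁ * e₂ * e₃ * e₄ * e₅ + (e₁ * e₂ * e₃ * e₄
      + (e₁ * e₂ * e₃ + (e₁ * e₂ + (e₁ + e₂) * e₃) * e₄) * e₅) * e₆) ∧
    c₀ ^ 2 - q₀ = e₁ * e₂ * e₃ * e₄ * e₅ * e₆ := by
  obtain ⟨k5, k4, k3, k2, k1, k0⟩ := quintic_coeff_eq_zero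
    (k₅ := 2 * c₂ + (e₁ + e₂ + e₃ + e₄ + e₅ + e₆))
    (k₄ := c₂ ^ 2 + 2 * c₁ - (e₁ * e₂ + (e₁ + e₂) * e₃ + (e₁ + e₂ + e₃) * e₄
      + (e₁ + e₂ + e₃ + e₄) * e₅ + (e₁ + e₂ + e₃ + e₄ + e₅) * e₆))
    (k₃ := 2 * c₀ + 2 * c₁ * c₂ + (e₁ * e₂ * e₃ + (e₁ * e₂ + (e₁ + e₂) * e₃) * e₄
      + (e₁ * e₂ + (e₁ + e₂) * e₃ + (e₁ + e₂ + e₃) * e₄) * e₅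
      + (e₁ * e₂ + (e₁ + e₂) * e₃ + (e₁ + e₂ + e₃) * e₄ + (e₁ + e₂ + e₃ + e₄) * e₅) * e₆))
    (k₂ := c₁ ^ 2 + 2 * c₀ * c₂ - q₂ - (e₁ * e₂ * e₃ * e₄
      + (e₁ * e₂ * e₃ + (e₁ * e₂ + (e₁ + e₂) * e₃) * e₄) * e₅
      + (e₁ * e₂ * e₃ + (e₁ * e₂ + (e₁ + e₂) * e₃) * e₄
        + (e₁ * e₂ + (e₁ + e₂) * e₃ + (e₁ + e₂ + e₃) * e₄) * e₅) * e₆))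
    (k₁ := 2 * c₀ * c₁ - 2 * q₁ + (e₁ * e₂ * e₃ * e₄ * e₅ + (e₁ * e₂ * e₃ * e₄
      + (e₁ * e₂ * e₃ + (e₁ * e₂ + (e₁ + e₂) * e₃) * e₄) * e₅) * e₆))
    (k₀ := c₀ ^ 2 - q₀ - e₁ * e₂ * e₃ * e₄ * e₅ * e₆)
    (fun t => by linear_combination h t)
  refine ⟨?_, ?_, ?_, ?_, ?_, ?_⟩ <;> linarith

/-- The coefficients of t⁵, t⁴, t³ do not involve Q and determine c₂, c₁, c₀ one after the other: R
is the polynomial part of the square root of the sextic. -/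
theorem SexticSplit.cubic_unique {c₀' c₁' c₂' q₀' q₁' q₂' : ℝ}
    (h : SexticSplit c₀ c₁ c₂ q₀ q₁ q₂ e₁ e₂ e₃ e₄ e₅ e₆)
    (h' : SexticSplit c₀' c₁' c₂' q₀' q₁' q₂' e₁ e₂ e₃ e₄ e₅ e₆) :
    c₀ = c₀' ∧ c₁ = c₁' ∧ c₂ = c₂' := by
  obtain ⟨a2, a1, a0, -⟩ := h.coeffs
  obtain ⟨b2, b1, b0, -⟩ := h'.coeffs
  have e2 : c₂ = c₂' := by linarith
  subst e2
  have e1 : c₁ = c₁' := by linarith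
  subst e1
  exact ⟨by linarith, rfl, rfl⟩

/-- Completing the square from the top: c₂, c₁, c₀ are chosen to match t⁵, t⁴, t³, and Q absorbs the
remaining terms. -/
theorem exists_sexticSplit (e₁ e₂ e₃ e₄ e₅ e₆ : ℝ) :
    ∃ c₀ c₁ c₂ q₀ q₁ q₂, SexticSplit c₀ c₁ c₂ q₀ q₁ q₂ e₁ e₂ e₃ e₄ e₅ e₆ := by
  obtain ⟨s₁, hs₁⟩ : ∃ x, x = e₁ + e₂ + e₃ + e₄ + e₅ + e₆ := ⟨_, rfl⟩
  obtain ⟨s₂, hs₂⟩ : ∃ x, x = e₁ * e₂ + (e₁ + e₂) * e₃ + (e₁ + e₂ + e₃) * e₄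
    + (e₁ + e₂ + e₃ + e₄) * e₅ + (e₁ + e₂ + e₃ + e₄ + e₅) * e₆ := ⟨_, rfl⟩
  obtain ⟨s₃, hs₃⟩ : ∃ x, x = e₁ * e₂ * e₃ + (e₁ * e₂ + (e₁ + e₂) * e₃) * e₄
      + (e₁ * e₂ + (e₁ + e₂) * e₃ + (e₁ + e₂ + e₃) * e₄) * e₅
      + (e₁ * e₂ + (e₁ + e₂) * e₃ + (e₁ + e₂ + e₃) * e₄ + (e₁ + e₂ + e₃ + e₄) * e₅) * e₆ :=
    ⟨_, rfl⟩
  obtain ⟨s₄, hs₄⟩ : ∃ x, x = e₁ * e₂ * e₃ * e₄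
      + (e₁ * e₂ * e₃ + (e₁ * e₂ + (e₁ + e₂) * e₃) * e₄) * e₅
      + (e₁ * e₂ * e₃ + (e₁ * e₂ + (e₁ + e₂) * e₃) * e₄
        + (e₁ * e₂ + (e₁ + e₂) * e₃ + (e₁ + e₂ + e₃) * e₄) * e₅) * e₆ := ⟨_, rfl⟩
  obtain ⟨s₅, hs₅⟩ : ∃ x, x = e₁ * e₂ * e₃ * e₄ * e₅ + (e₁ * e₂ * e₃ * e₄
      + (e₁ * e₂ * e₃ + (e₁ * e₂ + (e₁ + e₂) * e₃) * e₄) * e₅) * e₆ := ⟨_, rfl⟩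
  have hS : ∀ t : ℝ, (t - e₁) * (t - e₂) * (t - e₃) * (t - e₄) * (t - e₅) * (t - e₆) =
      t ^ 6 - s₁ * t ^ 5 + s₂ * t ^ 4 - s₃ * t ^ 3 + s₄ * t ^ 2 - s₅ * t
        + e₁ * e₂ * e₃ * e₄ * e₅ * e₆ := fun t => by
    rw [hs₁, hs₂, hs₃, hs₄, hs₅]; ring
  obtain ⟨c₂, hc₂⟩ : ∃ x, x = -s₁ / 2 := ⟨_, rfl⟩
  obtain ⟨c₁, hc₁⟩ : ∃ x, x = (s₂ - c₂ ^ 2) / 2 := ⟨_, rfl⟩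
  obtain ⟨c₀, hc₀⟩ : ∃ x, x = (-s₃ - 2 * c₁ * c₂) / 2 := ⟨_, rfl⟩
  refine ⟨c₀, c₁, c₂, c₀ ^ 2 - e₁ * e₂ * e₃ * e₄ * e₅ * e₆, (2 * c₀ * c₁ + s₅) / 2,
    c₁ ^ 2 + 2 * c₀ * c₂ - s₄, fun t => ?_⟩
  rw [hS]
  linear_combination 2 * t ^ 5 * hc₂ + 2 * t ^ 4 * hc₁ + 2 * t ^ 3 * hc₀

/-- The product of the values of `R` at two roots, compared with the polar form of `Q`. -/
theorem SexticSplit.pair (h : SexticSplit c₀ c₁ c₂ q₀ q₁ q₂ e₁ e₂ e₃ e₄ e₅ e₆) :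
    32 * ((e₁ ^ 3 + c₂ * e₁ ^ 2 + c₁ * e₁ + c₀) * (e₂ ^ 3 + c₂ * e₂ ^ 2 + c₁ * e₂ + c₀)
      - (q₂ * (e₁ * e₂) + q₁ * (e₁ + e₂) + q₀)) =
      -((e₁ - e₂) ^ 2 * ((e₁ + e₂ + e₃ - e₄ - e₅ - e₆) * (e₁ + e₂ + e₄ - e₃ - e₅ - e₆) *
        (e₁ + e₂ + e₅ - e₃ - e₄ - e₆) * (e₁ + e₂ + e₆ - e₃ - e₄ - e₅))) ∧
    128 * ((e₁ ^ 3 + c₂ * e₁ ^ 2 + c₁ * e₁ + c₀) * (e₂ ^ 3 + c₂ * e₂ ^ 2 + c₁ * e₂ + c₀)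
      + (q₂ * (e₁ * e₂) + q₁ * (e₁ + e₂) + q₀)) =
      -((e₁ + e₃ + e₄ - e₂ - e₅ - e₆) * (e₁ + e₃ + e₅ - e₂ - e₄ - e₆) *
        (e₁ + e₃ + e₆ - e₂ - e₄ - e₅) * (e₁ + e₄ + e₅ - e₂ - e₃ - e₆) *
        (e₁ + e₄ + e₆ - e₂ - e₃ - e₅) * (e₁ + e₅ + e₆ - e₂ - e₃ - e₄)) := by
  obtain ⟨h2, h1, h0, g2, g1, g0⟩ := h.coeffs
  -- All coefficients of R and Q are eliminated in favour of the roots, which leaves polynomial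
  -- identities in e₁, …, e₆.
  have x2 : c₂ = -(e₁ + e₂ + e₃ + e₄ + e₅ + e₆) / 2 := by linarith
  rw [← eq_sub_iff_add_eq'] at h1
  have x1 := (eq_div_iff (two_ne_zero' ℝ)).2 ((mul_comm _ _).trans h1)
  have x0 := (eq_div_iff (two_ne_zero' ℝ)).2 ((mul_comm _ _).trans (eq_sub_of_add_eq h0))
  have y2 := (sub_eq_iff_eq_add.1 g2)
  have y2' := (eq_sub_of_add_eq' y2.symm)
  have y1' := (eq_sub_of_add_eq' (sub_eq_iff_eq_add.1 g1).symm)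
  have y1 := (eq_div_iff (two_ne_zero' ℝ)).2 ((mul_comm _ _).trans y1')
  have y0 := (eq_sub_of_add_eq' (sub_eq_iff_eq_add.1 g0).symm)
  rw [x2] at x1
  rw [x1, x2] at x0
  constructor
  · rw [y2', y1, y0, x0, x1, x2]; ring
  · rw [y2', y1, y0, x0, x1, x2]; ring

/-- The values of `R` at two roots and the polar form of `Q`, in terms of the discriminant. -/
theorem SexticSplit.disc (h : SexticSplit c₀ c₁ c₂ q₀ q₁ q₂ e₁ e₂ e₃ e₄ e₅ e₆) :
    ((e₁ ^ 3 + c₂ * e₁ ^ 2 + c₁ * e₁ + c₀) * (e₂ ^ 3 + c₂ * e₂ ^ 2 + c₁ * e₂ + c₀)) ^ 2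
      - (q₂ * (e₁ * e₂) + q₁ * (e₁ + e₂) + q₀) ^ 2 = (q₂ * q₀ - q₁ ^ 2) * (e₁ - e₂) ^ 2 := by
  have h1 : (e₁ ^ 3 + c₂ * e₁ ^ 2 + c₁ * e₁ + c₀) ^ 2 = q₂ * e₁ ^ 2 + 2 * q₁ * e₁ + q₀ := by
    have := h e₁
    rw [sub_self] at this; linarith
  have h2 : (e₂ ^ 3 + c₂ * e₂ ^ 2 + c₁ * e₂ + c₀) ^ 2 = q₂ * e₂ ^ 2 + 2 * q₁ * e₂ + q₀ := by
    have := h e₂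
    rw [sub_self, mul_zero] at this; linarith
  rw [mul_pow, h1, h2]; ring

end Sextic

end SpectralProblem

namespace SpectralProblem

/-! ### Signs of R at the roots of the sextic and linear inequalities between the roots -/

section Signs

variable {c₀ c₁ c₂ q₀ q₁ q₂ e₁ e₂ e₃ e₄ e₅ e₆ : ℝ}

theorem abs_lt_of_sq_sub_sq_pos {x y : ℝ} (h : 0 < x ^ 2 - y ^ 2) (hx : 0 < x) :
    -x < y ∧ y < x :=
  abs_lt.1 ((abs_of_pos hx) ▸ sq_lt_sq.1 (sub_pos.1 h))

/-- By `SexticSplit.disc`, a positive discriminant makes the polar form of Q smaller in absolute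
value than R(e₁)R(e₂), so the difference factored in `SexticSplit.pair` is positive. -/
theorem SexticSplit.four_mul_neg (h : SexticSplit c₀ c₁ c₂ q₀ q₁ q₂ e₁ e₂ e₃ e₄ e₅ e₆)
    (hd : 0 < q₂ * q₀ - q₁ ^ 2) (hne : e₁ ≠ e₂)
    (hR : 0 < (e₁ ^ 3 + c₂ * e₁ ^ 2 + c₁ * e₁ + c₀) * (e₂ ^ 3 + c₂ * e₂ ^ 2 + c₁ * e₂ + c₀)) :
    (e₁ + e₂ + e₃ - e₄ - e₅ - e₆) * (e₁ + e₂ + e₄ - e₃ - e₅ - e₆) *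
      (e₁ + e₂ + e₅ - e₃ - e₄ - e₆) * (e₁ + e₂ + e₆ - e₃ - e₄ - e₅) < 0 := by
  have h1 := h.disc
  have hsq : 0 < (e₁ - e₂) ^ 2 := by
    have := sub_ne_zero.2 hne
    positivity
  have h2 := (abs_lt_of_sq_sub_sq_pos (h1 ▸ mul_pos hd hsq) hR).2
  have h3 := h.pair.1
  by_contra hc
  have := mul_nonneg hsq.le (not_lt.1 hc)
  linarith

/-- The linear inequalities forced by the position of the roots of `R`. -/
theorem SexticSplit.inequalities {r₁ r₂ r₃ : ℝ}
    (h : SexticSplit c₀ c₁ c₂ q₀ q₁ q₂ e₁ e₂ e₃ e₄ e₅ e₆)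
    (hd : 0 < q₂ * q₀ - q₁ ^ 2)
    (hR : ∀ t : ℝ, t ^ 3 + c₂ * t ^ 2 + c₁ * t + c₀ = (t - r₁) * (t - r₂) * (t - r₃))
    (h1 : e₁ < r₁) (h2 : r₁ < e₂) (h3 : r₁ < e₃) (h2' : e₂ < r₂) (h3' : e₃ < r₂)
    (h4 : r₂ < e₄) (h5 : r₂ < e₅) (h4' : e₄ < r₃) (h5' : e₅ < r₃) (h6 : r₃ < e₆) :
    e₅ + e₃ + e₂ < e₆ + e₄ + e₁ ∧ e₄ + e₃ + e₂ < e₆ + e₅ + e₁ ∧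
      e₅ + e₄ + e₁ < e₆ + e₃ + e₂ ∧ e₆ + e₃ + e₁ < e₅ + e₄ + e₂ ∧
      e₆ + e₂ + e₁ < e₅ + e₄ + e₃ := by
  have R1 : e₁ ^ 3 + c₂ * e₁ ^ 2 + c₁ * e₁ + c₀ < 0 := by
    rw [hR]
    exact mul_neg_of_pos_of_neg (mul_pos_of_neg_of_neg (by linarith) (by linarith)) (by linarith)
  have Rp : ∀ x, r₁ < x → x < r₂ → 0 < x ^ 3 + c₂ * x ^ 2 + c₁ * x + c₀ := fun x k k' => by
    rw [hR]
    exact mul_pos_of_neg_of_neg (mul_neg_of_pos_of_neg (by linarith) (by linarith)) (by linarith)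
  have Rn : ∀ x, r₂ < x → x < r₃ → x ^ 3 + c₂ * x ^ 2 + c₁ * x + c₀ < 0 := fun x k k' => by
    rw [hR]
    exact mul_neg_of_pos_of_neg (mul_pos (by linarith) (by linarith)) (by linarith)
  have R6 : 0 < e₆ ^ 3 + c₂ * e₆ ^ 2 + c₁ * e₆ + c₀ := by
    rw [hR]
    exact mul_pos (mul_pos (by linarith) (by linarith)) (by linarith)
  -- `SexticSplit.four_mul_neg` is used for the pairs (3,6), (2,6), (1,4), (1,5), at which R has
  -- equal signs. For pairs with e₆ the ordering makes two factors positive and orders the other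
  -- two; for pairs with e₁ it makes three factors negative.
  have p : ∀ {x y z w : ℝ}, x * y * z * w < 0 → 0 < z → 0 < w → x < y → x < 0 ∧ 0 < y := by
    intro x y z w hp hz hw hxy
    have : x * y < 0 := by
      by_contra hc
      have := mul_nonneg (mul_nonneg (not_lt.1 hc) hz.le) hw.le
      linarith
    rcases mul_neg_iff.1 this with h | h
    · linarith [h.1, h.2]
    · exact h
  have k36 : SexticSplit c₀ c₁ c₂ q₀ q₁ q₂ e₃ e₆ e₁ e₂ e₄ e₅ := fun t => (h t).trans (by ring)
  have k26 : SexticSplit c₀ c₁ c₂ q₀ q₁ q₂ e₂ e₆ e₁ e₃ e₄ e₅ := fun t => (h t).trans (by ring)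
  have k14 : SexticSplit c₀ c₁ c₂ q₀ q₁ q₂ e₁ e₄ e₆ e₂ e₃ e₅ := fun t => (h t).trans (by ring)
  have k15 : SexticSplit c₀ c₁ c₂ q₀ q₁ q₂ e₁ e₅ e₆ e₂ e₃ e₄ := fun t => (h t).trans (by ring)
  obtain ⟨t631, t632⟩ := p (k36.four_mul_neg hd (by linarith) (mul_pos (Rp _ h3 h3') R6))
    (by linarith) (by linarith) (by linarith)
  obtain ⟨t621, -⟩ := p (k26.four_mul_neg hd (by linarith) (mul_pos (Rp _ h2 h2') R6))
    (by linarith) (by linarith) (by linarith)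
  have q : ∀ {x y z w : ℝ}, x * y * z * w < 0 → y < 0 → z < 0 → w < 0 → 0 < x := by
    intro x y z w hp hy hz hw
    by_contra hc
    have := mul_nonneg (mul_pos_of_neg_of_neg hy hz).le (mul_nonneg_of_nonpos_of_nonpos (not_lt.1 hc) hw.le)
    nlinarith
  have t641 := q (k14.four_mul_neg hd (by linarith) (mul_pos_of_neg_of_neg R1 (Rn _ h4 h4')))
    (by linarith) (by linarith) (by linarith)
  have t651 := q (k15.four_mul_neg hd (by linarith) (mul_pos_of_neg_of_neg R1 (Rn _ h5 h5')))
    (by linarith) (by linarith) (by linarith)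
  refine ⟨?_, ?_, ?_, ?_, ?_⟩ <;> linarith

/-- A monic cubic has divided difference `1` at any four points. -/
theorem cubic_divided_difference {x y z w : ℝ} (hxy : x < y) (hyz : y < z) (hzw : z < w)
    (hx : 0 ≤ x ^ 3 + c₂ * x ^ 2 + c₁ * x + c₀) (hy : y ^ 3 + c₂ * y ^ 2 + c₁ * y + c₀ ≤ 0)
    (hz : 0 ≤ z ^ 3 + c₂ * z ^ 2 + c₁ * z + c₀)
    (hw : w ^ 3 + c₂ * w ^ 2 + c₁ * w + c₀ ≤ 0) : False := by
  have a1 := sub_pos.2 hxy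
  have a2 := sub_pos.2 hyz
  have a3 := sub_pos.2 hzw
  have a4 : 0 < z - x := by linarith
  have a5 : 0 < w - y := by linarith
  have a6 : 0 < w - x := by linarith
  have key : (x ^ 3 + c₂ * x ^ 2 + c₁ * x + c₀) * ((z - y) * (w - y) * (w - z))
      - (y ^ 3 + c₂ * y ^ 2 + c₁ * y + c₀) * ((z - x) * (w - x) * (w - z))
      + (z ^ 3 + c₂ * z ^ 2 + c₁ * z + c₀) * ((y - x) * (w - x) * (w - y))
      - (w ^ 3 + c₂ * w ^ 2 + c₁ * w + c₀) * ((y - x) * (z - x) * (z - y))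
      = -((y - x) * (z - x) * (w - x) * (z - y) * (w - y) * (w - z)) := by ring
  have p : 0 < (y - x) * (z - x) * (w - x) * (z - y) * (w - y) * (w - z) := by positivity
  have p1 : 0 ≤ (z - y) * (w - y) * (w - z) := by positivity
  have p2 : 0 ≤ (z - x) * (w - x) * (w - z) := by positivity
  have p3 : 0 ≤ (y - x) * (w - x) * (w - y) := by positivity
  have p4 : 0 ≤ (y - x) * (z - x) * (z - y) := by positivity
  have := mul_nonneg hx p1
  have := mul_nonneg hz p3
  have := mul_nonneg (neg_nonneg.2 hy) p2
  have := mul_nonneg (neg_nonneg.2 hw) p4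
  linarith

/-- The two hypotheses say that R(e₁)R(e₂) minus and plus the polar form of Q are both positive; add
them. -/
theorem SexticSplit.mul_pos_of (h : SexticSplit c₀ c₁ c₂ q₀ q₁ q₂ e₁ e₂ e₃ e₄ e₅ e₆)
    (hne : e₁ ≠ e₂)
    (h4 : (e₁ + e₂ + e₃ - e₄ - e₅ - e₆) * (e₁ + e₂ + e₄ - e₃ - e₅ - e₆) *
      (e₁ + e₂ + e₅ - e₃ - e₄ - e₆) * (e₁ + e₂ + e₆ - e₃ - e₄ - e₅) < 0)
    (h6 : (e₁ + e₃ + e₄ - e₂ - e₅ - e₆) * (e₁ + e₃ + e₅ - e₂ - e₄ - e₆) *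
        (e₁ + e₃ + e₆ - e₂ - e₄ - e₅) * (e₁ + e₄ + e₅ - e₂ - e₃ - e₆) *
        (e₁ + e₄ + e₆ - e₂ - e₃ - e₅) * (e₁ + e₅ + e₆ - e₂ - e₃ - e₄) < 0) :
    0 < (e₁ ^ 3 + c₂ * e₁ ^ 2 + c₁ * e₁ + c₀) * (e₂ ^ 3 + c₂ * e₂ ^ 2 + c₁ * e₂ + c₀) := by
  have hsq : 0 < (e₁ - e₂) ^ 2 := by
    have := sub_ne_zero.2 hne
    positivity
  obtain ⟨k1, k2⟩ := h.pair
  have := mul_neg_of_pos_of_neg hsq h4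
  linarith

/-- Now both expressions of `SexticSplit.pair` are negative. Their sum gives the sign of R(e₁)R(e₂),
and their product, which is positive, gives the sign of the discriminant. -/
theorem SexticSplit.mul_neg_of (h : SexticSplit c₀ c₁ c₂ q₀ q₁ q₂ e₁ e₂ e₃ e₄ e₅ e₆)
    (hne : e₁ ≠ e₂)
    (h4 : 0 < (e₁ + e₂ + e₃ - e₄ - e₅ - e₆) * (e₁ + e₂ + e₄ - e₃ - e₅ - e₆) *
      (e₁ + e₂ + e₅ - e₃ - e₄ - e₆) * (e₁ + e₂ + e₆ - e₃ - e₄ - e₅))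
    (h6 : 0 < (e₁ + e₃ + e₄ - e₂ - e₅ - e₆) * (e₁ + e₃ + e₅ - e₂ - e₄ - e₆) *
        (e₁ + e₃ + e₆ - e₂ - e₄ - e₅) * (e₁ + e₄ + e₅ - e₂ - e₃ - e₆) *
        (e₁ + e₄ + e₆ - e₂ - e₃ - e₅) * (e₁ + e₅ + e₆ - e₂ - e₃ - e₄)) :
    (e₁ ^ 3 + c₂ * e₁ ^ 2 + c₁ * e₁ + c₀) * (e₂ ^ 3 + c₂ * e₂ ^ 2 + c₁ * e₂ + c₀) < 0 ∧
      0 < q₂ * q₀ - q₁ ^ 2 := by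
  have hsq : 0 < (e₁ - e₂) ^ 2 := by
    have := sub_ne_zero.2 hne
    positivity
  obtain ⟨k1, k2⟩ := h.pair
  have k3 := h.disc
  have := mul_pos hsq h4
  refine ⟨by linarith, ?_⟩
  have hpos : 0 < (q₂ * q₀ - q₁ ^ 2) * (e₁ - e₂) ^ 2 := by
    rw [← k3, sq_sub_sq]
    exact mul_pos_of_neg_of_neg (by linarith) (by linarith)
  exact pos_of_mul_pos_left hpos hsq.le

/-- The linear inequalities determine the signs of `R` at the roots of the sextic. -/
theorem SexticSplit.signs (h : SexticSplit c₀ c₁ c₂ q₀ q₁ q₂ e₁ e₂ e₃ e₄ e₅ e₆)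
    (t641 : e₅ + e₃ + e₂ < e₆ + e₄ + e₁) (t651 : e₄ + e₃ + e₂ < e₆ + e₅ + e₁)
    (t632 : e₅ + e₄ + e₁ < e₆ + e₃ + e₂) (t631 : e₆ + e₃ + e₁ < e₅ + e₄ + e₂)
    (t621 : e₆ + e₂ + e₁ < e₅ + e₄ + e₃) :
    0 < q₂ ∧ 0 < q₂ * q₀ - q₁ ^ 2 ∧
    e₁ ^ 3 + c₂ * e₁ ^ 2 + c₁ * e₁ + c₀ < 0 ∧ 0 < e₂ ^ 3 + c₂ * e₂ ^ 2 + c₁ * e₂ + c₀ ∧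
    0 < e₃ ^ 3 + c₂ * e₃ ^ 2 + c₁ * e₃ + c₀ ∧ e₄ ^ 3 + c₂ * e₄ ^ 2 + c₁ * e₄ + c₀ < 0 ∧
    e₅ ^ 3 + c₂ * e₅ ^ 2 + c₁ * e₅ + c₀ < 0 ∧ 0 < e₆ ^ 3 + c₂ * e₆ ^ 2 + c₁ * e₆ + c₀ := by
  -- Every root is paired with e₆, which determines the signs of R at e₁, …, e₅ relative to R(e₆).
  have k1 : SexticSplit c₀ c₁ c₂ q₀ q₁ q₂ e₆ e₁ e₂ e₃ e₄ e₅ := fun t => (h t).trans (by ring)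
  have m1 := k1.mul_neg_of (by linarith)
    (mul_pos (mul_pos (mul_pos_of_neg_of_neg (by linarith) (by linarith)) (by linarith)) (by linarith))
    (mul_pos (mul_pos (mul_pos (mul_pos (mul_pos (by linarith) (by linarith)) (by linarith)) (by linarith)) (by linarith)) (by linarith))
  have k2 : SexticSplit c₀ c₁ c₂ q₀ q₁ q₂ e₆ e₂ e₁ e₃ e₄ e₅ := fun t => (h t).trans (by ring)
  have m2 := k2.mul_pos_of (by linarith)
    (mul_neg_of_neg_of_pos (mul_neg_of_neg_of_pos (mul_neg_of_neg_of_pos (by linarith) (by linarith)) (by linarith)) (by linarith))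
    (mul_neg_of_neg_of_pos (mul_neg_of_neg_of_pos (mul_neg_of_neg_of_pos (mul_neg_of_neg_of_pos (mul_neg_of_neg_of_pos (by linarith) (by linarith)) (by linarith)) (by linarith)) (by linarith)) (by linarith))
  have k3 : SexticSplit c₀ c₁ c₂ q₀ q₁ q₂ e₆ e₃ e₁ e₂ e₄ e₅ := fun t => (h t).trans (by ring)
  have m3 := k3.mul_pos_of (by linarith)
    (mul_neg_of_neg_of_pos (mul_neg_of_neg_of_pos (mul_neg_of_neg_of_pos (by linarith) (by linarith)) (by linarith)) (by linarith))
    (mul_neg_of_neg_of_pos (mul_neg_of_neg_of_pos (mul_neg_of_neg_of_pos (mul_neg_of_neg_of_pos (mul_neg_of_neg_of_pos (by linarith) (by linarith)) (by linarith)) (by linarith)) (by linarith)) (by linarith))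
  have k4 : SexticSplit c₀ c₁ c₂ q₀ q₁ q₂ e₆ e₄ e₁ e₂ e₃ e₅ := fun t => (h t).trans (by ring)
  have m4 := k4.mul_neg_of (by linarith)
    (mul_pos (mul_pos (mul_pos (by linarith) (by linarith)) (by linarith)) (by linarith))
    (mul_pos (mul_pos (mul_pos (mul_pos (mul_pos_of_neg_of_neg (by linarith) (by linarith)) (by linarith)) (by linarith)) (by linarith)) (by linarith))
  have k5 : SexticSplit c₀ c₁ c₂ q₀ q₁ q₂ e₆ e₅ e₁ e₂ e₃ e₄ := fun t => (h t).trans (by ring)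
  have m5 := k5.mul_neg_of (by linarith)
    (mul_pos (mul_pos (mul_pos (by linarith) (by linarith)) (by linarith)) (by linarith))
    (mul_pos (mul_pos (mul_pos (mul_pos (mul_pos_of_neg_of_neg (by linarith) (by linarith)) (by linarith)) (by linarith)) (by linarith)) (by linarith))
  obtain ⟨m1, hd⟩ := m1
  replace m4 := m4.1
  replace m5 := m5.1
  set R : ℝ → ℝ := fun t => t ^ 3 + c₂ * t ^ 2 + c₁ * t + c₀ with hR
  -- At a root of the sextic Q equals R², so completing the square gives q₂ R(e₆)² > 0.
  have hq : 0 < q₂ := by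
    have h1 := h e₆
    rw [sub_self, mul_zero, sub_eq_zero] at h1
    have h2 : q₂ * R e₆ ^ 2 = (q₂ * e₆ + q₁) ^ 2 + (q₂ * q₀ - q₁ ^ 2) := by
      simp only [hR]; rw [h1]; ring
    by_contra hc
    have := mul_nonneg (neg_nonneg.2 (not_lt.1 hc)) (sq_nonneg (R e₆))
    have := sq_nonneg (q₂ * e₆ + q₁)
    linarith
  -- Otherwise all signs are reversed, and R would have signs +, −, +, − at e₁ < e₂ < e₄ < e₆, which
  -- is impossible for a monic cubic.
  have m6 : 0 < R e₆ := by
    by_contra hc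
    have hc : R e₆ < 0 := lt_of_le_of_ne (not_lt.1 hc) fun h0 => by
      have : R e₆ * R e₁ < 0 := m1
      rw [h0, zero_mul] at this; exact lt_irrefl _ this
    exact cubic_divided_difference (c₀ := c₀) (c₁ := c₁) (c₂ := c₂)
      (show e₁ < e₂ by linarith) (show e₂ < e₄ by linarith) (show e₄ < e₆ by linarith)
      (pos_of_mul_neg_right m1 hc.le).le (neg_of_mul_pos_right m2 hc.le).le
      (pos_of_mul_neg_right m4 hc.le).le hc.le
  exact ⟨hq, hd, neg_of_mul_neg_right m1 m6.le, pos_of_mul_pos_right m2 m6.le,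
    pos_of_mul_pos_right m3 m6.le, neg_of_mul_neg_right m4 m6.le,
    neg_of_mul_neg_right m5 m6.le, m6⟩

theorem exists_cubic_root {x y : ℝ} (hxy : x < y)
    (h : (x ^ 3 + c₂ * x ^ 2 + c₁ * x + c₀) * (y ^ 3 + c₂ * y ^ 2 + c₁ * y + c₀) < 0) :
    ∃ r, x < r ∧ r < y ∧ r ^ 3 + c₂ * r ^ 2 + c₁ * r + c₀ = 0 := by
  have hc : ContinuousOn (fun t : ℝ => t ^ 3 + c₂ * t ^ 2 + c₁ * t + c₀) (Set.Icc x y) := by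
    fun_prop
  rcases mul_neg_iff.1 h with ⟨h1, h2⟩ | ⟨h1, h2⟩
  · obtain ⟨r, hr, h0⟩ := intermediate_value_Ioo' hxy.le hc ⟨h2, h1⟩
    exact ⟨r, hr.1, hr.2, h0⟩
  · obtain ⟨r, hr, h0⟩ := intermediate_value_Ioo hxy.le hc ⟨h1, h2⟩
    exact ⟨r, hr.1, hr.2, h0⟩

/-- A monic cubic with two sign changes is a product of linear factors. -/
theorem cubic_factor {x y z w : ℝ} (hxy : x < y) (hyz : y ≤ z) (hzw : z < w)
    (h1 : (x ^ 3 + c₂ * x ^ 2 + c₁ * x + c₀) * (y ^ 3 + c₂ * y ^ 2 + c₁ * y + c₀) < 0)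
    (h2 : (z ^ 3 + c₂ * z ^ 2 + c₁ * z + c₀) * (w ^ 3 + c₂ * w ^ 2 + c₁ * w + c₀) < 0) :
    ∃ r s p, x < r ∧ r < y ∧ z < s ∧ s < w ∧
      ∀ t, t ^ 3 + c₂ * t ^ 2 + c₁ * t + c₀ = (t - r) * (t - s) * (t - p) := by
  obtain ⟨r, hr1, hr2, hr⟩ := exists_cubic_root hxy h1
  obtain ⟨s, hs1, hs2, hs⟩ := exists_cubic_root hzw h2
  -- The third root is read off from the sum of the roots.
  refine ⟨r, s, -c₂ - r - s, hr1, hr2, hs1, hs2, fun t => ?_⟩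
  have hne : s - r ≠ 0 := by
    have : r < s := by linarith
    linarith
  have e1 : c₁ = r * s + (r + s) * (-c₂ - r - s) := by
    apply mul_left_cancel₀ hne
    linear_combination hs - hr
  have e0 : c₀ = -(r * s * (-c₂ - r - s)) := by
    linear_combination hr - r * e1
  linear_combination t * e1 + e0

end Signs

end SpectralProblem

namespace SpectralProblem

/-! ### Interlacing of the roots of R with the roots of the sextic -/

section Position

variable {c₀ c₁ c₂ q₀ q₁ q₂ d₁ d₂ d₃ d₄ a₁ a₂ : ℝ}

theorem mul_three_neg_cases {x y z : ℝ} (h : x * y * z < 0) :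
    (0 < x * y → z < 0) ∧ (x * y < 0 → 0 < z) :=
  ⟨fun k => neg_of_mul_neg_right h k.le, fun k => pos_of_mul_neg_right h k.le⟩

theorem mul_three_pos_cases {x y z : ℝ} (h : 0 < x * y * z) :
    (0 < x * y → 0 < z) ∧ (x * y < 0 → z < 0) :=
  ⟨fun k => pos_of_mul_pos_right h k.le, fun k => neg_of_mul_pos_right h k.le⟩

/-- The possible positions of the roots `r₁ < r₂ < r₃` of `R`, of the `dⱼ`, of `a₂ < a₁` and of `0`,
given the signs of `dⱼ R(dⱼ)`. -/
theorem SexticSplit.positions (h : SexticSplit c₀ c₁ c₂ q₀ q₁ q₂ d₁ d₂ d₃ d₄ a₁ a₂)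
    (hq : 0 < q₂) (hd : 0 < q₂ * q₀ - q₁ ^ 2) (h12 : d₁ < d₂) (h23 : d₂ < d₃) (h34 : d₃ < d₄)
    (ha : a₂ < a₁)
    (s1 : d₁ * (d₁ ^ 3 + c₂ * d₁ ^ 2 + c₁ * d₁ + c₀) < 0)
    (s2 : 0 < d₂ * (d₂ ^ 3 + c₂ * d₂ ^ 2 + c₁ * d₂ + c₀))
    (s3 : d₃ * (d₃ ^ 3 + c₂ * d₃ ^ 2 + c₁ * d₃ + c₀) < 0)
    (s4 : 0 < d₄ * (d₄ ^ 3 + c₂ * d₄ ^ 2 + c₁ * d₄ + c₀)) :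
    ∃ r₁ r₂ r₃ : ℝ, (∀ t : ℝ, t ^ 3 + c₂ * t ^ 2 + c₁ * t + c₀ = (t - r₁) * (t - r₂) * (t - r₃)) ∧
      ((0 < d₁ ∧ d₁ < r₁ ∧ r₁ < d₂ ∧ r₁ < a₂ ∧ d₂ < r₂ ∧ a₂ < r₂ ∧ r₂ < a₁ ∧ r₂ < d₃ ∧
          a₁ < r₃ ∧ d₃ < r₃ ∧ r₃ < d₄) ∨
        (d₁ < 0 ∧ 0 < d₂ ∧ a₂ < r₁ ∧ r₁ < d₁ ∧ d₂ < r₂ ∧ r₂ < d₃ ∧ r₂ < a₁ ∧ d₃ < r₃ ∧ a₁ < r₃ ∧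
          r₃ < d₄) ∨
        (d₂ < 0 ∧ 0 < d₃ ∧ a₂ < r₁ ∧ r₁ < d₁ ∧ r₁ < a₁ ∧ d₁ < r₂ ∧ a₁ < r₂ ∧ r₂ < d₂ ∧ d₃ < r₃ ∧
          r₃ < d₄)) := by
  have neg : ∀ {x y : ℝ}, x * y < 0 → x ≤ 0 → 0 < y := fun k k' => pos_of_mul_neg_right k k'
  -- At a root of R the sextic takes the value −Q(t), which is negative because Q is positive
  -- definite.
  have hQ : ∀ t : ℝ, t ^ 3 + c₂ * t ^ 2 + c₁ * t + c₀ = 0 →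
      (t - d₁) * (t - d₂) * (t - d₃) * (t - d₄) * ((t - a₁) * (t - a₂)) < 0 := by
    intro t ht
    have h1 := h t
    rw [ht] at h1
    have h2 : 0 < q₂ * (q₂ * t ^ 2 + 2 * q₁ * t + q₀) := by
      have : q₂ * (q₂ * t ^ 2 + 2 * q₁ * t + q₀) = (q₂ * t + q₁) ^ 2 + (q₂ * q₀ - q₁ ^ 2) := by
        ring
      rw [this]; positivity
    have h3 := pos_of_mul_pos_right h2 hq.le
    have h4 : (t - d₁) * (t - d₂) * (t - d₃) * (t - d₄) * ((t - a₁) * (t - a₂)) =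
        -(q₂ * t ^ 2 + 2 * q₁ * t + q₀) := by
      linear_combination -h1
    linarith
  -- For a root t of R, the sign of P = ∏(t − dⱼ) therefore decides whether t lies between a₂ and a₁
  -- or outside that interval.
  have inside : ∀ {t P : ℝ}, P * ((t - a₁) * (t - a₂)) < 0 → 0 < P → a₂ < t ∧ t < a₁ := by
    intro t P k kP
    rcases mul_neg_iff.1 (neg_of_mul_neg_right k kP.le) with k | k <;> constructor <;> linarith
  have outside : ∀ {t P : ℝ}, P * ((t - a₁) * (t - a₂)) < 0 → P < 0 → t < a₂ ∨ a₁ < t := by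
    intro t P k kP
    rcases mul_pos_iff.1 (pos_of_mul_neg_right k kP.le) with k | k
    · right; linarith
    · left; linarith
  rcases lt_trichotomy d₁ 0 with g1 | g1 | g1
  rotate_left
  · rw [g1, zero_mul] at s1; exact absurd s1 (lt_irrefl _)
  · -- all `dⱼ` are positive
    have R1 := neg_of_mul_neg_right s1 g1.le
    have R2 := pos_of_mul_pos_right s2 (by linarith)
    have R3 := neg_of_mul_neg_right s3 (by linarith)
    have R4 := pos_of_mul_pos_right s4 (by linarith)
    obtain ⟨r₁, r₃, r₂, k1, k2, k3, k4, hR⟩ := cubic_factor h12 h23.le h34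
      (mul_neg_of_neg_of_pos R1 R2) (mul_neg_of_neg_of_pos R3 R4)
    rw [hR] at R2 R3
    have k5 := (mul_three_pos_cases R2).2 (mul_neg_of_pos_of_neg (by linarith) (by linarith))
    have k6 := (mul_three_neg_cases R3).2 (mul_neg_of_pos_of_neg (by linarith) (by linarith))
    obtain ⟨i1, i2⟩ := inside (hQ r₂ (by rw [hR]; ring)) (mul_pos_of_neg_of_neg
      (mul_neg_of_pos_of_neg (mul_pos (by linarith) (by linarith)) (by linarith)) (by linarith))
    have i3 := outside (hQ r₁ (by rw [hR]; ring)) (mul_neg_of_pos_of_neg (mul_pos_of_neg_of_neg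
      (mul_neg_of_pos_of_neg (by linarith) (by linarith)) (by linarith)) (by linarith))
    have i4 := outside (hQ r₃ (by rw [hR]; ring)) (mul_neg_of_pos_of_neg (mul_pos
      (mul_pos (by linarith) (by linarith)) (by linarith)) (by linarith))
    have i3 : r₁ < a₂ := i3.resolve_right (by intro; linarith)
    have i4 : a₁ < r₃ := i4.resolve_left (by intro; linarith)
    exact ⟨r₁, r₂, r₃, fun t => by rw [hR]; ring, Or.inl ⟨g1, k1, k2, i3, by linarith, i1, i2,
      by linarith, i4, k3, k4⟩⟩
  have R1 := neg s1 g1.le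
  rcases lt_trichotomy d₂ 0 with g2 | g2 | g2
  rotate_left
  · rw [g2, zero_mul] at s2; exact absurd s2 (lt_irrefl _)
  · -- exactly `d₁` is negative
    have R2 := pos_of_mul_pos_right s2 (by linarith)
    have R3 := neg_of_mul_neg_right s3 (by linarith)
    have R4 := pos_of_mul_pos_right s4 (by linarith)
    obtain ⟨r₂, r₃, r₁, k1, k2, k3, k4, hR⟩ := cubic_factor h23 le_rfl h34
      (mul_neg_of_pos_of_neg R2 R3) (mul_neg_of_neg_of_pos R3 R4)
    rw [hR] at R1
    have k5 := (mul_three_pos_cases R1).1 (mul_pos_of_neg_of_neg (by linarith) (by linarith))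
    obtain ⟨i1, i1'⟩ := inside (hQ r₁ (by rw [hR]; ring)) (mul_pos_of_neg_of_neg
      (mul_neg_of_pos_of_neg (mul_pos_of_neg_of_neg (by linarith) (by linarith)) (by linarith))
      (by linarith))
    obtain ⟨i2', i2⟩ := inside (hQ r₂ (by rw [hR]; ring)) (mul_pos_of_neg_of_neg
      (mul_neg_of_pos_of_neg (mul_pos (by linarith) (by linarith)) (by linarith)) (by linarith))
    have i4 := outside (hQ r₃ (by rw [hR]; ring)) (mul_neg_of_pos_of_neg (mul_pos
      (mul_pos (by linarith) (by linarith)) (by linarith)) (by linarith))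
    have i4 : a₁ < r₃ := i4.resolve_left (by intro; linarith)
    exact ⟨r₁, r₂, r₃, fun t => by rw [hR]; ring, Or.inr (Or.inl ⟨g1, g2, i1, by linarith, k1, k2,
      i2, k3, i4, k4⟩)⟩
  have R2 := neg_of_mul_pos_right s2 g2.le
  rcases lt_trichotomy d₃ 0 with g3 | g3 | g3
  rotate_left
  · rw [g3, zero_mul] at s3; exact absurd s3 (lt_irrefl _)
  · -- exactly `d₁` and `d₂` are negative
    have R3 := neg_of_mul_neg_right s3 (by linarith)
    have R4 := pos_of_mul_pos_right s4 (by linarith)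
    obtain ⟨r₂, r₃, r₁, k1, k2, k3, k4, hR⟩ := cubic_factor h12 h23.le h34
      (mul_neg_of_pos_of_neg R1 R2) (mul_neg_of_neg_of_pos R3 R4)
    rw [hR] at R1
    have k5 := (mul_three_pos_cases R1).1 (mul_pos_of_neg_of_neg (by linarith) (by linarith))
    obtain ⟨i1, i1'⟩ := inside (hQ r₁ (by rw [hR]; ring)) (mul_pos_of_neg_of_neg
      (mul_neg_of_pos_of_neg (mul_pos_of_neg_of_neg (by linarith) (by linarith)) (by linarith))
      (by linarith))
    have i2 := outside (hQ r₂ (by rw [hR]; ring)) (mul_neg_of_pos_of_neg (mul_pos_of_neg_of_neg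
      (mul_neg_of_pos_of_neg (by linarith) (by linarith)) (by linarith)) (by linarith))
    have i2 : a₁ < r₂ := i2.resolve_left (by intro; linarith)
    exact ⟨r₁, r₂, r₃, fun t => by rw [hR]; ring, Or.inr (Or.inr ⟨g2, g3, i1, by linarith, i1', k1,
      i2, k2, k3, k4⟩)⟩
  have R3 := neg s3 g3.le
  -- Three negative dⱼ cannot occur. If d₄ < 0, R has signs +, −, +, − at d₁ < d₂ < d₃ < d₄. If d₄ >
  -- 0, the smallest and the largest root of R lie between a₂ and a₁, whereas the middle one does
  -- not.
  exfalso
  rcases lt_trichotomy d₄ 0 with g4 | g4 | g4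
  · have R4 := neg_of_mul_pos_right s4 g4.le
    exact cubic_divided_difference h12 h23 h34 R1.le R2.le R3.le R4.le
  · rw [g4, zero_mul] at s4; exact absurd s4 (lt_irrefl _)
  · obtain ⟨r₂, r₃, r₁, k1, k2, k3, k4, hR⟩ := cubic_factor h12 le_rfl h23
      (mul_neg_of_pos_of_neg R1 R2) (mul_neg_of_neg_of_pos R2 R3)
    rw [hR] at R1
    have k5 := (mul_three_pos_cases R1).1 (mul_pos_of_neg_of_neg (by linarith) (by linarith))
    obtain ⟨i1, i1'⟩ := inside (hQ r₁ (by rw [hR]; ring)) (mul_pos_of_neg_of_neg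
      (mul_neg_of_pos_of_neg (mul_pos_of_neg_of_neg (by linarith) (by linarith)) (by linarith))
      (by linarith))
    obtain ⟨i2, i2'⟩ := inside (hQ r₃ (by rw [hR]; ring)) (mul_pos_of_neg_of_neg
      (mul_neg_of_pos_of_neg (mul_pos (by linarith) (by linarith)) (by linarith)) (by linarith))
    have i3 := outside (hQ r₂ (by rw [hR]; ring)) (mul_neg_of_pos_of_neg (mul_pos_of_neg_of_neg
      (mul_neg_of_pos_of_neg (by linarith) (by linarith)) (by linarith)) (by linarith))
    rcases i3 with i3 | i3 <;> linarith

/-- The inequalities for the three sign patterns of `a₂ < a₁`. -/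
theorem SexticSplit.inequalities_of_weights
    (h : SexticSplit c₀ c₁ c₂ q₀ q₁ q₂ d₁ d₂ d₃ d₄ a₁ a₂)
    (hq : 0 < q₂) (hd : 0 < q₂ * q₀ - q₁ ^ 2) (h12 : d₁ < d₂) (h23 : d₂ < d₃) (h34 : d₃ < d₄)
    (ha : a₂ < a₁)
    (s1 : d₁ * (d₁ ^ 3 + c₂ * d₁ ^ 2 + c₁ * d₁ + c₀) < 0)
    (s2 : 0 < d₂ * (d₂ ^ 3 + c₂ * d₂ ^ 2 + c₁ * d₂ + c₀))
    (s3 : d₃ * (d₃ ^ 3 + c₂ * d₃ ^ 2 + c₁ * d₃ + c₀) < 0)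
    (s4 : 0 < d₄ * (d₄ ^ 3 + c₂ * d₄ ^ 2 + c₁ * d₄ + c₀)) :
    (0 < a₂ → 0 < d₁ ∧ a₁ + a₂ + d₂ < d₄ + d₃ + d₁ ∧ d₃ + a₂ + d₂ < d₄ + a₁ + d₁ ∧
      d₃ + a₁ + d₁ < d₄ + a₂ + d₂ ∧ d₄ + d₁ + a₂ < d₂ + a₁ + d₃ ∧ d₄ + d₁ + d₂ < a₁ + a₂ + d₃) ∧
    (a₂ < 0 → 0 < a₁ → d₁ < 0 ∧ 0 < d₂ ∧ a₁ + d₂ + d₁ < d₄ + d₃ + a₂ ∧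
      d₃ + d₂ + d₁ < d₄ + a₁ + a₂ ∧ d₃ + a₁ + a₂ < d₄ + d₂ + d₁ ∧
      d₄ + d₂ + a₂ < d₃ + a₁ + d₁ ∧ d₄ + d₁ + a₂ < d₂ + a₁ + d₃) ∧
    (a₁ < 0 → d₂ < 0 ∧ 0 < d₃ ∧ d₃ + a₁ + d₁ < d₄ + d₂ + a₂ ∧ d₂ + a₁ + d₁ < d₄ + d₃ + a₂ ∧
      d₃ + d₂ + a₂ < d₄ + a₁ + d₁ ∧ d₄ + a₁ + a₂ < d₃ + d₂ + d₁ ∧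
      d₄ + d₁ + a₂ < d₂ + a₁ + d₃) := by
  -- Each position forces the signs of a₁ and a₂, so two of the three implications are vacuous. The
  -- third comes from `SexticSplit.inequalities` after the six roots are listed in their order
  -- relative to r₁, r₂, r₃.
  obtain ⟨r₁, r₂, r₃, hR, k | k | k⟩ := h.positions hq hd h12 h23 h34 ha s1 s2 s3 s4
  · obtain ⟨k0, k1, k2, k3, k4, k5, k6, k7, k8, k9, k10⟩ := k
    have hs : SexticSplit c₀ c₁ c₂ q₀ q₁ q₂ d₁ d₂ a₂ d₃ a₁ d₄ := fun t => (h t).trans (by ring)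
    obtain ⟨t1, t2, t3, t4, t5⟩ := hs.inequalities hd hR k1 k2 k3 k4 k5 k7 k6 k9 k8 k10
    refine ⟨fun _ => ⟨k0, ?_, ?_, ?_, ?_, ?_⟩, fun _ _ => ?_, fun _ => ?_⟩ <;> linarith
  · obtain ⟨k0, k1, k2, k3, k4, k5, k6, k7, k8, k9⟩ := k
    have hs : SexticSplit c₀ c₁ c₂ q₀ q₁ q₂ a₂ d₁ d₂ d₃ a₁ d₄ := fun t => (h t).trans (by ring)
    obtain ⟨t1, t2, t3, t4, t5⟩ := hs.inequalities hd hR k2 k3 (by linarith) (by linarith) k4 k5 k6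
      k7 k8 k9
    refine ⟨fun _ => ?_, fun _ _ => ⟨k0, k1, ?_, ?_, ?_, ?_, ?_⟩, fun _ => ?_⟩ <;> linarith
  · obtain ⟨k0, k1, k2, k3, k4, k5, k6, k7, k8, k9⟩ := k
    have hs : SexticSplit c₀ c₁ c₂ q₀ q₁ q₂ a₂ d₁ a₁ d₂ d₃ d₄ := fun t => (h t).trans (by ring)
    obtain ⟨t1, t2, t3, t4, t5⟩ := hs.inequalities hd hR k2 k3 k4 k5 k6 k7 (by linarith)
      (by linarith) k8 k9
    refine ⟨fun _ => ?_, fun _ _ => ?_, fun _ => ⟨k0, k1, ?_, ?_, ?_, ?_, ?_⟩⟩ <;> linarith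

/-- Conversely, the inequalities imply the signs of `dⱼ R(dⱼ)` and the definiteness of `Q`. -/
theorem SexticSplit.weights_of_inequalities
    (h : SexticSplit c₀ c₁ c₂ q₀ q₁ q₂ d₁ d₂ d₃ d₄ a₁ a₂)
    (k : (0 < d₁ ∧ a₁ + a₂ + d₂ < d₄ + d₃ + d₁ ∧ d₃ + a₂ + d₂ < d₄ + a₁ + d₁ ∧
        d₃ + a₁ + d₁ < d₄ + a₂ + d₂ ∧ d₄ + d₁ + a₂ < d₂ + a₁ + d₃ ∧
        d₄ + d₁ + d₂ < a₁ + a₂ + d₃) ∨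
      (d₁ < 0 ∧ 0 < d₂ ∧ a₁ + d₂ + d₁ < d₄ + d₃ + a₂ ∧
        d₃ + d₂ + d₁ < d₄ + a₁ + a₂ ∧ d₃ + a₁ + a₂ < d₄ + d₂ + d₁ ∧
        d₄ + d₂ + a₂ < d₃ + a₁ + d₁ ∧ d₄ + d₁ + a₂ < d₂ + a₁ + d₃) ∨
      (d₂ < 0 ∧ 0 < d₃ ∧ d₃ + a₁ + d₁ < d₄ + d₂ + a₂ ∧ d₂ + a₁ + d₁ < d₄ + d₃ + a₂ ∧
        d₃ + d₂ + a₂ < d₄ + a₁ + d₁ ∧ d₄ + a₁ + a₂ < d₃ + d₂ + d₁ ∧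
        d₄ + d₁ + a₂ < d₂ + a₁ + d₃))
    (h12 : d₁ < d₂) (h23 : d₂ < d₃) (h34 : d₃ < d₄) :
    0 < q₂ ∧ 0 < q₂ * q₀ - q₁ ^ 2 ∧
      d₁ * (d₁ ^ 3 + c₂ * d₁ ^ 2 + c₁ * d₁ + c₀) < 0 ∧
      0 < d₂ * (d₂ ^ 3 + c₂ * d₂ ^ 2 + c₁ * d₂ + c₀) ∧
      d₃ * (d₃ ^ 3 + c₂ * d₃ ^ 2 + c₁ * d₃ + c₀) < 0 ∧
      0 < d₄ * (d₄ ^ 3 + c₂ * d₄ ^ 2 + c₁ * d₄ + c₀) := by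
  rcases k with k | k | k
  · obtain ⟨k0, t1, t2, t3, t4, t5⟩ := k
    have hs : SexticSplit c₀ c₁ c₂ q₀ q₁ q₂ d₁ d₂ a₂ d₃ a₁ d₄ := fun t => (h t).trans (by ring)
    obtain ⟨m1, m2, m3, m4, m5, m6, m7, m8⟩ := hs.signs (by linarith) (by linarith) (by linarith)
      (by linarith) (by linarith)
    exact ⟨m1, m2, mul_neg_of_pos_of_neg k0 m3, mul_pos (by linarith) m4,
      mul_neg_of_pos_of_neg (by linarith) m6, mul_pos (by linarith) m8⟩
  · obtain ⟨k0, k1, t1, t2, t3, t4, t5⟩ := k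
    have hs : SexticSplit c₀ c₁ c₂ q₀ q₁ q₂ a₂ d₁ d₂ d₃ a₁ d₄ := fun t => (h t).trans (by ring)
    obtain ⟨m1, m2, m3, m4, m5, m6, m7, m8⟩ := hs.signs (by linarith) (by linarith) (by linarith)
      (by linarith) (by linarith)
    exact ⟨m1, m2, mul_neg_of_neg_of_pos k0 m4, mul_pos (by linarith) m5,
      mul_neg_of_pos_of_neg (by linarith) m6, mul_pos (by linarith) m8⟩
  · obtain ⟨k0, k1, t1, t2, t3, t4, t5⟩ := k
    have hs : SexticSplit c₀ c₁ c₂ q₀ q₁ q₂ a₂ d₁ a₁ d₂ d₃ d₄ := fun t => (h t).trans (by ring)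
    obtain ⟨m1, m2, m3, m4, m5, m6, m7, m8⟩ := hs.signs (by linarith) (by linarith) (by linarith)
      (by linarith) (by linarith)
    exact ⟨m1, m2, mul_neg_of_neg_of_pos (by linarith) m4, mul_pos_of_neg_of_neg k0 m6,
      mul_neg_of_pos_of_neg (by linarith) m7, mul_pos (by linarith) m8⟩

end Position

end SpectralProblem

namespace SpectralProblem

/-! ### Representations in terms of the images of the generators -/

section Generators

variable {k l m : ℕ} {α : Fin k → ℝ} {β : Fin l → ℝ} {δ : Fin m → ℝ} {γ : ℝ}

/-- A property of elements of `𝒫_{α,β,δ,γ}` can be checked on scalars and generators. -/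
theorem P.induction {motive : P α β δ γ → Prop}
    (scalar : ∀ r : ℂ, motive (algebraMap ℂ _ r)) (gen : ∀ x, motive (P.gen α β δ γ x))
    (mul : ∀ a b, motive a → motive b → motive (a * b))
    (add : ∀ a b, motive a → motive b → motive (a + b)) (a : P α β δ γ) : motive a := by
  obtain ⟨w, rfl⟩ := RingQuot.mkAlgHom_surjective ℂ (Rel α β δ γ) a
  change motive (P.mk α β δ γ w)
  induction w using FreeAlgebra.induction with
  | grade0 r => rw [AlgHom.commutes]; exact scalar r
  | grade1 x => exact gen x
  | mul a b ha hb => rw [map_mul]; exact mul _ _ ha hb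
  | add a b ha hb => rw [map_add]; exact add _ _ ha hb

variable {H : Type*} [NormedAddCommGroup H] [InnerProductSpace ℂ H] [CompleteSpace H]

namespace StarRep

theorem op_star (π : StarRep α β δ γ H) (x : Gen k l m) : star (π.op x) = π.op x := by
  rw [op, ← map_star, P.star_gen]

theorem op_p_mul (π : StarRep α β δ γ H) (i j : Fin k) :
    π.op (.p i) * π.op (.p j) = if i = j then π.op (.p i) else 0 := by
  have h := P.mk_rel α β δ γ (Rel.p_mul i j)
  rw [map_mul] at h
  rw [op, op, ← map_mul]
  refine (congrArg π h).trans ?_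
  split_ifs
  · rfl
  · rw [map_zero, map_zero]

theorem op_q_mul (π : StarRep α β δ γ H) (i j : Fin l) :
    π.op (.q i) * π.op (.q j) = if i = j then π.op (.q i) else 0 := by
  have h := P.mk_rel α β δ γ (Rel.q_mul i j)
  rw [map_mul] at h
  rw [op, op, ← map_mul]
  refine (congrArg π h).trans ?_
  split_ifs
  · rfl
  · rw [map_zero, map_zero]

theorem op_s_mul (π : StarRep α β δ γ H) (i j : Fin m) :
    π.op (.s i) * π.op (.s j) = if i = j then π.op (.s i) else 0 := by
  have h := P.mk_rel α β δ γ (Rel.s_mul i j)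
  rw [map_mul] at h
  rw [op, op, ← map_mul]
  refine (congrArg π h).trans ?_
  split_ifs
  · rfl
  · rw [map_zero, map_zero]

theorem op_sum (π : StarRep α β δ γ H) :
    ∑ i, (α i : ℂ) • π.op (.p i) + ∑ j, (β j : ℂ) • π.op (.q j) + ∑ d, (δ d : ℂ) • π.op (.s d) =
      (γ : ℂ) • 1 := by
  have h := congrArg π (P.mk_rel α β δ γ Rel.sum)
  simp only [map_add, map_sum, map_smul, map_one] at h
  exact h

theorem map_mem_of_gen (π : StarRep α β δ γ H) {K : Submodule ℂ H}
    (h : ∀ x, ∀ y ∈ K, π.op x y ∈ K) (a : P α β δ γ) : ∀ y ∈ K, π a y ∈ K := by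
  induction a using P.induction with
  | scalar r =>
    intro y hy
    rw [AlgHomClass.commutes, Algebra.algebraMap_eq_smul_one]
    exact K.smul_mem r hy
  | gen x => exact h x
  | mul a b ha hb => intro y hy; rw [map_mul]; exact ha _ (hb _ hy)
  | add a b ha hb => intro y hy; rw [map_add]; exact K.add_mem (ha _ hy) (hb _ hy)

theorem IsIrreducible.eq_bot_or_top {π : StarRep α β δ γ H} (hπ : π.IsIrreducible)
    (K : Submodule ℂ H) [FiniteDimensional ℂ K] (h : ∀ x, ∀ y ∈ K, π.op x y ∈ K) :
    K = ⊥ ∨ K = ⊤ :=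
  hπ.2 K K.closed_of_finiteDimensional (π.map_mem_of_gen h)

/-- Operators that satisfy the defining relations define a representation. -/
theorem exists_of_relations (T : Gen k l m → H →L[ℂ] H) (hT : ∀ x, star (T x) = T x)
    (hp : ∀ i j, T (.p i) * T (.p j) = if i = j then T (.p i) else 0)
    (hq : ∀ i j, T (.q i) * T (.q j) = if i = j then T (.q i) else 0)
    (hs : ∀ i j, T (.s i) * T (.s j) = if i = j then T (.s i) else 0)
    (hsum : ∑ i, (α i : ℂ) • T (.p i) + ∑ j, (β j : ℂ) • T (.q j) + ∑ d, (δ d : ℂ) • T (.s d) =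
      (γ : ℂ) • 1) :
    ∃ π : StarRep α β δ γ H, ∀ x, π.op x = T x := by
  let F : FreeAlgebra ℂ (Gen k l m) →ₐ[ℂ] (H →L[ℂ] H) := FreeAlgebra.lift ℂ T
  have hF : ∀ x, F (FreeAlgebra.ι ℂ x) = T x := FreeAlgebra.lift_ι_apply T
  have hrel : ∀ ⦃a b⦄, Rel α β δ γ a b → F a = F b := by
    intro a b h
    cases h with
    | p_mul i j => rw [map_mul, hF, hF, hp]; split_ifs <;> simp [hF]
    | q_mul i j => rw [map_mul, hF, hF, hq]; split_ifs <;> simp [hF]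
    | s_mul i j => rw [map_mul, hF, hF, hs]; split_ifs <;> simp [hF]
    | sum => simp only [map_add, map_sum, map_smul, map_one, hF, hsum]
  let G : P α β δ γ →ₐ[ℂ] (H →L[ℂ] H) := RingQuot.liftAlgHom ℂ ⟨F, hrel⟩
  have hG : ∀ x, G (P.gen α β δ γ x) = T x := fun x =>
    (RingQuot.liftAlgHom_mkAlgHom_apply ℂ F hrel (FreeAlgebra.ι ℂ x)).trans (hF x)
  have hstar : ∀ a, G (star a) = star (G a) := by
    intro a
    induction a using P.induction with
    | scalar r =>
      rw [Algebra.algebraMap_eq_smul_one, star_smul, star_one, map_smul, map_smul, map_one,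
        star_smul, star_one]
    | gen x => rw [P.star_gen, hG, hT]
    | mul a b ha hb => rw [star_mul, map_mul, map_mul, star_mul, ha, hb]
    | add a b ha hb => rw [star_add, map_add, map_add, star_add, ha, hb]
  exact ⟨{ G with map_star' := hstar }, hG⟩

end StarRep

end Generators

end SpectralProblem

namespace SpectralProblem

/-! ### The chain argument for resolutions of the identity -/

section IdempotentSystem

/-- Two resolutions of the identity `E`, `F` into three and four idempotents and an idempotent `s`
with `∑ aᵢ Eᵢ + ∑ bⱼ Fⱼ + δ s = γ`. -/
structure IsIdempotentSystem {V : Type*} [AddCommGroup V] [Module ℂ V]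
    (E : Fin 3 → Module.End ℂ V) (F : Fin 4 → Module.End ℂ V) (s : Module.End ℂ V)
    (a : Fin 3 → ℂ) (b : Fin 4 → ℂ) (δ γ : ℂ) : Prop where
  E_mul : ∀ i j, E i * E j = if i = j then E i else 0
  E_sum : ∑ i, E i = 1
  F_mul : ∀ i j, F i * F j = if i = j then F i else 0
  F_sum : ∑ j, F j = 1
  s_mul : s * s = s
  rel : ∑ i, a i • E i + ∑ j, b j • F j + δ • s = γ • 1

variable {V V' : Type*} [AddCommGroup V] [Module ℂ V] [AddCommGroup V'] [Module ℂ V']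

theorem aeval_sum_smul_idempotents {n : ℕ} {E : Fin n → Module.End ℂ V}
    (hmul : ∀ i j, E i * E j = if i = j then E i else 0) (hsum : ∑ i, E i = 1) (a : Fin n → ℂ)
    (p : Polynomial ℂ) : Polynomial.aeval (∑ i, a i • E i) p = ∑ i, p.eval (a i) • E i := by
  induction p using Polynomial.induction_on' with
  | add p q hp hq => simp [hp, hq, add_smul, Finset.sum_add_distrib]
  | monomial k r =>
    have hpow : ∀ k : ℕ, (∑ i, a i • E i) ^ k = ∑ i, a i ^ k • E i := by
      intro k
      induction k with
      | zero => simp [hsum]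
      | succ k ih =>
        rw [pow_succ, ih, Finset.sum_mul]
        refine Finset.sum_congr rfl fun i _ => ?_
        simp [Finset.mul_sum, hmul, smul_smul, pow_succ, mul_comm]
    rw [Polynomial.aeval_monomial, hpow, Algebra.algebraMap_eq_smul_one, smul_mul_assoc, one_mul,
      Finset.smul_sum]
    simp [smul_smul, Polynomial.eval_monomial]

/-- As the a i are distinct, E i is the value of a Lagrange basis polynomial at ∑ aᵢEᵢ. -/
theorem idempotent_mem_of_sum_mem {n : ℕ} {E : Fin n → Module.End ℂ V}
    (hmul : ∀ i j, E i * E j = if i = j then E i else 0) (hsum : ∑ i, E i = 1) {a : Fin n → ℂ}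
    (ha : Function.Injective a) {K : Submodule ℂ V}
    (h : ∀ x ∈ K, (∑ i, a i • E i) x ∈ K) (i : Fin n) : ∀ x ∈ K, E i x ∈ K := by
  have hE : E i = Polynomial.aeval (∑ i, a i • E i) (Lagrange.basis Finset.univ a i) := by
    rw [aeval_sum_smul_idempotents hmul hsum, Finset.sum_eq_single i]
    · rw [Lagrange.eval_basis_self ha.injOn (Finset.mem_univ i), one_smul]
    · intro j _ hj
      rw [Lagrange.eval_basis_of_ne hj.symm (Finset.mem_univ j), zero_smul]
    · simp
  intro x hx
  rw [hE]
  induction Lagrange.basis Finset.univ a i using Polynomial.induction_on with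
  | C r => rw [Polynomial.aeval_C]; exact K.smul_mem r hx
  | add p q hp hq => rw [map_add]; exact K.add_mem hp hq
  | monomial k r hk =>
    rw [pow_succ', ← mul_assoc, mul_comm (Polynomial.C r), mul_assoc, map_mul, Polynomial.aeval_X]
    exact h _ hk

variable {E : Fin 3 → Module.End ℂ V} {F : Fin 4 → Module.End ℂ V} {s : Module.End ℂ V}
  {a : Fin 3 → ℂ} {b : Fin 4 → ℂ} {δ γ : ℂ}

theorem IsIdempotentSystem.permF (h : IsIdempotentSystem E F s a b δ γ) (e : Equiv.Perm (Fin 4)) :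
    IsIdempotentSystem E (F ∘ e) s a (b ∘ e) δ γ where
  E_mul := h.E_mul
  E_sum := h.E_sum
  F_mul i j := by simp [h.F_mul]
  F_sum := (Equiv.sum_comp e F).trans h.F_sum
  s_mul := h.s_mul
  rel := by
    rw [← h.rel, ← Equiv.sum_comp e (fun j => b j • F j)]
    rfl

/-- Uniqueness compares two systems with the same parameters inside V × V'. Such a direct sum is not
irreducible, which is why this structure consists of algebraic identities only. -/
theorem IsIdempotentSystem.prod {E' : Fin 3 → Module.End ℂ V'} {F' : Fin 4 → Module.End ℂ V'}
    {s' : Module.End ℂ V'} (h : IsIdempotentSystem E F s a b δ γ)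
    (h' : IsIdempotentSystem E' F' s' a b δ γ) :
    IsIdempotentSystem (fun i => (E i).prodMap (E' i)) (fun j => (F j).prodMap (F' j))
      (s.prodMap s') a b δ γ where
  E_mul i j := by
    refine LinearMap.ext fun x => Prod.ext ?_ ?_
    · refine (LinearMap.congr_fun (h.E_mul i j) x.1).trans ?_
      split_ifs <;> rfl
    · refine (LinearMap.congr_fun (h'.E_mul i j) x.2).trans ?_
      split_ifs <;> rfl
  E_sum := by
    refine LinearMap.ext fun x => Prod.ext ?_ ?_
    · simpa [Prod.fst_sum] using LinearMap.congr_fun h.E_sum x.1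
    · simpa [Prod.snd_sum] using LinearMap.congr_fun h'.E_sum x.2
  F_mul i j := by
    refine LinearMap.ext fun x => Prod.ext ?_ ?_
    · refine (LinearMap.congr_fun (h.F_mul i j) x.1).trans ?_
      split_ifs <;> rfl
    · refine (LinearMap.congr_fun (h'.F_mul i j) x.2).trans ?_
      split_ifs <;> rfl
  F_sum := by
    refine LinearMap.ext fun x => Prod.ext ?_ ?_
    · simpa [Prod.fst_sum] using LinearMap.congr_fun h.F_sum x.1
    · simpa [Prod.snd_sum] using LinearMap.congr_fun h'.F_sum x.2
  s_mul := by
    refine LinearMap.ext fun x => Prod.ext ?_ ?_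
    · exact LinearMap.congr_fun h.s_mul x.1
    · exact LinearMap.congr_fun h'.s_mul x.2
  rel := by
    refine LinearMap.ext fun x => Prod.ext ?_ ?_
    · simpa [Prod.fst_sum] using LinearMap.congr_fun h.rel x.1
    · simpa [Prod.snd_sum] using LinearMap.congr_fun h'.rel x.2

/-- The vectors in the range of `F₀` lie in finite dimensional invariant subspaces; the image of such
a subspace under `F₀` is a line if it is generated by an eigenvector of `F₀ s`. -/
theorem IsIdempotentSystem.exists_invariant (h : IsIdempotentSystem E F s a b δ γ)
    (ha : Function.Injective a) (hb : Function.Injective b) (hδ : δ ≠ 0) {ξ : V}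
    (hξ : F 0 ξ = ξ) :
    ∃ W : Submodule ℂ V, FiniteDimensional ℂ W ∧ ξ ∈ W ∧ (∀ i, ∀ x ∈ W, E i x ∈ W) ∧
      (∀ j, ∀ x ∈ W, F j x ∈ W) ∧ (∀ x ∈ W, s x ∈ W) ∧
      ∀ c : ℂ, F 0 (s ξ) = c • ξ → ∀ x ∈ W, F 0 x ∈ Submodule.span ℂ {ξ} := by
  set A := ∑ i, a i • E i with hA
  set B := ∑ j, b j • F j with hB
  set C := δ • s with hC
  have hAp := aeval_sum_smul_idempotents h.E_mul h.E_sum a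
  have hBp := aeval_sum_smul_idempotents h.F_mul h.F_sum b
  rw [← hA] at hAp
  rw [← hB] at hBp
  have hBx : ∀ x, B x = γ • x - A x - C x := fun x => by
    have := LinearMap.congr_fun h.rel x
    simp only [LinearMap.add_apply, LinearMap.smul_apply, Module.End.one_apply] at this
    rw [← this, hC, LinearMap.smul_apply]; abel
  have hCx : ∀ x, C (C x) = δ • C x := fun x => by
    simp only [hC, LinearMap.smul_apply, map_smul]
    rw [← Module.End.mul_apply, h.s_mul]
  have hAx : ∀ x, A (A (A x)) = (a 0 + a 1 + a 2) • A (A x)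
      + (-(a 0 * a 1 + a 0 * a 2 + a 1 * a 2)) • A x + (a 0 * a 1 * a 2) • x := fun x => by
    have e : ∀ k : ℕ, (A ^ k) x = a 0 ^ k • E 0 x + a 1 ^ k • E 1 x + a 2 ^ k • E 2 x :=
      fun k => by simpa [Fin.sum_univ_three] using LinearMap.congr_fun (hAp (Polynomial.X ^ k)) x
    have e0 : x = E 0 x + E 1 x + E 2 x := by simpa using e 0
    have e1 : A x = a 0 • E 0 x + a 1 • E 1 x + a 2 • E 2 x := by simpa using e 1
    have e2 : A (A x) = a 0 ^ 2 • E 0 x + a 1 ^ 2 • E 1 x + a 2 ^ 2 • E 2 x := e 2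
    have e3 : A (A (A x)) = a 0 ^ 3 • E 0 x + a 1 ^ 3 • E 1 x + a 2 ^ 3 • E 2 x := e 3
    have e4 : (a 0 * a 1 * a 2) • x =
        (a 0 * a 1 * a 2) • E 0 x + (a 0 * a 1 * a 2) • E 1 x + (a 0 * a 1 * a 2) • E 2 x := by
      rw [← smul_add, ← smul_add, ← e0]
    rw [e3, e2, e1, e4]
    module
  have hBpow : ∀ x, x = F 0 x + F 1 x + F 2 x + F 3 x ∧
      B x = b 0 • F 0 x + b 1 • F 1 x + b 2 • F 2 x + b 3 • F 3 x ∧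
      B (B x) = b 0 ^ 2 • F 0 x + b 1 ^ 2 • F 1 x + b 2 ^ 2 • F 2 x + b 3 ^ 2 • F 3 x ∧
      B (B (B x)) = b 0 ^ 3 • F 0 x + b 1 ^ 3 • F 1 x + b 2 ^ 3 • F 2 x + b 3 ^ 3 • F 3 x ∧
      B (B (B (B x))) =
        b 0 ^ 4 • F 0 x + b 1 ^ 4 • F 1 x + b 2 ^ 4 • F 2 x + b 3 ^ 4 • F 3 x := fun x => by
    have e : ∀ k : ℕ, (B ^ k) x =
        b 0 ^ k • F 0 x + b 1 ^ k • F 1 x + b 2 ^ k • F 2 x + b 3 ^ k • F 3 x := fun k => by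
      have := LinearMap.congr_fun (hBp (Polynomial.X ^ k)) x
      simpa [Fin.sum_univ_four] using this
    exact ⟨by simpa using e 0, by simpa using e 1, e 2, e 3, e 4⟩
  have hB4 : ∀ x, B (B (B (B x))) = (b 0 + b 1 + b 2 + b 3) • B (B (B x))
      + (-(b 0 * b 1 + b 0 * b 2 + b 0 * b 3 + b 1 * b 2 + b 1 * b 3 + b 2 * b 3)) • B (B x)
      + (b 0 * b 1 * b 2 + b 0 * b 1 * b 3 + b 0 * b 2 * b 3 + b 1 * b 2 * b 3) • B x
      + (-(b 0 * b 1 * b 2 * b 3)) • x := fun x => by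
    obtain ⟨e0, e1, e2, e3, e4⟩ := hBpow x
    rw [e4, e3, e2, e1]
    conv_rhs => rw [e0]
    simp only [map_add]
    have k : ∀ i j, F i (F j x) = if i = j then F i x else 0 := fun i j => by
      rw [← Module.End.mul_apply, h.F_mul]; split_ifs <;> simp
    simp only [k]
    simp
    module
  have hne : ∀ j : Fin 4, j ≠ 0 → b 0 - b j ≠ 0 := fun j hj => sub_ne_zero.2 (hb.ne hj.symm)
  have hκ : (b 0 - b 1) * (b 0 - b 2) * (b 0 - b 3) ≠ 0 :=
    mul_ne_zero (mul_ne_zero (hne 1 (by decide)) (hne 2 (by decide))) (hne 3 (by decide))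
  -- Lagrange interpolation: F₀ is the product over j ≠ 0 of (B − bⱼ)/(b₀ − bⱼ).
  have hF0 : ∀ x, F 0 x = ((b 0 - b 1) * (b 0 - b 2) * (b 0 - b 3))⁻¹ • (B (B (B x))
      + (-(b 1 + b 2 + b 3)) • B (B x) + (b 1 * b 2 + b 1 * b 3 + b 2 * b 3) • B x
      + (-(b 1 * b 2 * b 3)) • x) := fun x => by
    rw [eq_inv_smul_iff₀ hκ]
    obtain ⟨e0, e1, e2, e3, -⟩ := hBpow x
    rw [e3, e2, e1]
    conv_rhs => rw [e0]
    simp only [map_add]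
    have k : ∀ i j, F i (F j x) = if i = j then F i x else 0 := fun i j => by
      rw [← Module.End.mul_apply, h.F_mul]; split_ifs <;> simp
    simp only [k]
    simp
    module
  have hFF : ∀ i j x, F i (F j x) = if i = j then F i x else 0 := fun i j x => by
    rw [← Module.End.mul_apply, h.F_mul]; split_ifs <;> simp
  have hFB : ∀ x, F 0 (B x) = b 0 • F 0 x := fun x => by
    rw [(hBpow x).2.1]; simp [hFF]
  have hBξ : B ξ = b 0 • ξ := by
    rw [(hBpow ξ).2.1, ← hξ]; simp [hFF]
  have hAξ : A ξ = (γ - b 0) • ξ - C ξ := by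
    have := hBx ξ
    rw [hBξ] at this
    rw [sub_smul, this]; abel
  obtain ⟨iA, iC⟩ := chainSpan_invariant hBx hCx hAx hB4 hAξ
  have iB : ∀ x ∈ chainSpan A C ξ, B x ∈ chainSpan A C ξ := fun x hx => by
    rw [hBx]
    exact Submodule.sub_mem _ (Submodule.sub_mem _ (Submodule.smul_mem _ _ hx) (iA x hx)) (iC x hx)
  refine ⟨chainSpan A C ξ, inferInstance, self_mem_chainSpan _ _ _,
    idempotent_mem_of_sum_mem h.E_mul h.E_sum ha iA,
    idempotent_mem_of_sum_mem h.F_mul h.F_sum hb iB, fun x hx => ?_, fun c hc => ?_⟩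
  · have := Submodule.smul_mem _ δ⁻¹ (iC x hx)
    rwa [hC, LinearMap.smul_apply, inv_smul_smul₀ hδ] at this
  · refine map_chainSpan_mem_span (inv_ne_zero hκ) hBx hCx hAx hF0 hFB hBξ hξ (x := δ * c) ?_
    rw [hC, LinearMap.smul_apply, map_smul, hc, smul_smul]

end IdempotentSystem

end SpectralProblem

namespace SpectralProblem

/-! ### Dimension and ranks in the irreducible case -/

section ProjectionSystem

variable {H : Type*} [NormedAddCommGroup H] [InnerProductSpace ℂ H]

theorem trace_eq_finrank_range [FiniteDimensional ℂ H] {T : H →L[ℂ] H} (hT : ∀ x, T (T x) = T x) :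
    LinearMap.trace ℂ H (T : H →ₗ[ℂ] H) = (Module.finrank ℂ T.range : ℂ) :=
  LinearMap.IsProj.trace ⟨fun x => ⟨x, rfl⟩, by rintro _ ⟨y, rfl⟩; exact hT y⟩

theorem exists_range_vector {T : H →L[ℂ] H} (hT : ∀ x, T (T x) = T x) (h0 : T ≠ 0) :
    ∃ ξ, T ξ = ξ ∧ ξ ≠ 0 := by
  obtain ⟨x, hx⟩ : ∃ x, T x ≠ 0 := by
    by_contra hc
    push Not at hc
    exact h0 (ContinuousLinearMap.ext hc)
  exact ⟨T x, hT x, hx⟩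

variable [CompleteSpace H]

/-- Two resolutions of the identity `E`, `F` into three and four nonzero orthogonal projections and a
nontrivial orthogonal projection `s` with `∑ aᵢ Eᵢ + ∑ bⱼ Fⱼ + δ s = γ`, without common finite
dimensional invariant subspaces. -/
structure IsProjectionSystem (E : Fin 3 → H →L[ℂ] H) (F : Fin 4 → H →L[ℂ] H) (s : H →L[ℂ] H)
    (a : Fin 3 → ℝ) (b : Fin 4 → ℝ) (δ γ : ℝ) : Prop where
  sys : IsIdempotentSystem (fun i => (E i : H →ₗ[ℂ] H)) (fun j => (F j : H →ₗ[ℂ] H))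
    (s : H →ₗ[ℂ] H) (fun i => (a i : ℂ)) (fun j => (b j : ℂ)) δ γ
  E_star : ∀ i, star (E i) = E i
  F_star : ∀ j, star (F j) = F j
  s_star : star s = s
  E_ne : ∀ i, E i ≠ 0
  F_ne : ∀ j, F j ≠ 0
  s_ne_zero : s ≠ 0
  s_ne_one : s ≠ 1
  irr : ∀ K : Submodule ℂ H, FiniteDimensional ℂ K → (∀ i, ∀ x ∈ K, E i x ∈ K) →
    (∀ j, ∀ x ∈ K, F j x ∈ K) → (∀ x ∈ K, s x ∈ K) → K = ⊥ ∨ K = ⊤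

variable {E : Fin 3 → H →L[ℂ] H} {F : Fin 4 → H →L[ℂ] H} {s : H →L[ℂ] H}
  {a : Fin 3 → ℝ} {b : Fin 4 → ℝ} {δ γ : ℝ}

namespace IsProjectionSystem

theorem permF (h : IsProjectionSystem E F s a b δ γ) (e : Equiv.Perm (Fin 4)) :
    IsProjectionSystem E (F ∘ e) s a (b ∘ e) δ γ where
  sys := h.sys.permF e
  E_star := h.E_star
  F_star j := h.F_star _
  s_star := h.s_star
  E_ne := h.E_ne
  F_ne j := h.F_ne _
  s_ne_zero := h.s_ne_zero
  s_ne_one := h.s_ne_one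
  irr K hK hE hF hs := h.irr K hK hE (fun j x hx => by
    have := hF (e.symm j) x hx
    rwa [Function.comp_apply, Equiv.apply_symm_apply] at this) hs

theorem E_apply (h : IsProjectionSystem E F s a b δ γ) (i j : Fin 3) (x : H) :
    E i (E j x) = if i = j then E i x else 0 := by
  refine (LinearMap.congr_fun (h.sys.E_mul i j) x).trans ?_
  split_ifs <;> rfl

theorem F_apply (h : IsProjectionSystem E F s a b δ γ) (i j : Fin 4) (x : H) :
    F i (F j x) = if i = j then F i x else 0 := by
  refine (LinearMap.congr_fun (h.sys.F_mul i j) x).trans ?_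
  split_ifs <;> rfl

theorem s_apply (h : IsProjectionSystem E F s a b δ γ) (x : H) : s (s x) = s x :=
  LinearMap.congr_fun h.sys.s_mul x

theorem E_sum_apply (h : IsProjectionSystem E F s a b δ γ) (x : H) : ∑ i, E i x = x := by
  simpa using LinearMap.congr_fun h.sys.E_sum x

theorem F_sum_apply (h : IsProjectionSystem E F s a b δ γ) (x : H) : ∑ j, F j x = x := by
  simpa using LinearMap.congr_fun h.sys.F_sum x

theorem rel_apply (h : IsProjectionSystem E F s a b δ γ) (x : H) :
    ∑ i, (a i : ℂ) • E i x + ∑ j, (b j : ℂ) • F j x + (δ : ℂ) • s x = (γ : ℂ) • x := by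
  simpa using LinearMap.congr_fun h.sys.rel x

/-- By irreducibility the invariant subspace generated by ξ is all of H. -/
theorem exists_invariant (h : IsProjectionSystem E F s a b δ γ) (ha : Function.Injective a)
    (hb : Function.Injective b) (hδ : δ ≠ 0) {ξ : H} (hξ : F 0 ξ = ξ) (h0 : ξ ≠ 0) :
    FiniteDimensional ℂ H ∧ ∀ c : ℂ, F 0 (s ξ) = c • ξ → ∀ x, F 0 x ∈ Submodule.span ℂ {ξ} := by
  obtain ⟨W, hW, hmem, hE, hF, hs, hc⟩ := h.sys.exists_invariant
    (Complex.ofReal_injective.comp ha) (Complex.ofReal_injective.comp hb)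
    (Complex.ofReal_ne_zero.2 hδ) hξ
  have hT : W = ⊤ := (h.irr W hW hE hF hs).resolve_left fun hbot => h0 (by
    rw [hbot] at hmem; exact (Submodule.mem_bot ℂ).1 hmem)
  subst hT
  exact ⟨⟨Module.Finite.iff_fg.1 hW⟩,
    fun c k x => hc c k x trivial⟩

theorem finiteDimensional (h : IsProjectionSystem E F s a b δ γ) (ha : Function.Injective a)
    (hb : Function.Injective b) (hδ : δ ≠ 0) : FiniteDimensional ℂ H := by
  obtain ⟨ξ, h1, h2⟩ := exists_range_vector (fun x => by rw [h.F_apply, if_pos rfl]) (h.F_ne 0)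
  exact (h.exists_invariant ha hb hδ h1 h2).1

/-- Over ℂ the compression of s to the finite dimensional range of F₀ has an eigenvector η. Its
chain fills H, and F₀ maps that chain into the line through η. The other indices follow by permuting
the Fⱼ. -/
theorem finrank_range_F (h : IsProjectionSystem E F s a b δ γ) (ha : Function.Injective a)
    (hb : Function.Injective b) (hδ : δ ≠ 0) (j : Fin 4) : Module.finrank ℂ (F j).range = 1 := by
  have key : ∀ {F : Fin 4 → H →L[ℂ] H} {b : Fin 4 → ℝ}, Function.Injective b →
      IsProjectionSystem E F s a b δ γ → Module.finrank ℂ (F 0).range = 1 := by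
    intro F b hb h
    have := h.finiteDimensional ha hb hδ
    have hFF : ∀ x, F 0 (F 0 x) = F 0 x := fun x => by rw [h.F_apply, if_pos rfl]
    obtain ⟨ξ, h1, h2⟩ := exists_range_vector hFF (h.F_ne 0)
    have : Nontrivial (F 0).range := ⟨⟨ξ, ξ, h1⟩, 0, fun k => h2 (congrArg Subtype.val k)⟩
    let T : Module.End ℂ (F 0).range :=
      ((F 0 : H →ₗ[ℂ] H) ∘ₗ (s : H →ₗ[ℂ] H)).restrict (fun x _ => ⟨s x, rfl⟩)
    obtain ⟨c, hc⟩ := Module.End.exists_eigenvalue T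
    obtain ⟨⟨η, ζ, hζ⟩, hη⟩ := hc.exists_hasEigenvector
    have e1 : F 0 η = η := by rw [← hζ]; exact hFF ζ
    have e0 : η ≠ 0 := fun k => hη.2 (Subtype.ext k)
    have e2 : F 0 (s η) = c • η := congrArg Subtype.val hη.apply_eq_smul
    have e3 := (h.exists_invariant ha hb hδ e1 e0).2 c e2
    have : (F 0).range = Submodule.span ℂ {η} := by
      apply le_antisymm
      · rintro _ ⟨x, rfl⟩; exact e3 x
      · rw [Submodule.span_singleton_le_iff_mem]; exact ⟨η, e1⟩
    rw [this, finrank_span_singleton e0]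
  have := key (hb.comp (Equiv.swap 0 j).injective) (h.permF (Equiv.swap 0 j))
  rwa [Function.comp_apply, Equiv.swap_apply_left] at this

theorem finrank_eq (h : IsProjectionSystem E F s a b δ γ) (ha : Function.Injective a)
    (hb : Function.Injective b) (hδ : δ ≠ 0) : Module.finrank ℂ H = 4 := by
  have := h.finiteDimensional ha hb hδ
  have h1 := congrArg (LinearMap.trace ℂ H) h.sys.F_sum
  rw [map_sum, LinearMap.trace_one, Finset.sum_congr rfl (fun j _ => (trace_eq_finrank_range
    (T := F j) (fun x => by rw [h.F_apply, if_pos rfl])).trans (congrArg Nat.cast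
      (h.finrank_range_F ha hb hδ j)))] at h1
  have : (4 : ℂ) = Module.finrank ℂ H := by simpa using h1
  exact_mod_cast this.symm

theorem sum_finrank_range_E (h : IsProjectionSystem E F s a b δ γ) [FiniteDimensional ℂ H] :
    ∑ i, Module.finrank ℂ (E i).range = Module.finrank ℂ H := by
  have h1 := congrArg (LinearMap.trace ℂ H) h.sys.E_sum
  rw [map_sum, LinearMap.trace_one, Finset.sum_congr rfl (fun j _ => trace_eq_finrank_range
    (T := E j) (fun x => by rw [h.E_apply, if_pos rfl]))] at h1
  exact_mod_cast h1

theorem finrank_range_E_pos (h : IsProjectionSystem E F s a b δ γ) [FiniteDimensional ℂ H]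
    (i : Fin 3) : 0 < Module.finrank ℂ (E i).range := by
  obtain ⟨ξ, h1, h2⟩ := exists_range_vector (fun x => by rw [h.E_apply, if_pos rfl]) (h.E_ne i)
  have : Nontrivial (E i).range := ⟨⟨ξ, ξ, h1⟩, 0, fun k => h2 (congrArg Subtype.val k)⟩
  exact Module.finrank_pos

/-- There are no common eigenvectors of `E i` and `s`. -/
theorem eq_zero_of_E (h : IsProjectionSystem E F s a b δ γ)
    (hb : Function.Injective b) (hH : Module.finrank ℂ H = 4) {i : Fin 3} {x : H} {c : ℂ}
    (h1 : E i x = x) (h2 : s x = c • x) : x = 0 := by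
  by_contra h0
  have hE : ∀ j, E j x = if j = i then x else 0 := fun j => by
    conv_lhs => rw [← h1]
    rw [h.E_apply]
    split_ifs with hj
    · rw [hj, h1]
    · rfl
  have hsub : ∀ {T : H →L[ℂ] H} {r : ℂ}, T x = r • x → ∀ y ∈ Submodule.span ℂ {x},
      T y ∈ Submodule.span ℂ {x} := by
    intro T r hr y hy
    obtain ⟨z, rfl⟩ := Submodule.mem_span_singleton.1 hy
    rw [map_smul, hr]
    exact Submodule.smul_mem _ _ (Submodule.smul_mem _ _ (Submodule.mem_span_singleton_self x))
  -- A common eigenvector of E i and s is also an eigenvector of ∑ bⱼFⱼ, so its line is invariant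
  -- under everything, contradicting dimension 4.
  have hB : (∑ j, (b j : ℂ) • F j) x = ((γ : ℂ) - a i - δ * c) • x := by
    have := h.rel_apply x
    simp only [hE, h2, smul_ite, smul_zero, Finset.sum_ite_eq', Finset.mem_univ, if_true] at this
    rw [sub_smul, sub_smul, ← this]
    simp only [smul_smul]
    abel
  have hF := idempotent_mem_of_sum_mem h.sys.F_mul h.sys.F_sum (Complex.ofReal_injective.comp hb)
    (K := Submodule.span ℂ {x}) (fun y hy => by simpa using hsub hB y hy)
  rcases h.irr (Submodule.span ℂ {x}) inferInstance
    (fun j => hsub (r := if j = i then 1 else 0) (by rw [hE]; split_ifs <;> simp))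
    hF (hsub h2) with k | k
  · exact h0 (Submodule.span_singleton_eq_bot.1 k)
  · have := finrank_span_singleton (K := ℂ) h0
    rw [k, finrank_top, hH] at this
    omega

/-- There are no common eigenvectors of `F j` and `s`. -/
theorem eq_zero_of_F (h : IsProjectionSystem E F s a b δ γ)
    (ha : Function.Injective a) (hH : Module.finrank ℂ H = 4) {i : Fin 4} {x : H} {c : ℂ}
    (h1 : F i x = x) (h2 : s x = c • x) : x = 0 := by
  by_contra h0
  have hE : ∀ j, F j x = if j = i then x else 0 := fun j => by
    conv_lhs => rw [← h1]
    rw [h.F_apply]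
    split_ifs with hj
    · rw [hj, h1]
    · rfl
  have hsub : ∀ {T : H →L[ℂ] H} {r : ℂ}, T x = r • x → ∀ y ∈ Submodule.span ℂ {x},
      T y ∈ Submodule.span ℂ {x} := by
    intro T r hr y hy
    obtain ⟨z, rfl⟩ := Submodule.mem_span_singleton.1 hy
    rw [map_smul, hr]
    exact Submodule.smul_mem _ _ (Submodule.smul_mem _ _ (Submodule.mem_span_singleton_self x))
  have hB : (∑ j, (a j : ℂ) • E j) x = ((γ : ℂ) - b i - δ * c) • x := by
    have := h.rel_apply x
    simp only [hE, h2, smul_ite, smul_zero, Finset.sum_ite_eq', Finset.mem_univ, if_true] at this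
    rw [sub_smul, sub_smul, ← this]
    simp only [smul_smul]
    abel
  have hF := idempotent_mem_of_sum_mem h.sys.E_mul h.sys.E_sum (Complex.ofReal_injective.comp ha)
    (K := Submodule.span ℂ {x}) (fun y hy => by simpa using hsub hB y hy)
  rcases h.irr (Submodule.span ℂ {x}) inferInstance hF
    (fun j => hsub (r := if j = i then 1 else 0) (by rw [hE]; split_ifs <;> simp))
    (hsub h2) with k | k
  · exact h0 (Submodule.span_singleton_eq_bot.1 k)
  · have := finrank_span_singleton (K := ℂ) h0
    rw [k, finrank_top, hH] at this
    omega

/-- Three ranks with sum 4 include one that is at least 2. The range of that E i meets neither the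
range nor the kernel of s, since a common vector would be a common eigenvector; so both have
dimension at most 2, and their dimensions add up to 4. -/
theorem finrank_range_s (h : IsProjectionSystem E F s a b δ γ) (ha : Function.Injective a)
    (hb : Function.Injective b) (hδ : δ ≠ 0) : Module.finrank ℂ s.range = 2 := by
  have := h.finiteDimensional ha hb hδ
  have hH := h.finrank_eq ha hb hδ
  obtain ⟨i, hi⟩ : ∃ i, 2 ≤ Module.finrank ℂ (E i).range := by
    by_contra hc
    push Not at hc
    have h1 := h.sum_finrank_range_E
    rw [Fin.sum_univ_three] at h1
    have := hc 0
    have := hc 1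
    have := hc 2
    omega
  have disj : ∀ L : Submodule ℂ H, (∃ c : ℂ, ∀ x ∈ L, s x = c • x) → Module.finrank ℂ L ≤ 2 := by
    rintro L ⟨c, hL⟩
    have h1 := Submodule.finrank_sup_add_finrank_inf_eq (E i).range L
    have h2 : (E i).range ⊓ L = ⊥ := by
      rw [Submodule.eq_bot_iff]
      rintro x ⟨⟨y, hy⟩, hx⟩
      refine h.eq_zero_of_E hb hH (i := i) (c := c) ?_ (hL x hx)
      rw [← hy]
      exact (h.E_apply i i y).trans (if_pos rfl)
    have h3 := Submodule.finrank_le ((E i).range ⊔ L)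
    rw [h2, finrank_bot] at h1
    omega
  have r1 := disj s.range ⟨1, by rintro _ ⟨y, rfl⟩; rw [one_smul]; exact h.s_apply y⟩
  have r2 := disj s.ker ⟨0, fun x hx => by rw [zero_smul]; exact hx⟩
  have r3 := LinearMap.finrank_range_add_finrank_ker (s : H →ₗ[ℂ] H)
  rw [hH] at r3
  change Module.finrank ℂ s.range + Module.finrank ℂ s.ker = 4 at r3
  omega

end IsProjectionSystem

end ProjectionSystem

end SpectralProblem

namespace SpectralProblem

/-! ### From weights with prescribed moments to the sextic -/

section Interpolation

theorem cubic_coeff_eq_zero {k₀ k₁ k₂ k₃ : ℝ} {d : Fin 4 → ℝ} (hd : Function.Injective d)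
    (h : ∀ j, k₃ * d j ^ 3 + k₂ * d j ^ 2 + k₁ * d j + k₀ = 0) :
    k₃ = 0 ∧ k₂ = 0 ∧ k₁ = 0 ∧ k₀ = 0 := by
  have n : ∀ i j, i ≠ j → d i - d j ≠ 0 := fun i j hij => sub_ne_zero.2 (hd.ne hij)
  have n01 := n 0 1 (by decide)
  have n02 := n 0 2 (by decide)
  have n12 := n 1 2 (by decide)
  have n03 := n 0 3 (by decide)
  have n13 := n 1 3 (by decide)
  have n23 := n 2 3 (by decide)
  have e1 : ∀ i j, d i - d j ≠ 0 →
      k₃ * (d i ^ 2 + d i * d j + d j ^ 2) + k₂ * (d i + d j) + k₁ = 0 := fun i j hij => by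
    apply mul_left_cancel₀ hij
    linear_combination h i - h j
  have e2 : ∀ i, d 1 - d i ≠ 0 → d 0 - d i ≠ 0 → k₃ * (d 0 + d 1 + d i) + k₂ = 0 :=
    fun i hi h0 => by
      apply mul_left_cancel₀ n01
      linear_combination e1 0 i h0 - e1 1 i hi
  have e3 : k₃ = 0 := by
    apply mul_left_cancel₀ n23
    linear_combination e2 2 n12 n02 - e2 3 n13 n03
  have e4 : k₂ = 0 := by have := e2 2 n12 n02; rw [e3] at this; linarith
  have e5 : k₁ = 0 := by have := e1 0 1 n01; rw [e3, e4] at this; linarith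
  refine ⟨e3, e4, e5, ?_⟩
  have := h 0
  rw [e3, e4, e5] at this; linarith

/-- The cubic polynomial with values `wⱼ ∏_{k ≠ j} (dⱼ - dₖ)` at the points `dⱼ`. -/
theorem exists_interpolation (d w : Fin 4 → ℝ) :
    ∃ l₀ l₁ : ℝ, (∀ t : ℝ, w 0 * ((t - d 1) * (t - d 2) * (t - d 3))
        + w 1 * ((t - d 0) * (t - d 2) * (t - d 3)) + w 2 * ((t - d 0) * (t - d 1) * (t - d 3))
        + w 3 * ((t - d 0) * (t - d 1) * (t - d 2)) =
      (∑ j, w j) * t ^ 3 + ((∑ j, d j * w j) - (∑ j, d j) * ∑ j, w j) * t ^ 2 + l₁ * t + l₀) ∧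
      2 * l₁ = ((∑ j, d j) ^ 2 - ∑ j, d j ^ 2) * (∑ j, w j) - 2 * (∑ j, d j) * (∑ j, d j * w j)
        + 2 * ∑ j, d j ^ 2 * w j := by
  refine ⟨-(w 0 * (d 1 * d 2 * d 3) + w 1 * (d 0 * d 2 * d 3) + w 2 * (d 0 * d 1 * d 3)
      + w 3 * (d 0 * d 1 * d 2)),
    w 0 * (d 1 * d 2 + d 1 * d 3 + d 2 * d 3) + w 1 * (d 0 * d 2 + d 0 * d 3 + d 2 * d 3)
      + w 2 * (d 0 * d 1 + d 0 * d 3 + d 1 * d 3) + w 3 * (d 0 * d 1 + d 0 * d 2 + d 1 * d 2),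
    fun t => ?_, ?_⟩ <;> simp only [Fin.sum_univ_four] <;> ring

/-- Weights `ω` and vectors `(τ, u, v)` with `|ωⱼ| = ‖(τⱼ, uⱼ, vⱼ)‖` and prescribed moments give a
representation of the sextic as `R² - Q`, with `Q` positive definite. -/
theorem exists_sexticSplit_of_weights {d w τ u v : Fin 4 → ℝ} {a₁ a₂ δ : ℝ}
    (hd : Function.Injective d) (hw : ∑ j, w j = 1) (hdw : ∑ j, d j * w j = δ)
    (hτ : ∑ j, τ j = 0) (hdτ : ∑ j, d j * τ j = 0) (hu : ∑ j, u j = 0)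
    (hdu : ∑ j, d j * u j = 0) (hv : ∑ j, v j = 0) (hdv : ∑ j, d j * v j = 0)
    (hsq : ∀ j, w j ^ 2 = τ j ^ 2 + u j ^ 2 + v j ^ 2) (hw0 : w 0 ≠ 0) (hu0 : u 0 = 0)
    (hv0 : v 0 = 0) (huv : ∃ j, u j ≠ 0 ∨ v j ≠ 0) (htr : ∑ j, d j - 2 * δ = a₁ + a₂)
    (htr2 : ∑ j, d j ^ 2 - 4 * ∑ j, d j ^ 2 * w j + 2 * δ ^ 2 = a₁ ^ 2 + a₂ ^ 2) :
    ∃ c₀ c₁ c₂ q₀ q₁ q₂ : ℝ, SexticSplit c₀ c₁ c₂ q₀ q₁ q₂ (d 0) (d 1) (d 2) (d 3) a₁ a₂ ∧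
      0 < q₂ ∧ 0 < q₂ * q₀ - q₁ ^ 2 ∧
      d 0 ^ 3 + c₂ * d 0 ^ 2 + c₁ * d 0 + c₀ = w 0 * ((d 0 - d 1) * (d 0 - d 2) * (d 0 - d 3)) ∧
      d 1 ^ 3 + c₂ * d 1 ^ 2 + c₁ * d 1 + c₀ = w 1 * ((d 1 - d 0) * (d 1 - d 2) * (d 1 - d 3)) ∧
      d 2 ^ 3 + c₂ * d 2 ^ 2 + c₁ * d 2 + c₀ = w 2 * ((d 2 - d 0) * (d 2 - d 1) * (d 2 - d 3)) ∧
      d 3 ^ 3 + c₂ * d 3 ^ 2 + c₁ * d 3 + c₀ =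
        w 3 * ((d 3 - d 0) * (d 3 - d 1) * (d 3 - d 2)) := by
  obtain ⟨c₀, c₁, hc, hc₁⟩ := exists_interpolation d w
  obtain ⟨T₀, T₁, hT, -⟩ := exists_interpolation d τ
  obtain ⟨U₀, U₁, hU, -⟩ := exists_interpolation d u
  obtain ⟨V₀, V₁, hV, -⟩ := exists_interpolation d v
  rw [hw, hdw] at hc hc₁
  rw [hτ, hdτ] at hT
  rw [hu, hdu] at hU
  rw [hv, hdv] at hV
  -- The vanishing zeroth and first moments remove the cubic and quadratic terms, so the
  -- interpolants of τ, u, v are affine, while that of w is monic because the weights sum to 1.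
  have eT : ∀ t, T₁ * t + T₀ = _ := fun t => ((hT t).trans (by ring)).symm
  have eU : ∀ t, U₁ * t + U₀ = _ := fun t => ((hU t).trans (by ring)).symm
  have eV : ∀ t, V₁ * t + V₀ = _ := fun t => ((hV t).trans (by ring)).symm
  have eR : ∀ t, t ^ 3 + (δ - ∑ j, d j) * t ^ 2 + c₁ * t + c₀ = _ :=
    fun t => ((hc t).trans (by ring)).symm
  have n : ∀ i j, i ≠ j → d i - d j ≠ 0 := fun i j hij => sub_ne_zero.2 (hd.ne hij)
  have hval : ∀ j, (d j ^ 3 + (δ - ∑ j, d j) * d j ^ 2 + c₁ * d j + c₀) ^ 2 =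
      (T₁ * d j + T₀) ^ 2 + (U₁ * d j + U₀) ^ 2 + (V₁ * d j + V₀) ^ 2 := by
    intro j
    rw [eR, eT, eU, eV]
    fin_cases j <;> simp only [Fin.zero_eta, Fin.mk_one, Fin.reduceFinMk, sub_self, mul_zero,
      zero_mul, add_zero, zero_add, mul_pow, hsq] <;> ring
  set q₂ := T₁ ^ 2 + U₁ ^ 2 + V₁ ^ 2 with hq₂
  set q₁ := T₁ * T₀ + U₁ * U₀ + V₁ * V₀ with hq₁
  set q₀ := T₀ ^ 2 + U₀ ^ 2 + V₀ ^ 2 with hq₀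
  set c₂ := δ - ∑ j, d j with hc₂
  -- Both sides are monic of degree six. The two trace conditions match the coefficients of t⁵ and
  -- t⁴, so the difference has degree at most three; it vanishes at the four points dⱼ.
  have hsplit : SexticSplit c₀ c₁ c₂ q₀ q₁ q₂ (d 0) (d 1) (d 2) (d 3) a₁ a₂ := by
    have hs : ∑ j, d j = d 0 + d 1 + d 2 + d 3 := Fin.sum_univ_four d
    have hs2 : ∑ j, d j ^ 2 = d 0 ^ 2 + d 1 ^ 2 + d 2 ^ 2 + d 3 ^ 2 :=
      Fin.sum_univ_four fun j => d j ^ 2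
    obtain ⟨p₁, hp₁⟩ : ∃ x, x = a₁ + a₂ := ⟨_, rfl⟩
    obtain ⟨p₂, hp₂⟩ : ∃ x, x = a₁ * a₂ := ⟨_, rfl⟩
    obtain ⟨e₂, he₂⟩ : ∃ x, x = d 0 * d 1 + (d 0 + d 1) * d 2 + (d 0 + d 1 + d 2) * d 3 := ⟨_, rfl⟩
    obtain ⟨e₃, he₃⟩ : ∃ x, x = d 0 * d 1 * d 2 + (d 0 * d 1 + (d 0 + d 1) * d 2) * d 3 :=
      ⟨_, rfl⟩
    obtain ⟨e₄, he₄⟩ : ∃ x, x = d 0 * d 1 * d 2 * d 3 := ⟨_, rfl⟩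
    obtain ⟨e₁, he₁⟩ : ∃ x, x = ∑ j, d j := ⟨_, rfl⟩
    have hP : ∀ t, (t - d 0) * (t - d 1) * (t - d 2) * (t - d 3) =
        t ^ 4 - e₁ * t ^ 3 + e₂ * t ^ 2 - e₃ * t + e₄ := fun t => by
      rw [he₁, hs, he₂, he₃, he₄]; ring
    have h5 : 2 * c₂ + e₁ + p₁ = 0 := by rw [hc₂, hp₁, he₁]; linarith
    have h4 : c₂ ^ 2 + 2 * c₁ - (e₂ + e₁ * p₁ + p₂) = 0 := by
      have k1 : e₂ = (e₁ ^ 2 - ∑ j, d j ^ 2) / 2 := by rw [he₁, he₂, hs, hs2]; ring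
      have k2 : p₂ = (p₁ ^ 2 - (a₁ ^ 2 + a₂ ^ 2)) / 2 := by rw [hp₁, hp₂]; ring
      have k3 : p₁ = e₁ - 2 * δ := by rw [hp₁, he₁, htr]
      rw [k1, k2, k3, ← htr2, hc₂, hc₁, ← he₁]; ring
    obtain ⟨k3, k2, k1, k0⟩ := cubic_coeff_eq_zero (d := d) hd
      (k₃ := 2 * c₀ + 2 * c₁ * c₂ + (e₃ + e₂ * p₁ + e₁ * p₂))
      (k₂ := c₁ ^ 2 + 2 * c₀ * c₂ - q₂ - (e₄ + e₃ * p₁ + e₂ * p₂))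
      (k₁ := 2 * c₀ * c₁ - 2 * q₁ + (e₄ * p₁ + e₃ * p₂))
      (k₀ := c₀ ^ 2 - q₀ - e₄ * p₂) (fun j => by
        have hj : d j ^ 4 - e₁ * d j ^ 3 + e₂ * d j ^ 2 - e₃ * d j + e₄ = 0 := by
          rw [← hP]; fin_cases j <;> simp
        linear_combination hval j + (d j ^ 2 * hq₂ + 2 * d j * hq₁ + hq₀) * (-1)
          - d j ^ 5 * h5 - d j ^ 4 * h4 - (d j ^ 2 - p₁ * d j + p₂) * hj)
    intro t
    have e : (t - d 0) * (t - d 1) * (t - d 2) * (t - d 3) * (t - a₁) * (t - a₂) =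
        (t ^ 4 - e₁ * t ^ 3 + e₂ * t ^ 2 - e₃ * t + e₄) * (t ^ 2 - p₁ * t + p₂) := by
      rw [← hP, hp₁, hp₂]; ring
    rw [e]
    linear_combination t ^ 5 * h5 + t ^ 4 * h4 + t ^ 3 * k3 + t ^ 2 * k2 + t * k1 + k0
  have hU0 : U₁ * d 0 + U₀ = 0 := by rw [eU, hu0]; ring
  have hV0 : V₁ * d 0 + V₀ = 0 := by rw [eV, hv0]; ring
  -- The interpolants of u and v vanish at d₀. If their slopes vanished too, all uⱼ and vⱼ would be
  -- zero.
  have hpos : 0 < U₁ ^ 2 + V₁ ^ 2 := by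
    by_contra hc
    have hU1 : U₁ = 0 := by nlinarith [sq_nonneg U₁, sq_nonneg V₁]
    have hV1 : V₁ = 0 := by nlinarith [sq_nonneg U₁, sq_nonneg V₁]
    have hU2 : U₀ = 0 := by rw [hU1] at hU0; linarith
    have hV2 : V₀ = 0 := by rw [hV1] at hV0; linarith
    obtain ⟨j, hj⟩ := huv
    have kU := eU (d j)
    have kV := eV (d j)
    rw [hU1, hU2] at kU
    rw [hV1, hV2] at kV
    have n01 := n 0 1 (by decide)
    have n02 := n 0 2 (by decide)
    have n12 := n 1 2 (by decide)
    have n03 := n 0 3 (by decide)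
    have n13 := n 1 3 (by decide)
    have n23 := n 2 3 (by decide)
    have n10 := n 1 0 (by decide)
    have n20 := n 2 0 (by decide)
    have n21 := n 2 1 (by decide)
    have n30 := n 3 0 (by decide)
    have n31 := n 3 1 (by decide)
    have n32 := n 3 2 (by decide)
    have z : ∀ {x y p : ℝ}, p ≠ 0 → 0 = x * p → 0 = y * p → ¬(x ≠ 0 ∨ y ≠ 0) :=
      fun hp hx hy k => k.elim (fun k => k ((mul_eq_zero.1 hx.symm).resolve_right hp))
        (fun k => k ((mul_eq_zero.1 hy.symm).resolve_right hp))
    fin_cases j <;> simp only [Fin.zero_eta, Fin.mk_one, Fin.reduceFinMk, sub_self, mul_zero,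
      zero_mul, add_zero, zero_add] at kU kV hj
    · exact z (mul_ne_zero (mul_ne_zero n01 n02) n03) kU kV hj
    · exact z (mul_ne_zero (mul_ne_zero n10 n12) n13) kU kV hj
    · exact z (mul_ne_zero (mul_ne_zero n20 n21) n23) kU kV hj
    · exact z (mul_ne_zero (mul_ne_zero n30 n31) n32) kU kV hj
  have hT0 : (T₁ * d 0 + T₀) ≠ 0 := by
    rw [eT]
    have hτ0 : τ 0 ≠ 0 := fun h0 => hw0 (by
      have := hsq 0
      rw [h0, hu0, hv0] at this
      exact pow_eq_zero_iff two_ne_zero |>.1 (by linarith))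
    have n01 := n 0 1 (by decide)
    have n02 := n 0 2 (by decide)
    have n03 := n 0 3 (by decide)
    simpa using ⟨hτ0, ⟨n01, n02⟩, n03⟩
  refine ⟨c₀, c₁, c₂, q₀, q₁, q₂, hsplit, by linarith [sq_nonneg T₁], ?_, ?_, ?_, ?_, ?_⟩
  -- Lagrange's identity for the discriminant of a sum of squares, where two of the affine forms
  -- share the zero d₀.
  · have : q₂ * q₀ - q₁ ^ 2 = (T₁ * d 0 + T₀) ^ 2 * (U₁ ^ 2 + V₁ ^ 2) := by
      have hU2 : U₀ = -(U₁ * d 0) := by linarith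
      have hV2 : V₀ = -(V₁ * d 0) := by linarith
      rw [hq₂, hq₁, hq₀, hU2, hV2]; ring
    rw [this]; positivity
  all_goals rw [eR]; ring

end Interpolation

end SpectralProblem

namespace SpectralProblem

/-! ### Orthonormal bases adapted to the Fⱼ and to s -/

section Weights

open scoped InnerProductSpace

variable {H : Type*} [NormedAddCommGroup H] [InnerProductSpace ℂ H] [CompleteSpace H]

theorem inner_map_of_star_eq {T : H →L[ℂ] H} (hT : star T = T) (x y : H) :
    ⟪T x, y⟫_ℂ = ⟪x, T y⟫_ℂ := by
  rw [← ContinuousLinearMap.adjoint_inner_right, ← ContinuousLinearMap.star_eq_adjoint, hT]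

namespace IsProjectionSystem

variable {E : Fin 3 → H →L[ℂ] H} {F : Fin 4 → H →L[ℂ] H} {s : H →L[ℂ] H}
  {a : Fin 3 → ℝ} {b : Fin 4 → ℝ} {δ γ : ℝ}

theorem exists_eigenbasis (h : IsProjectionSystem E F s a b δ γ)
    (hH : Module.finrank ℂ H = 4) :
    ∃ f : OrthonormalBasis (Fin 4) ℂ H, ∀ i j, F i (f j) = if i = j then f j else 0 := by
  have : FiniteDimensional ℂ H := Module.finite_of_finrank_pos (by omega)
  choose ξ hξ hξ0 using fun j => exists_range_vector
    (fun x => by rw [h.F_apply, if_pos rfl]) (h.F_ne j)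
  let g : Fin 4 → H := fun j => ((‖ξ j‖ : ℂ)⁻¹) • ξ j
  have hg : ∀ j, F j (g j) = g j := fun j => by simp only [g, map_smul, hξ]
  have hg' : ∀ i j, F i (g j) = if i = j then g j else 0 := fun i j => by
    conv_lhs => rw [← hg j]
    rw [h.F_apply]
    split_ifs with hij
    · rw [hij, hg]
    · rfl
  have horth : Orthonormal ℂ g := by
    refine ⟨fun j => norm_smul_inv_norm (hξ0 j), fun i j hij => ?_⟩
    change ⟪g i, g j⟫_ℂ = 0
    rw [← hg i, inner_map_of_star_eq (h.F_star i), hg', if_neg hij, inner_zero_right]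
  obtain ⟨f, hf⟩ := Orthonormal.exists_orthonormalBasis_extension_of_card_eq (𝕜 := ℂ) (E := H)
    (ι := Fin 4) (v := g) (s := Set.univ) (by simpa using hH)
    (horth.comp _ Subtype.val_injective)
  refine ⟨f, fun i j => ?_⟩
  rw [hf j (Set.mem_univ j)]
  exact hg' i j

omit [CompleteSpace H] in
theorem F_apply_eq {f : OrthonormalBasis (Fin 4) ℂ H}
    (hf : ∀ i j, F i (f j) = if i = j then f j else 0) (j : Fin 4) (x : H) :
    F j x = ⟪f j, x⟫_ℂ • f j := by
  conv_lhs => rw [← f.sum_repr' x]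
  simp [hf]

/-- An orthonormal basis of the range of `s`, adapted to the vector `f₀`. -/
theorem exists_basis_range_s (h : IsProjectionSystem E F s a b δ γ)
    (hs : Module.finrank ℂ s.range = 2) {x : H} (hx : s x ≠ 0) :
    ∃ w : Fin 2 → H, (∀ i j, ⟪w i, w j⟫_ℂ = if i = j then 1 else 0) ∧ (∀ i, s (w i) = w i) ∧
      (∀ y, s y = ∑ i, ⟪w i, y⟫_ℂ • w i) ∧ ⟪w 1, x⟫_ℂ = 0 := by
  have : FiniteDimensional ℂ s.range := Module.finite_of_finrank_pos (by omega)
  have hsR : ∀ y ∈ s.range, s y = y := by rintro _ ⟨y, rfl⟩; exact h.s_apply y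
  -- Only the value at 0 is prescribed to the extension below; being a multiple of s x, it makes the
  -- second basis vector orthogonal to x.
  let g : Fin 2 → s.range := fun _ => ((‖s x‖ : ℂ)⁻¹) • (⟨s x, x, rfl⟩ : s.range)
  obtain ⟨b, hb⟩ := Orthonormal.exists_orthonormalBasis_extension_of_card_eq (𝕜 := ℂ)
    (E := s.range) (ι := Fin 2) (v := g) (s := {0}) (by simpa using hs) (by
      refine ⟨fun i => ?_, fun i j hij => absurd (Subsingleton.elim i j) hij⟩
      exact norm_smul_inv_norm (𝕜 := ℂ) (x := (⟨s x, x, rfl⟩ : s.range))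
        (fun k => hx (congrArg Subtype.val k)))
  have hw : ∀ i j, ⟪(b i : H), (b j : H)⟫_ℂ = if i = j then 1 else 0 :=
    fun i j => orthonormal_iff_ite.1 b.orthonormal i j
  refine ⟨fun i => b i, hw, fun i => hsR _ (b i).2, fun y => ?_, ?_⟩
  · have := congrArg Subtype.val (b.sum_repr' ⟨s y, y, rfl⟩)
    rw [Submodule.coe_sum] at this
    refine this.symm.trans (Finset.sum_congr rfl fun i _ => ?_)
    change ⟪(b i : H), s y⟫_ℂ • (b i : H) = ⟪(b i : H), y⟫_ℂ • (b i : H)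
    rw [← inner_map_of_star_eq h.s_star, hsR _ (b i).2]
  · have h0 : (b 0 : H) = ((‖s x‖ : ℂ)⁻¹) • s x := by rw [hb 0 rfl]; rfl
    have h1 := hw 1 0
    rw [h0, inner_smul_right, if_neg (by decide), mul_eq_zero, ← inner_map_of_star_eq h.s_star,
      hsR _ (b 1).2] at h1
    exact h1.resolve_left (inv_ne_zero (by simpa using hx))

end IsProjectionSystem

end Weights

end SpectralProblem

namespace SpectralProblem

/-! ### The coordinate matrix V of a projection system -/

section WeightsOfSystem

open scoped InnerProductSpace ComplexConjugate

variable {H : Type*} [NormedAddCommGroup H] [InnerProductSpace ℂ H] [CompleteSpace H]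

namespace IsProjectionSystem

variable {E : Fin 3 → H →L[ℂ] H} {F : Fin 4 → H →L[ℂ] H} {s : H →L[ℂ] H}
  {a : Fin 3 → ℝ} {b : Fin 4 → ℝ} {δ γ : ℝ}

/-- Subtracting a₀ eliminates E₀. In particular the diagonal operator on the left agrees with δ s on
the range of E₀. -/
theorem shift_apply (h : IsProjectionSystem E F s a b δ γ) (x : H) :
    ∑ j, ((γ - a 0 - b j : ℝ) : ℂ) • F j x =
      ((a 1 - a 0 : ℝ) : ℂ) • E 1 x + ((a 2 - a 0 : ℝ) : ℂ) • E 2 x + (δ : ℂ) • s x := by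
  have h1 := h.rel_apply x
  have h2 := h.E_sum_apply x
  have h3 := h.F_sum_apply x
  rw [Fin.sum_univ_three] at h1 h2
  rw [Fin.sum_univ_four] at h1 h3 ⊢
  have h4 : ((γ : ℂ) - a 0) • x = (γ : ℂ) • x - (a 0 : ℂ) • (E 0 x + E 1 x + E 2 x) := by
    rw [h2, sub_smul]
  rw [← h1] at h4
  have h5 : ((γ : ℂ) - a 0) • x = ((γ : ℂ) - a 0) • (F 0 x + F 1 x + F 2 x + F 3 x) := by rw [h3]
  rw [h5] at h4
  push_cast
  rw [← sub_eq_zero] at h4 ⊢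
  refine Eq.trans ?_ h4
  module

/-- The range of `s` is the image under `s` of the range of `E₀`. -/
theorem exists_preimage (h : IsProjectionSystem E F s a b δ γ) (hb : Function.Injective b)
    (hH : Module.finrank ℂ H = 4) (hs : Module.finrank ℂ s.range = 2)
    (hE : Module.finrank ℂ (E 0).range = 2) {y : H} (hy : s y = y) :
    ∃ k, E 0 k = k ∧ s k = y := by
  have : FiniteDimensional ℂ H := Module.finite_of_finrank_pos (by omega)
  let T : (E 0).range →ₗ[ℂ] s.range := (s : H →ₗ[ℂ] H).restrict (fun x _ => ⟨x, rfl⟩)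
  -- The kernel would consist of common eigenvectors of E₀ and s. Both ranges have dimension 2, so
  -- injectivity suffices.
  have hT : Function.Injective T := by
    rw [← LinearMap.ker_eq_bot, LinearMap.ker_eq_bot']
    rintro ⟨x, z, rfl⟩ hx
    refine Subtype.ext (h.eq_zero_of_E hb hH (i := 0) (c := 0) ?_ ?_)
    · exact (h.E_apply 0 0 z).trans (if_pos rfl)
    · rw [zero_smul]; exact congrArg Subtype.val hx
  obtain ⟨⟨k, z, rfl⟩, hk⟩ := ((LinearMap.injective_iff_surjective_of_finrank_eq_finrank
    (hE.trans hs.symm)).1 hT) ⟨y, y, hy⟩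
  exact ⟨_, (h.E_apply 0 0 z).trans (if_pos rfl), congrArg Subtype.val hk⟩

/-- The coordinates of an adapted orthonormal basis of the range of `s` with respect to the common
eigenbasis of the `F j`. -/
theorem exists_coordinates (h : IsProjectionSystem E F s a b δ γ) (ha : Function.Injective a)
    (hb : Function.Injective b) (hδ : δ ≠ 0) (hE : Module.finrank ℂ (E 0).range = 2) :
    ∃ V : Fin 4 → Fin 2 → ℂ,
      (∀ j, γ - a 0 - b j ≠ 0) ∧
      (∀ i k, ∑ j, conj (V j i) * V j k = if i = k then 1 else 0) ∧
      (∀ i k, ∑ j, conj (V j i) * (δ * V j k / (γ - a 0 - b j : ℝ)) = if i = k then 1 else 0) ∧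
      V 0 1 = 0 ∧ (∃ j, V j 0 * V j 1 ≠ 0) ∧ (∀ j, ∃ i, V j i ≠ 0) ∧
      (∀ j x, F j (s (F j x)) = (∑ i, conj (V j i) * V j i) • F j x) ∧
      (∑ j, ((γ - a 0 - b j : ℝ) - δ * ∑ i, conj (V j i) * V j i) =
        ((a 1 - a 0 : ℝ) : ℂ) + (a 2 - a 0 : ℝ)) ∧
      (∑ j, ((γ - a 0 - b j : ℝ) ^ 2 - 2 * δ * (γ - a 0 - b j : ℝ) * (∑ i, conj (V j i) * V j i)
          + δ ^ 2 * ∑ i, conj (V j i) * V j i) =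
        ((a 1 - a 0 : ℝ) : ℂ) ^ 2 + (a 2 - a 0 : ℝ) ^ 2) := by
  have hfin := h.finiteDimensional ha hb hδ
  have hH := h.finrank_eq ha hb hδ
  have hs := h.finrank_range_s ha hb hδ
  obtain ⟨f, hf⟩ := h.exists_eigenbasis hH
  have hF := F_apply_eq hf
  have hsf : ∀ j, s (f j) ≠ 0 := fun j k => by
    have := h.eq_zero_of_F ha hH (i := j) (x := f j) (c := 0) (by rw [hf, if_pos rfl])
      (by rw [k, zero_smul])
    exact f.orthonormal.ne_zero j this
  obtain ⟨w, hw, hsw, hsy, hw1⟩ := h.exists_basis_range_s hs (hsf 0)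
  choose k hk hsk using fun i => h.exists_preimage hb hH hs hE (hsw i)
  set d : Fin 4 → ℝ := fun j => γ - a 0 - b j with hd
  -- The vector k i lies in the range of E₀, so the shifted relation reads D (k i) = δ w i.
  have hDk : ∀ i j, (d j : ℂ) * ⟪f j, k i⟫_ℂ = δ * ⟪f j, w i⟫_ℂ := fun i j => by
    have h1 := congrArg (fun y => ⟪f j, y⟫_ℂ) (h.shift_apply (k i))
    have hE0 : ∀ l : Fin 3, l ≠ 0 → E l (k i) = 0 := fun l hl => by
      rw [← hk i, h.E_apply, if_neg hl]
    simp only [hF, hsk, hE0 1 (by decide), hE0 2 (by decide), smul_zero, zero_add, inner_sum,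
      inner_smul_right, orthonormal_iff_ite.1 f.orthonormal, mul_ite, mul_one, mul_zero,
      Finset.sum_ite_eq, Finset.mem_univ, if_true] at h1
    exact h1
  have hδ' : (δ : ℂ) ≠ 0 := Complex.ofReal_ne_zero.2 hδ
  have hconj : ∀ i j, conj ⟪f j, w i⟫_ℂ = ⟪w i, f j⟫_ℂ := fun i j => inner_conj_symm _ _
  have hne : ∀ j, ∃ i, ⟪f j, w i⟫_ℂ ≠ 0 := fun j => by
    by_contra hc
    push Not at hc
    apply hsf j
    rw [hsy]
    refine Finset.sum_eq_zero fun i _ => ?_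
    rw [← hconj, hc, map_zero, zero_smul]
  -- If d j = 0, then f j is orthogonal to the range of s, contrary to s (f j) ≠ 0.
  have hd0 : ∀ j, d j ≠ 0 := fun j h0 => by
    obtain ⟨i, hi⟩ := hne j
    have := hDk i j
    rw [h0, Complex.ofReal_zero, zero_mul] at this
    exact hi ((mul_eq_zero.1 this.symm).resolve_left hδ')
  have hkw : ∀ i j, ⟪f j, k i⟫_ℂ = δ * ⟪f j, w i⟫_ℂ / (d j : ℝ) := fun i j => by
    rw [eq_div_iff (Complex.ofReal_ne_zero.2 (hd0 j)), mul_comm, hDk]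
  have hr : ∀ j, ⟪f j, s (f j)⟫_ℂ = ∑ i, conj ⟪f j, w i⟫_ℂ * ⟪f j, w i⟫_ℂ := fun j => by
    rw [hsy, inner_sum]
    exact Finset.sum_congr rfl fun i _ => by rw [inner_smul_right, hconj]
  have htrE : ∀ i : Fin 3, i ≠ 0 → LinearMap.trace ℂ H (E i : H →ₗ[ℂ] H) = 1 := by
    have h1 := h.sum_finrank_range_E
    rw [Fin.sum_univ_three, hE, hH] at h1
    have p1 := h.finrank_range_E_pos 1
    have p2 := h.finrank_range_E_pos 2
    intro i hi
    have : Module.finrank ℂ (E i).range = 1 := by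
      fin_cases i
      · exact absurd rfl hi
      · change Module.finrank ℂ (E 1).range = 1; omega
      · change Module.finrank ℂ (E 2).range = 1; omega
    rw [trace_eq_finrank_range (fun x => by rw [h.E_apply, if_pos rfl]), this, Nat.cast_one]
  -- The traces of M and M² are computed twice, from the rank-one projections E₁, E₂ and from M = D
  -- − δ s in the basis f. This gives the last two identities.
  set M : H →ₗ[ℂ] H := ((a 1 - a 0 : ℝ) : ℂ) • (E 1 : H →ₗ[ℂ] H)
    + ((a 2 - a 0 : ℝ) : ℂ) • (E 2 : H →ₗ[ℂ] H) with hM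
  have hMx : ∀ x, M x = ∑ j, (d j : ℂ) • F j x - (δ : ℂ) • s x := fun x => by
    rw [h.shift_apply, add_sub_cancel_right]; rfl
  have hfD : ∀ j x, ⟪f j, ∑ l, (d l : ℂ) • F l x⟫_ℂ = d j * ⟪f j, x⟫_ℂ := fun j x => by
    simp [hF, orthonormal_iff_ite.1 f.orthonormal]
  have hMf : ∀ j, M (f j) = (d j : ℂ) • f j - (δ : ℂ) • s (f j) := fun j => by
    rw [hMx]; simp [hf]
  have hss : ∀ j, ⟪f j, s (s (f j))⟫_ℂ = ⟪f j, s (f j)⟫_ℂ := fun j => by rw [h.s_apply]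
  refine ⟨fun j i => ⟪f j, w i⟫_ℂ, hd0, fun i l => ?_, fun i l => ?_, ?_, ?_, hne, fun j x => ?_,
    ?_, ?_⟩
  · rw [← hw i l, ← f.sum_inner_mul_inner]
    exact Finset.sum_congr rfl fun j _ => by rw [hconj]
  · have : ⟪w i, k l⟫_ℂ = if i = l then 1 else 0 := by
      rw [← hw i l, ← hsk l, ← inner_map_of_star_eq h.s_star, hsw]
    rw [← this, ← f.sum_inner_mul_inner]
    exact Finset.sum_congr rfl fun j _ => by rw [hconj, hkw]
  · change ⟪f 0, w 1⟫_ℂ = 0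
    rw [← inner_conj_symm, hw1, map_zero]
  -- If every product vanished, the f j orthogonal to w 1 would span a space containing w 0 and
  -- hence invariant under s. It contains f 0 but not w 1, so irreducibility fails.
  · by_contra hc
    push Not at hc
    let J : Set H := {y | ∃ j, f j = y ∧ ⟪f j, w 1⟫_ℂ = 0}
    have hJ : J ⊆ Set.range f := by rintro _ ⟨j, rfl, -⟩; exact ⟨j, rfl⟩
    have hfinJ : FiniteDimensional ℂ (Submodule.span ℂ J) := inferInstance
    have memJ : ∀ j, ⟪f j, w 1⟫_ℂ = 0 → f j ∈ Submodule.span ℂ J := fun j hj =>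
      Submodule.subset_span ⟨j, rfl, hj⟩
    have hw0 : w 0 ∈ Submodule.span ℂ J := by
      rw [← f.sum_repr' (w 0)]
      refine Submodule.sum_mem _ fun j _ => ?_
      rcases mul_eq_zero.1 (hc j) with h0 | h0
      · rw [h0, zero_smul]; exact Submodule.zero_mem _
      · exact Submodule.smul_mem _ _ (memJ j h0)
    have lift : ∀ (T : H →L[ℂ] H), (∀ j, ⟪f j, w 1⟫_ℂ = 0 → T (f j) ∈ Submodule.span ℂ J) →
        ∀ x ∈ Submodule.span ℂ J, T x ∈ Submodule.span ℂ J := fun T hT x hx => by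
      refine (Submodule.span_le (p := (Submodule.span ℂ J).comap (T : H →ₗ[ℂ] H))).2 ?_ hx
      rintro _ ⟨j, rfl, hj⟩
      exact hT j hj
    have iF : ∀ j, ∀ x ∈ Submodule.span ℂ J, F j x ∈ Submodule.span ℂ J := fun j =>
      lift (F j) fun l hl => by
        rw [hf]
        split_ifs
        · exact memJ l hl
        · exact Submodule.zero_mem _
    have is : ∀ x ∈ Submodule.span ℂ J, s x ∈ Submodule.span ℂ J :=
      lift s fun l hl => by
        rw [hsy, Fin.sum_univ_two, ← hconj 1, hl, map_zero, zero_smul, add_zero]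
        exact Submodule.smul_mem _ _ hw0
    have iE := idempotent_mem_of_sum_mem h.sys.E_mul h.sys.E_sum
      (Complex.ofReal_injective.comp ha) (K := Submodule.span ℂ J) (fun x hx => by
        have h1 := h.rel_apply x
        rw [add_assoc, ← eq_sub_iff_add_eq] at h1
        have h2 : (∑ i, (a i : ℂ) • (E i : H →ₗ[ℂ] H)) x = ∑ i, (a i : ℂ) • E i x := by simp
        refine h2 ▸ h1 ▸ ?_
        exact Submodule.sub_mem _ (Submodule.smul_mem _ _ hx) (Submodule.add_mem _
          (Submodule.sum_mem _ fun j _ => Submodule.smul_mem _ _ (iF j x hx))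
          (Submodule.smul_mem _ _ (is x hx))))
    rcases h.irr _ hfinJ iE iF is with h0 | h0
    · have := memJ 0 (by rw [← inner_conj_symm, hw1, map_zero])
      rw [h0, Submodule.mem_bot] at this
      exact f.orthonormal.ne_zero 0 this
    · have hperp : Submodule.span ℂ J ≤ (Submodule.span ℂ {w 1})ᗮ := by
        rw [Submodule.span_le]
        rintro _ ⟨j, rfl, hj⟩
        rw [SetLike.mem_coe, Submodule.mem_orthogonal_singleton_iff_inner_left]
        exact hj
      have : w 1 ∈ (Submodule.span ℂ {w 1})ᗮ := hperp (h0 ▸ Submodule.mem_top)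
      rw [Submodule.mem_orthogonal_singleton_iff_inner_left, hw, if_pos rfl] at this
      exact one_ne_zero this
  · rw [hF j x, map_smul, map_smul, hF, ← hr, smul_comm]
  · have h1 := LinearMap.trace_eq_sum_inner M f
    rw [hM, map_add, map_smul, map_smul, htrE 1 (by decide), htrE 2 (by decide), ← hM, smul_eq_mul,
      smul_eq_mul, mul_one, mul_one] at h1
    rw [h1]
    refine Finset.sum_congr rfl fun j _ => ?_
    rw [hMf, inner_sub_right, inner_smul_right, inner_smul_right, hr,
      orthonormal_iff_ite.1 f.orthonormal, if_pos rfl, mul_one]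
  · have hMM : M * M = ((a 1 - a 0 : ℝ) : ℂ) ^ 2 • (E 1 : H →ₗ[ℂ] H)
        + ((a 2 - a 0 : ℝ) : ℂ) ^ 2 • (E 2 : H →ₗ[ℂ] H) := by
      have m := h.sys.E_mul
      rw [hM, add_mul, mul_add, mul_add, smul_mul_smul_comm, smul_mul_smul_comm,
        smul_mul_smul_comm, smul_mul_smul_comm, m 1 1, m 1 2, m 2 1, m 2 2]
      simp [sq]
    have h1 := LinearMap.trace_eq_sum_inner (M * M) f
    rw [hMM, map_add, map_smul, map_smul, htrE 1 (by decide), htrE 2 (by decide), ← hMM,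
      smul_eq_mul, smul_eq_mul, mul_one, mul_one] at h1
    rw [h1]
    refine Finset.sum_congr rfl fun j _ => ?_
    rw [Module.End.mul_apply, hMf, map_sub, map_smul, map_smul, hMf, hMx (s (f j)),
      inner_sub_right, inner_smul_right, inner_smul_right, inner_sub_right, inner_sub_right,
      hfD, inner_smul_right, inner_smul_right, inner_smul_right, hss, hr,
      orthonormal_iff_ite.1 f.orthonormal, if_pos rfl]
    ring

end IsProjectionSystem

end WeightsOfSystem

end SpectralProblem

namespace SpectralProblem

/-! ### The sextic of a projection system and the necessary inequalities -/

section NecessaryConditions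

open scoped ComplexConjugate

variable {H : Type*} [NormedAddCommGroup H] [InnerProductSpace ℂ H] [CompleteSpace H]

namespace IsProjectionSystem

variable {E : Fin 3 → H →L[ℂ] H} {F : Fin 4 → H →L[ℂ] H} {s : H →L[ℂ] H}
  {a : Fin 3 → ℝ} {b : Fin 4 → ℝ} {δ γ : ℝ}

/-- Row j of V defines the rank-one Hermitian matrix with diagonal x j, y j and off-diagonal entry m
j 0 1. Half its trace, half the difference of its diagonal entries, and the real and imaginary parts
of m j 0 1, each multiplied by δ/dⱼ, serve as w, τ, u, v. Vanishing of the determinant is the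
relation w² = τ² + u² + v², and V*V = 1, V*D⁻¹V = δ⁻¹ are the moment conditions. The number r j is
the diagonal entry of s at the j-th eigenvector. -/
theorem exists_sexticSplit (h : IsProjectionSystem E F s a b δ γ) (ha : Function.Injective a)
    (hb : Function.Injective b) (hδ : 0 < δ) (hE : Module.finrank ℂ (E 0).range = 2)
    {d : Fin 4 → ℝ} (hd : ∀ j, d j = γ - a 0 - b j) :
    ∃ (c₀ c₁ c₂ q₀ q₁ q₂ : ℝ) (r : Fin 4 → ℝ),
      SexticSplit c₀ c₁ c₂ q₀ q₁ q₂ (d 0) (d 1) (d 2) (d 3) (a 1 - a 0) (a 2 - a 0) ∧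
      0 < q₂ ∧ 0 < q₂ * q₀ - q₁ ^ 2 ∧ (∀ j, 0 < r j) ∧
      (∀ j x, F j (s (F j x)) = (r j : ℂ) • F j x) ∧
      ∑ j, d j - 2 * δ = (a 1 - a 0) + (a 2 - a 0) ∧
      2 * (d 0 * (d 0 ^ 3 + c₂ * d 0 ^ 2 + c₁ * d 0 + c₀)) =
        δ * r 0 * ((d 0 - d 1) * (d 0 - d 2) * (d 0 - d 3)) ∧
      2 * (d 1 * (d 1 ^ 3 + c₂ * d 1 ^ 2 + c₁ * d 1 + c₀)) =
        δ * r 1 * ((d 1 - d 0) * (d 1 - d 2) * (d 1 - d 3)) ∧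
      2 * (d 2 * (d 2 ^ 3 + c₂ * d 2 ^ 2 + c₁ * d 2 + c₀)) =
        δ * r 2 * ((d 2 - d 0) * (d 2 - d 1) * (d 2 - d 3)) ∧
      2 * (d 3 * (d 3 ^ 3 + c₂ * d 3 ^ 2 + c₁ * d 3 + c₀)) =
        δ * r 3 * ((d 3 - d 0) * (d 3 - d 1) * (d 3 - d 2)) := by
  obtain ⟨V, hd0, hV, hVd, hV01, ⟨l, hl⟩, hVne, hrF, htr, htr2⟩ :=
    h.exists_coordinates ha hb hδ.ne' hE
  have hdinj : Function.Injective d := fun i j hij => hb (by rw [hd, hd] at hij; linarith)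
  simp only [← hd] at hd0 hVd htr htr2
  set m : Fin 4 → Fin 2 → Fin 2 → ℂ := fun j i k => conj (V j i) * V j k with hm
  set x : Fin 4 → ℝ := fun j => Complex.normSq (V j 0) with hx
  set y : Fin 4 → ℝ := fun j => Complex.normSq (V j 1) with hy
  have mx : ∀ j, m j 0 0 = x j := fun j => Complex.normSq_eq_conj_mul_self.symm
  have my : ∀ j, m j 1 1 = y j := fun j => Complex.normSq_eq_conj_mul_self.symm
  have mxy : ∀ j, ∑ i, conj (V j i) * V j i = ((x j + y j : ℝ) : ℂ) := fun j => by
    rw [Fin.sum_univ_two, Complex.ofReal_add, ← mx, ← my]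
  have hmsq : ∀ j, (m j 0 1).re ^ 2 + (m j 0 1).im ^ 2 = x j * y j := fun j => by
    have : Complex.normSq (m j 0 1) = x j * y j := by
      simp only [hm, hx, hy, Complex.normSq_mul, Complex.normSq_conj]
    rw [← this, Complex.normSq_apply]; ring
  have hS : ∀ i k, ∑ j, m j i k = if i = k then 1 else 0 := hV
  have hSd : ∀ i k, ∑ j, ((δ / d j : ℝ) : ℂ) * m j i k = if i = k then 1 else 0 := fun i k => by
    rw [← hVd i k]
    refine Finset.sum_congr rfl fun j _ => ?_
    simp only [hm]; push_cast; ring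
  have x1 : ∑ j, x j = 1 := by
    have := congrArg Complex.re (hS 0 0); simpa [mx] using this
  have y1 : ∑ j, y j = 1 := by
    have := congrArg Complex.re (hS 1 1); simpa [my] using this
  have xd : ∑ j, δ / d j * x j = 1 := by
    have := congrArg Complex.re (hSd 0 0)
    simpa only [mx, ← Complex.ofReal_mul, Complex.re_sum, Complex.ofReal_re, if_true,
      Complex.one_re] using this
  have yd : ∑ j, δ / d j * y j = 1 := by
    have := congrArg Complex.re (hSd 1 1)
    simpa only [my, ← Complex.ofReal_mul, Complex.re_sum, Complex.ofReal_re, if_true,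
      Complex.one_re] using this
  have u1 : ∑ j, (m j 0 1).re = 0 := by
    rw [← Complex.re_sum, hS]; simp
  have v1 : ∑ j, (m j 0 1).im = 0 := by
    rw [← Complex.im_sum, hS]; simp
  have ud : ∑ j, δ / d j * (m j 0 1).re = 0 := by
    have := congrArg Complex.re (hSd 0 1)
    simpa only [Complex.re_sum, Complex.re_ofReal_mul, zero_ne_one, if_false,
      Complex.zero_re] using this
  have vd : ∑ j, δ / d j * (m j 0 1).im = 0 := by
    have := congrArg Complex.im (hSd 0 1)
    simpa only [Complex.im_sum, Complex.im_ofReal_mul, zero_ne_one, if_false,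
      Complex.zero_im] using this
  have hdd : ∀ (j : Fin 4) (z : ℝ), d j * (δ / d j * z) = δ * z := fun j z => by
    rw [← mul_assoc, mul_div_cancel₀ _ (hd0 j)]
  have hdpos : ∀ j, δ / d j ≠ 0 := fun j => div_ne_zero hδ.ne' (hd0 j)
  have hxy : ∀ j, 0 < x j + y j := fun j => by
    obtain ⟨i, hi⟩ := hVne j
    have p : 0 < Complex.normSq (V j i) := Complex.normSq_pos.2 hi
    have p0 : 0 ≤ x j := Complex.normSq_nonneg _
    have p1 : 0 ≤ y j := Complex.normSq_nonneg _
    fin_cases i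
    · exact add_pos_of_pos_of_nonneg p p1
    · exact add_pos_of_nonneg_of_pos p0 p
  have htr' : ∑ j, (d j - δ * (x j + y j)) = (a 1 - a 0) + (a 2 - a 0) := by
    simp only [mxy] at htr
    exact_mod_cast htr
  have htr2' : ∑ j, (d j ^ 2 - 2 * δ * d j * (x j + y j) + δ ^ 2 * (x j + y j)) =
      (a 1 - a 0) ^ 2 + (a 2 - a 0) ^ 2 := by
    simp only [mxy] at htr2
    exact_mod_cast htr2
  have m01 : m 0 0 1 = 0 := by simp only [hm, hV01, mul_zero]
  have htrace : ∑ j, d j - 2 * δ = (a 1 - a 0) + (a 2 - a 0) := by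
    rw [← htr']
    simp only [Fin.sum_univ_four] at x1 y1 ⊢
    linear_combination δ * (x1 + y1)
  obtain ⟨c₀, c₁, c₂, q₀, q₁, q₂, hsplit, hq, hdisc, R0, R1, R2, R3⟩ :=
    exists_sexticSplit_of_weights (d := d) (w := fun j => δ / d j * ((x j + y j) / 2))
      (τ := fun j => δ / d j * ((x j - y j) / 2)) (u := fun j => δ / d j * (m j 0 1).re)
      (v := fun j => δ / d j * (m j 0 1).im) (a₁ := a 1 - a 0) (a₂ := a 2 - a 0) (δ := δ) hdinj
      (by simp only [Fin.sum_univ_four] at xd yd ⊢; linear_combination (xd + yd) / 2)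
      (by simp only [hdd]; simp only [Fin.sum_univ_four] at x1 y1 ⊢
          linear_combination δ * (x1 + y1) / 2)
      (by simp only [Fin.sum_univ_four] at xd yd ⊢; linear_combination (xd - yd) / 2)
      (by simp only [hdd]; simp only [Fin.sum_univ_four] at x1 y1 ⊢
          linear_combination δ * (x1 - y1) / 2)
      ud (by simp only [hdd]; rw [← Finset.mul_sum, u1, mul_zero])
      vd (by simp only [hdd]; rw [← Finset.mul_sum, v1, mul_zero])
      (fun j => by linear_combination -(δ / d j) ^ 2 * hmsq j)
      (mul_ne_zero (hdpos 0) (half_pos (hxy 0)).ne')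
      (by rw [m01, Complex.zero_re, mul_zero]) (by rw [m01, Complex.zero_im, mul_zero])
      (by
        refine ⟨l, ?_⟩
        by_contra hc
        push Not at hc
        have e1 := (mul_eq_zero.1 hc.1).resolve_left (hdpos l)
        have e2 := (mul_eq_zero.1 hc.2).resolve_left (hdpos l)
        have e3 : m l 0 1 = 0 := Complex.ext e1 e2
        rcases mul_eq_zero.1 e3 with e | e
        · exact hl (by rw [(map_eq_zero _).1 e, zero_mul])
        · exact hl (by rw [e, mul_zero]))
      htrace
      (by
        have e : ∀ j, d j ^ 2 * (δ / d j * ((x j + y j) / 2)) = δ * d j * ((x j + y j) / 2) :=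
          fun j => by rw [sq, mul_assoc, hdd]; ring
        simp only [e]
        rw [← htr2']
        simp only [Fin.sum_univ_four] at x1 y1 ⊢
        linear_combination -δ ^ 2 * (x1 + y1))
  refine ⟨c₀, c₁, c₂, q₀, q₁, q₂, fun j => x j + y j, hsplit, hq, hdisc, hxy,
    fun j z => by rw [hrF, mxy], htrace, ?_, ?_, ?_, ?_⟩
  all_goals beta_reduce
  · rw [R0]
    linear_combination (x 0 + y 0) * ((d 0 - d 1) * (d 0 - d 2) * (d 0 - d 3)) * hdd 0 1
  · rw [R1]
    linear_combination (x 1 + y 1) * ((d 1 - d 0) * (d 1 - d 2) * (d 1 - d 3)) * hdd 1 1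
  · rw [R2]
    linear_combination (x 2 + y 2) * ((d 2 - d 0) * (d 2 - d 1) * (d 2 - d 3)) * hdd 2 1
  · rw [R3]
    linear_combination (x 3 + y 3) * ((d 3 - d 0) * (d 3 - d 1) * (d 3 - d 2)) * hdd 3 1

/-- The inequalities that hold for a projection system, for the three sign patterns. -/
theorem inequalities (h : IsProjectionSystem E F s a b δ γ) (ha : Function.Injective a)
    (hb : StrictAnti b) (hδ : 0 < δ) (hE : Module.finrank ℂ (E 0).range = 2) (ha21 : a 2 < a 1)
    {d₁ d₂ d₃ d₄ a₁ a₂ : ℝ} (e1 : d₁ = γ - a 0 - b 0) (e2 : d₂ = γ - a 0 - b 1)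
    (e3 : d₃ = γ - a 0 - b 2) (e4 : d₄ = γ - a 0 - b 3) (ea1 : a₁ = a 1 - a 0)
    (ea2 : a₂ = a 2 - a 0) :
    d₁ + d₂ + d₃ + d₄ - 2 * δ = a₁ + a₂ ∧
    (0 < a₂ → 0 < d₁ ∧ a₁ + a₂ + d₂ < d₄ + d₃ + d₁ ∧ d₃ + a₂ + d₂ < d₄ + a₁ + d₁ ∧
      d₃ + a₁ + d₁ < d₄ + a₂ + d₂ ∧ d₄ + d₁ + a₂ < d₂ + a₁ + d₃ ∧ d₄ + d₁ + d₂ < a₁ + a₂ + d₃) ∧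
    (a₂ < 0 → 0 < a₁ → d₁ < 0 ∧ 0 < d₂ ∧ a₁ + d₂ + d₁ < d₄ + d₃ + a₂ ∧
      d₃ + d₂ + d₁ < d₄ + a₁ + a₂ ∧ d₃ + a₁ + a₂ < d₄ + d₂ + d₁ ∧
      d₄ + d₂ + a₂ < d₃ + a₁ + d₁ ∧ d₄ + d₁ + a₂ < d₂ + a₁ + d₃) ∧
    (a₁ < 0 → d₂ < 0 ∧ 0 < d₃ ∧ d₃ + a₁ + d₁ < d₄ + d₂ + a₂ ∧ d₂ + a₁ + d₁ < d₄ + d₃ + a₂ ∧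
      d₃ + d₂ + a₂ < d₄ + a₁ + d₁ ∧ d₄ + a₁ + a₂ < d₃ + d₂ + d₁ ∧
      d₄ + d₁ + a₂ < d₂ + a₁ + d₃) := by
  obtain ⟨c₀, c₁, c₂, q₀, q₁, q₂, r, hsplit, hq, hdisc, hr, -, htr, R0, R1, R2, R3⟩ :=
    h.exists_sexticSplit ha hb.injective hδ hE (d := fun j => γ - a 0 - b j) (fun _ => rfl)
  rw [Fin.sum_univ_four] at htr
  rw [← e1, ← e2, ← e3, ← e4] at hsplit htr R0 R1 R2 R3
  rw [← ea1, ← ea2] at hsplit htr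
  have b01 := hb (show (0 : Fin 4) < 1 by decide)
  have b12 := hb (show (1 : Fin 4) < 2 by decide)
  have b23 := hb (show (2 : Fin 4) < 3 by decide)
  have h12 : d₁ < d₂ := by linarith
  have h23 : d₂ < d₃ := by linarith
  have h34 : d₃ < d₄ := by linarith
  have p : ∀ j, 0 < δ * r j := fun j => mul_pos hδ (hr j)
  -- Since δ r j > 0, the sign of dⱼR(dⱼ) is that of ∏_{k≠j}(dⱼ − dₖ), which alternates.
  refine ⟨htr, hsplit.inequalities_of_weights hq hdisc h12 h23 h34 (by linarith) ?_ ?_ ?_ ?_⟩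
  · have := mul_neg_of_pos_of_neg (p 0) (mul_neg_of_pos_of_neg (mul_pos_of_neg_of_neg
      (sub_neg.2 h12) (sub_neg.2 (h12.trans h23))) (sub_neg.2 (h12.trans (h23.trans h34))))
    linarith
  · have := mul_pos (p 1) (mul_pos_of_neg_of_neg (mul_neg_of_pos_of_neg
      (sub_pos.2 h12) (sub_neg.2 h23)) (sub_neg.2 (h23.trans h34)))
    linarith
  · have := mul_neg_of_pos_of_neg (p 2) (mul_neg_of_pos_of_neg (mul_pos
      (sub_pos.2 (h12.trans h23)) (sub_pos.2 h23)) (sub_neg.2 h34))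
    linarith
  · have := mul_pos (p 3) (mul_pos (mul_pos
      (sub_pos.2 (h12.trans (h23.trans h34))) (sub_pos.2 (h23.trans h34))) (sub_pos.2 h34))
    linarith

/-- The compression of `s` to the range of `F₀` is a scalar that is determined by the parameters. -/
theorem exists_common_weight {H' : Type*} [NormedAddCommGroup H'] [InnerProductSpace ℂ H']
    [CompleteSpace H'] {E' : Fin 3 → H' →L[ℂ] H'} {F' : Fin 4 → H' →L[ℂ] H'} {s' : H' →L[ℂ] H'}
    (h : IsProjectionSystem E F s a b δ γ) (h' : IsProjectionSystem E' F' s' a b δ γ)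
    (ha : Function.Injective a) (hb : Function.Injective b) (hδ : 0 < δ)
    (hE : Module.finrank ℂ (E 0).range = 2) (hE' : Module.finrank ℂ (E' 0).range = 2) :
    ∃ r : ℂ, (∀ x, F 0 (s (F 0 x)) = r • F 0 x) ∧ ∀ x, F' 0 (s' (F' 0 x)) = r • F' 0 x := by
  obtain ⟨c₀, c₁, c₂, q₀, q₁, q₂, r, hsplit, -, -, -, hr, -, R0, -⟩ :=
    h.exists_sexticSplit ha hb hδ hE (d := fun j => γ - a 0 - b j) (fun _ => rfl)
  obtain ⟨c₀', c₁', c₂', q₀', q₁', q₂', r', hsplit', -, -, -, hr', -, R0', -⟩ :=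
    h'.exists_sexticSplit ha hb hδ hE' (d := fun j => γ - a 0 - b j) (fun _ => rfl)
  -- The six roots depend only on a, b and γ, so both systems have the same R, and R(d₀) determines
  -- r 0.
  obtain ⟨rfl, rfl, rfl⟩ := hsplit.cubic_unique hsplit'
  have hne : ∀ i j, i ≠ j → (γ - a 0 - b i) - (γ - a 0 - b j) ≠ 0 := fun i j hij =>
    sub_ne_zero.2 fun k => hij (hb (by linarith))
  have e := R0.symm.trans R0'
  have e' := mul_left_cancel₀ hδ.ne' (mul_right_cancel₀ (mul_ne_zero (mul_ne_zero
    (hne 0 1 (by decide)) (hne 0 2 (by decide))) (hne 0 3 (by decide))) e)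
  exact ⟨r 0, hr 0, fun x => by rw [hr' 0, e']⟩

end IsProjectionSystem

end NecessaryConditions

end SpectralProblem

namespace SpectralProblem

/-! ### Uniqueness up to unitary equivalence -/

section Uniqueness

open scoped InnerProductSpace

variable {k l m : ℕ} {α : Fin k → ℝ} {β : Fin l → ℝ} {η : Fin m → ℝ} {γ : ℝ}
variable {H : Type*} [NormedAddCommGroup H] [InnerProductSpace ℂ H] [CompleteSpace H]
variable {H' : Type*} [NormedAddCommGroup H'] [InnerProductSpace ℂ H'] [CompleteSpace H']

/-- Irreducible finite dimensional representations with a common vector state are equivalent. -/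
theorem StarRep.unitarilyEquivalent_of_state {π : StarRep α β η γ H} {π' : StarRep α β η γ H'}
    [FiniteDimensional ℂ H] [FiniteDimensional ℂ H'] (hπ : π.IsIrreducible)
    (hπ' : π'.IsIrreducible) {ξ : H} {ξ' : H'} (h0 : ξ ≠ 0) (h0' : ξ' ≠ 0)
    (h : ∀ a, ⟪ξ, π a ξ⟫_ℂ = ⟪ξ', π' a ξ'⟫_ℂ) : π.UnitarilyEquivalent π' := by
  let f : P α β η γ →ₗ[ℂ] H :=
    { toFun := fun a => π a ξ
      map_add' := fun a b => by rw [map_add]; rfl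
      map_smul' := fun c a => by rw [map_smul]; rfl }
  let g : P α β η γ →ₗ[ℂ] H' :=
    { toFun := fun a => π' a ξ'
      map_add' := fun a b => by rw [map_add]; rfl
      map_smul' := fun c a => by rw [map_smul]; rfl }
  have hf : LinearMap.range f = ⊤ := by
    refine (hπ.2 _ (Submodule.closed_of_finiteDimensional _) ?_).resolve_left fun k => h0 ?_
    · rintro a _ ⟨b, rfl⟩
      exact ⟨a * b, by change π (a * b) ξ = π a (π b ξ); rw [map_mul]; rfl⟩
    · have : f 1 ∈ LinearMap.range f := ⟨1, rfl⟩
      rw [k, Submodule.mem_bot] at this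
      rw [← this]; change ξ = π 1 ξ; rw [map_one]; rfl
  have hg : LinearMap.range g = ⊤ := by
    refine (hπ'.2 _ (Submodule.closed_of_finiteDimensional _) ?_).resolve_left fun k => h0' ?_
    · rintro a _ ⟨b, rfl⟩
      exact ⟨a * b, by change π' (a * b) ξ' = π' a (π' b ξ'); rw [map_mul]; rfl⟩
    · have : g 1 ∈ LinearMap.range g := ⟨1, rfl⟩
      rw [k, Submodule.mem_bot] at this
      rw [← this]; change ξ' = π' 1 ξ'; rw [map_one]; rfl
  -- Equality of the states at a*a, as in the GNS construction: π(a)ξ ↦ π'(a)ξ' is well defined and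
  -- isometric.
  have hnorm : ∀ a, ‖g a‖ = ‖f a‖ := by
    intro a
    have e1 : ⟪f a, f a⟫_ℂ = ⟪ξ, π (star a * a) ξ⟫_ℂ := by
      rw [map_mul, map_star, ContinuousLinearMap.star_eq_adjoint]
      exact (ContinuousLinearMap.adjoint_inner_right _ _ _).symm
    have e2 : ⟪g a, g a⟫_ℂ = ⟪ξ', π' (star a * a) ξ'⟫_ℂ := by
      rw [map_mul, map_star, ContinuousLinearMap.star_eq_adjoint]
      exact (ContinuousLinearMap.adjoint_inner_right _ _ _).symm
    have e3 : ⟪g a, g a⟫_ℂ = ⟪f a, f a⟫_ℂ := by rw [e1, e2, h]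
    rw [inner_self_eq_norm_sq_to_K, inner_self_eq_norm_sq_to_K] at e3
    have e4 : ‖g a‖ ^ 2 = ‖f a‖ ^ 2 := by exact_mod_cast e3
    exact (sq_eq_sq₀ (norm_nonneg _) (norm_nonneg _)).1 e4
  obtain ⟨t, ht⟩ := f.exists_rightInverse_of_surjective hf
  have ht' : ∀ x, f (t x) = x := fun x => LinearMap.congr_fun ht x
  have hU : ∀ a, g (t (f a)) = g a := fun a => by
    rw [← sub_eq_zero, ← map_sub, ← norm_eq_zero, hnorm, map_sub, ht', sub_self, norm_zero]
  let U : H →ₗᵢ[ℂ] H' := ⟨g ∘ₗ t, fun x => by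
    rw [LinearMap.comp_apply, hnorm, ht']⟩
  have hUs : Function.Surjective U := fun y => by
    obtain ⟨a, rfl⟩ := LinearMap.range_eq_top.1 hg y
    exact ⟨f a, hU a⟩
  refine ⟨LinearIsometryEquiv.ofSurjective U hUs, fun a x => ?_⟩
  obtain ⟨b, rfl⟩ := LinearMap.range_eq_top.1 hf x
  change g (t (π a (f b))) = π' a (g (t (f b)))
  have e : π a (f b) = f (a * b) := by
    change π a (π b ξ) = π (a * b) ξ; rw [map_mul]; rfl
  rw [e, hU, hU]
  change π' (a * b) ξ' = π' a (π' b ξ')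
  rw [map_mul]; rfl

theorem IsProjectionSystem.exists_unit_vector {E : Fin 3 → H →L[ℂ] H} {F : Fin 4 → H →L[ℂ] H}
    {s : H →L[ℂ] H} {a : Fin 3 → ℝ} {b : Fin 4 → ℝ} {δ μ : ℝ}
    (h : IsProjectionSystem E F s a b δ μ) (j : Fin 4) : ∃ ξ, F j ξ = ξ ∧ ‖ξ‖ = 1 := by
  obtain ⟨ξ, h1, h2⟩ := exists_range_vector (fun x => by rw [h.F_apply, if_pos rfl]) (h.F_ne j)
  exact ⟨((‖ξ‖ : ℂ)⁻¹) • ξ, by rw [map_smul, h1], norm_smul_inv_norm h2⟩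

/-- Two irreducible representations that come from projection systems with the same parameters are
equivalent if the compressions of `s` to the range of `F₀` agree. -/
theorem IsProjectionSystem.unitarilyEquivalent {π : StarRep α β η γ H} {π' : StarRep α β η γ H'}
    {E : Fin 3 → H →L[ℂ] H} {F : Fin 4 → H →L[ℂ] H} {s : H →L[ℂ] H}
    {E' : Fin 3 → H' →L[ℂ] H'} {F' : Fin 4 → H' →L[ℂ] H'} {s' : H' →L[ℂ] H'}
    {a : Fin 3 → ℝ} {b : Fin 4 → ℝ} {δ μ : ℝ}
    (h : IsProjectionSystem E F s a b δ μ) (h' : IsProjectionSystem E' F' s' a b δ μ)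
    (hop : ∀ x, (∃ i, π.op x = E i ∧ π'.op x = E' i) ∨ (∃ j, π.op x = F j ∧ π'.op x = F' j) ∨
      (π.op x = s ∧ π'.op x = s'))
    (ha : Function.Injective a) (hb : Function.Injective b) (hδ : δ ≠ 0)
    (hπ : π.IsIrreducible) (hπ' : π'.IsIrreducible) {r : ℂ}
    (hr : ∀ x, F 0 (s (F 0 x)) = r • F 0 x) (hr' : ∀ x, F' 0 (s' (F' 0 x)) = r • F' 0 x) :
    π.UnitarilyEquivalent π' := by
  have := h.finiteDimensional ha hb hδ
  have := h'.finiteDimensional ha hb hδ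
  obtain ⟨ξ, hξ, hn⟩ := h.exists_unit_vector 0
  obtain ⟨ξ', hξ', hn'⟩ := h'.exists_unit_vector 0
  -- The chain of (ξ, ξ') in the direct sum is mapped by F₀ ⊕ F₀' into the line through (ξ, ξ'),
  -- because both compressions of s have the same eigenvalue r. Hence F₀ π(a)ξ and F₀' π'(a)ξ' are
  -- the same multiple of ξ and ξ', which is the value of both states at a.
  obtain ⟨W, -, hmem, iE, iF, is, hW⟩ := (h.sys.prod h'.sys).exists_invariant (ξ := (ξ, ξ'))
    (Complex.ofReal_injective.comp ha) (Complex.ofReal_injective.comp hb)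
    (Complex.ofReal_ne_zero.2 hδ) (Prod.ext hξ hξ')
  have e1 : F 0 (s ξ) = r • ξ := by have := hr ξ; rwa [hξ] at this
  have e2 : F' 0 (s' ξ') = r • ξ' := by have := hr' ξ'; rwa [hξ'] at this
  replace hW := hW r (Prod.ext e1 e2)
  have hinv : ∀ a : P α β η γ, ∀ x ∈ W, ((π a x.1, π' a x.2) : H × H') ∈ W := by
    intro a
    induction a using P.induction with
    | scalar c =>
      intro x hx
      have := W.smul_mem c hx
      rw [AlgHomClass.commutes, AlgHomClass.commutes, Algebra.algebraMap_eq_smul_one,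
        Algebra.algebraMap_eq_smul_one]
      exact this
    | gen x =>
      intro y hy
      change (π.op x y.1, π'.op x y.2) ∈ W
      rcases hop x with ⟨i, k1, k2⟩ | ⟨j, k1, k2⟩ | ⟨k1, k2⟩
      · rw [k1, k2]; exact iE i y hy
      · rw [k1, k2]; exact iF j y hy
      · rw [k1, k2]; exact is y hy
    | mul a b ha hb =>
      intro x hx
      rw [map_mul, map_mul]
      exact ha _ (hb x hx)
    | add a b ha hb =>
      intro x hx
      rw [map_add, map_add]
      exact W.add_mem (ha x hx) (hb x hx)
  refine StarRep.unitarilyEquivalent_of_state hπ hπ' (ξ := ξ) (ξ' := ξ')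
    (fun k => by simp [k] at hn) (fun k => by simp [k] at hn') fun a => ?_
  obtain ⟨c, hc⟩ := Submodule.mem_span_singleton.1 (hW _ (hinv a _ hmem))
  have c1 : c • ξ = F 0 (π a ξ) := congrArg Prod.fst hc
  have c2 : c • ξ' = F' 0 (π' a ξ') := congrArg Prod.snd hc
  have s1 : ⟪ξ, π a ξ⟫_ℂ = c := by
    rw [← hξ, inner_map_of_star_eq (h.F_star 0), hξ, ← c1, inner_smul_right,
      inner_self_eq_norm_sq_to_K, hn]; simp
  have s2 : ⟪ξ', π' a ξ'⟫_ℂ = c := by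
    rw [← hξ', inner_map_of_star_eq (h'.F_star 0), hξ', ← c2, inner_smul_right,
      inner_self_eq_norm_sq_to_K, hn']; simp
  rw [s1, s2]

end Uniqueness

end SpectralProblem

namespace SpectralProblem

/-! ### Operators that are diagonal in an orthonormal family -/

section DiagonalOperator

open scoped InnerProductSpace

variable {ι : Type*} [Fintype ι] {H : Type*} [NormedAddCommGroup H] [InnerProductSpace ℂ H]

/-- The operator `∑ gᵢ ⟨vᵢ, ·⟩ vᵢ`. -/
noncomputable def diagonalOperator (v : ι → H) (g : ι → ℝ) : H →L[ℂ] H :=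
  ∑ i, (g i : ℂ) • InnerProductSpace.rankOne ℂ (v i) (v i)

theorem diagonalOperator_apply (v : ι → H) (g : ι → ℝ) (x : H) :
    diagonalOperator v g x = ∑ i, (g i : ℂ) • ⟪v i, x⟫_ℂ • v i := by
  simp [diagonalOperator]

theorem diagonalOperator_apply_self {v : ι → H} (hv : Orthonormal ℂ v) (g : ι → ℝ) (i : ι) :
    diagonalOperator v g (v i) = (g i : ℂ) • v i := by
  classical
  rw [diagonalOperator_apply, Finset.sum_eq_single i]
  · rw [orthonormal_iff_ite.1 hv, if_pos rfl, one_smul]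
  · intro j _ hj
    rw [orthonormal_iff_ite.1 hv, if_neg hj, zero_smul, smul_zero]
  · simp

theorem star_diagonalOperator [CompleteSpace H] (v : ι → H) (g : ι → ℝ) :
    star (diagonalOperator v g) = diagonalOperator v g := by
  rw [diagonalOperator, star_sum]
  refine Finset.sum_congr rfl fun i _ => ?_
  rw [star_smul, ContinuousLinearMap.star_eq_adjoint, InnerProductSpace.adjoint_rankOne]
  simp

theorem diagonalOperator_mul {v : ι → H} (hv : Orthonormal ℂ v) (g h : ι → ℝ) :
    diagonalOperator v g * diagonalOperator v h = diagonalOperator v (g * h) := by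
  ext x
  rw [mul_apply_eq_comp, diagonalOperator_apply v h, map_sum, diagonalOperator_apply]
  refine Finset.sum_congr rfl fun i _ => ?_
  rw [map_smul, map_smul, diagonalOperator_apply_self hv, smul_smul, smul_smul, smul_smul,
    Pi.mul_apply, Complex.ofReal_mul]
  congr 1
  ring

theorem diagonalOperator_one (v : OrthonormalBasis ι ℂ H) : diagonalOperator v 1 = 1 := by
  ext x
  rw [diagonalOperator_apply]
  simpa using v.sum_repr' x

theorem sum_diagonalOperator {κ : Type*} [Fintype κ] (v : ι → H) (g : κ → ι → ℝ) :
    ∑ k, diagonalOperator v (g k) = diagonalOperator v (∑ k, g k) := by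
  simp only [diagonalOperator, Finset.sum_apply, Complex.ofReal_sum, Finset.sum_smul]
  exact Finset.sum_comm

theorem smul_diagonalOperator (v : ι → H) (c : ℝ) (g : ι → ℝ) :
    (c : ℂ) • diagonalOperator v g = diagonalOperator v (c • g) := by
  simp only [diagonalOperator, Finset.smul_sum, smul_smul, Pi.smul_apply, smul_eq_mul,
    Complex.ofReal_mul]

theorem trace_diagonalOperator [FiniteDimensional ℂ H] {v : ι → H} (hv : Orthonormal ℂ v)
    (g : ι → ℝ) : LinearMap.trace ℂ H (diagonalOperator v g : H →ₗ[ℂ] H) = ((∑ i, g i : ℝ) : ℂ) := by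
  classical
  rw [diagonalOperator, ContinuousLinearMap.toLinearMap_sum, map_sum, Complex.ofReal_sum]
  refine Finset.sum_congr rfl fun i _ => ?_
  rw [ContinuousLinearMap.toLinearMap_smul, map_smul, InnerProductSpace.trace_rankOne,
    orthonormal_iff_ite.1 hv, if_pos rfl, smul_eq_mul, mul_one]

theorem diagonalOperator_zero (v : ι → H) : diagonalOperator v 0 = 0 := by
  simp [diagonalOperator]

end DiagonalOperator

/-! ### Recovering a spectrum from two traces -/

section SpectralProjections

open scoped InnerProductSpace

variable {H : Type*} [NormedAddCommGroup H] [InnerProductSpace ℂ H] [FiniteDimensional ℂ H]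

/-- A symmetric operator on a four dimensional space that annihilates two independent vectors is
determined up to conjugation by the traces of its first two powers. -/
theorem exists_eigenbasis_of_trace (hH : Module.finrank ℂ H = 4) {T : H →ₗ[ℂ] H}
    (hT : T.IsSymmetric) {u : Fin 2 → H} (hu : LinearIndependent ℂ u) (hTu : ∀ i, T (u i) = 0)
    {a₁ a₂ : ℝ} (h1 : LinearMap.trace ℂ H T = ((a₁ + a₂ : ℝ) : ℂ))
    (h2 : LinearMap.trace ℂ H (T * T) = ((a₁ ^ 2 + a₂ ^ 2 : ℝ) : ℂ)) :
    ∃ (v : OrthonormalBasis (Fin 4) ℂ H) (lam : Fin 4 → ℝ), (∀ i, T (v i) = (lam i : ℂ) • v i) ∧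
      (∀ i, lam i = 0 ∨ lam i = a₁ ∨ lam i = a₂) ∧ ∑ i, lam i = a₁ + a₂ ∧
      ∑ i, lam i ^ 2 = a₁ ^ 2 + a₂ ^ 2 := by
  let v := hT.eigenvectorBasis hH
  let lam := hT.eigenvalues hH
  have hv : ∀ i, T (v i) = (lam i : ℂ) • v i := hT.apply_eigenvectorBasis hH
  have s1 : ∑ i, lam i = a₁ + a₂ := by
    rw [LinearMap.trace_eq_sum_inner T v] at h1
    simp only [hv, inner_smul_right, orthonormal_iff_ite.1 v.orthonormal, if_true, mul_one] at h1
    exact_mod_cast h1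
  have s2 : ∑ i, lam i ^ 2 = a₁ ^ 2 + a₂ ^ 2 := by
    rw [LinearMap.trace_eq_sum_inner _ v] at h2
    simp only [Module.End.mul_apply, map_smul, hv, inner_smul_right,
      orthonormal_iff_ite.1 v.orthonormal, if_true, mul_one] at h2
    simp only [sq] at h2 ⊢
    exact_mod_cast h2
  refine ⟨v, lam, hv, fun i => ?_, s1, s2⟩
  have hcard : (Finset.univ.filter fun i => lam i ≠ 0).card ≤ 2 := by
    have hker : 2 ≤ Module.finrank ℂ (LinearMap.ker T) := by
      have : LinearIndependent ℂ (fun i => (⟨u i, hTu i⟩ : LinearMap.ker T)) :=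
        LinearIndependent.of_comp (LinearMap.ker T).subtype hu
      simpa using this.fintype_card_le_finrank
    have hrank : Module.finrank ℂ (LinearMap.range T) ≤ 2 := by
      have := T.finrank_range_add_finrank_ker
      omega
    have : LinearIndependent ℂ (fun i : {i // lam i ≠ 0} =>
        (⟨v i, (lam i : ℂ)⁻¹ • v i, by
          rw [map_smul, hv, inv_smul_smul₀ (Complex.ofReal_ne_zero.2 i.2)]⟩ : LinearMap.range T)) :=
      LinearIndependent.of_comp (LinearMap.range T).subtype
        (v.orthonormal.linearIndependent.comp _ Subtype.val_injective)
    have := this.fintype_card_le_finrank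
    rw [Fintype.card_subtype] at this
    exact this.trans hrank
  by_cases h0 : lam i = 0
  · exact Or.inl h0
  refine Or.inr ?_
  obtain ⟨j, hij, hj⟩ : ∃ j, i ≠ j ∧ ∀ k, k ≠ i ∧ k ≠ j → lam k = 0 := by
    by_cases hex : ∃ j, j ≠ i ∧ lam j ≠ 0
    · obtain ⟨j, hji, hj0⟩ := hex
      refine ⟨j, hji.symm, fun k ⟨hki, hkj⟩ => ?_⟩
      by_contra hk
      have : ({i, j, k} : Finset (Fin 4)) ⊆ Finset.univ.filter fun i => lam i ≠ 0 := by
        intro l hl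
        simp only [Finset.mem_insert, Finset.mem_singleton] at hl
        rcases hl with rfl | rfl | rfl <;> simpa
      have := Finset.card_le_card this
      rw [Finset.card_eq_three.2 ⟨i, j, k, hji.symm, hki.symm, hkj.symm, rfl⟩] at this
      omega
    · push Not at hex
      -- All other eigenvalues vanish here, so any index different from i serves as j.
      exact ⟨i + 1, by simp, fun k hk => hex k hk.1⟩
  rw [Finset.sum_eq_add i j hij (fun k _ hk => hj k hk) (by simp) (by simp)] at s1
  rw [Finset.sum_eq_add i j hij (fun k _ hk => by rw [hj k hk, sq, zero_mul]) (by simp)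
    (by simp)] at s2
  -- With at most two nonzero eigenvalues, the sum and the sum of squares give (λᵢ − a₁)(λᵢ − a₂) =
  -- 0.
  rw [← sub_eq_zero, ← sub_eq_zero (b := a₂), ← mul_eq_zero]
  rw [eq_sub_of_add_eq' s1] at s2
  linear_combination s2 / 2

end SpectralProjections

end SpectralProblem

namespace SpectralProblem

/-! ### Building a projection system from the matrix V -/

section Construction

open scoped InnerProductSpace ComplexConjugate

variable {H : Type*} [NormedAddCommGroup H] [InnerProductSpace ℂ H]

theorem sum_spectral_indicator {R : Type*} [Ring R] [DecidableEq R] {a : Fin 3 → R}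
    (ha : Function.Injective a) {r : R} {f : Fin 3 → R} (hr : r = a 0 ∨ r = a 1 ∨ r = a 2)
    {y : R} (hy : ∀ k, r = a k → f k = y) : ∑ k, f k * (if r = a k then 1 else 0) = y := by
  obtain ⟨k, hk⟩ : ∃ k, r = a k := by
    rcases hr with h | h | h
    exacts [⟨0, h⟩, ⟨1, h⟩, ⟨2, h⟩]
  rw [Finset.sum_eq_single k, if_pos hk, mul_one, hy k hk]
  · intro l _ hl
    rw [if_neg fun h => hl (ha (h.symm.trans hk)), mul_zero]
  · simp

theorem inner_basis_sum (f : OrthonormalBasis (Fin 4) ℂ H) (c : Fin 4 → ℂ) (i : Fin 4) :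
    ⟪f i, ∑ j, c j • f j⟫_ℂ = c i := by
  simp [orthonormal_iff_ite.1 f.orthonormal]

theorem inner_sum_basis (f : OrthonormalBasis (Fin 4) ℂ H) (c : Fin 4 → ℂ) (x : H) :
    ⟪∑ j, c j • f j, x⟫_ℂ = ∑ j, conj (c j) * ⟪f j, x⟫_ℂ := by
  simp only [sum_inner, inner_smul_left]

/-- A projection system in terms of an eigenbasis `f` of `∑ bⱼ Fⱼ` and the coordinates `V` of an
orthonormal basis of the range of `s`. -/
theorem exists_projectionSystem [CompleteSpace H] (f : OrthonormalBasis (Fin 4) ℂ H)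
    {a : Fin 3 → ℝ} (ha : Function.Injective a) {b d : Fin 4 → ℝ} {δ γ : ℝ} (hδ : δ ≠ 0)
    (hd : ∀ j, d j = γ - a 0 - b j) (hd0 : ∀ j, d j ≠ 0) {V : Fin 4 → Fin 2 → ℂ}
    (hV : ∀ i k, ∑ j, conj (V j i) * V j k = if i = k then 1 else 0)
    (hVd : ∀ i k, ∑ j, conj (V j i) * (((d j)⁻¹ : ℝ) * V j k) =
      if i = k then ((δ⁻¹ : ℝ) : ℂ) else 0)
    (hVij : ∀ i j, i ≠ j → ∑ k, V i k * conj (V j k) ≠ 0)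
    (htr : ∑ j, d j - 2 * δ = (a 1 - a 0) + (a 2 - a 0))
    (htr2 : (∑ j, d j ^ 2 : ℝ) - 2 * δ * ∑ j, d j * ∑ k, V j k * conj (V j k) + 2 * δ ^ 2 =
      (((a 1 - a 0) ^ 2 + (a 2 - a 0) ^ 2 : ℝ) : ℂ)) :
    ∃ (E : Fin 3 → H →L[ℂ] H) (F : Fin 4 → H →L[ℂ] H) (s : H →L[ℂ] H),
      IsProjectionSystem E F s a b δ γ ∧ Module.finrank ℂ (E 0).range = 2 := by
  classical
  have hfin : FiniteDimensional ℂ H := f.toBasis.finiteDimensional_of_finite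
  have hH : Module.finrank ℂ H = 4 := by simpa using Module.finrank_eq_card_basis f.toBasis
  have hf := f.orthonormal
  set w : Fin 2 → H := fun k => ∑ j, V j k • f j with hw
  have fw : ∀ j k, ⟪f j, w k⟫_ℂ = V j k := fun j k => inner_basis_sum f _ j
  have wf : ∀ j k, ⟪w k, f j⟫_ℂ = conj (V j k) := fun j k => by rw [← inner_conj_symm, fw]
  have hwo : Orthonormal ℂ w := orthonormal_iff_ite.2 fun i k => by
    rw [← hV, hw, inner_sum_basis]
    exact Finset.sum_congr rfl fun j _ => by rw [fw]
  set D := diagonalOperator f d with hD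
  set s := diagonalOperator w 1 with hs
  have hss : s * s = s := by rw [hs, diagonalOperator_mul hwo, one_mul]
  have hsw : ∀ k, s (w k) = w k := fun k => by
    rw [hs, diagonalOperator_apply_self hwo]; simp
  have hs_apply : ∀ x, s x = ∑ k, ⟪w k, x⟫_ℂ • w k := fun x => by
    rw [hs, diagonalOperator_apply]; simp
  have fsf : ∀ i j, ⟪f i, s (f j)⟫_ℂ = ∑ k, V i k * conj (V j k) := fun i j => by
    rw [hs_apply, inner_sum]
    exact Finset.sum_congr rfl fun k _ => by rw [inner_smul_right, fw, wf, mul_comm]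
  -- These vectors D⁻¹ w k span what will be in the kernel of D − δ s: the identity V*D⁻¹V = δ⁻¹
  -- says that δ s (u k) = w k.
  set u : Fin 2 → H := fun k => diagonalOperator f d⁻¹ (w k) with hu
  have hDu : ∀ k, D (u k) = w k := fun k => by
    change (D * diagonalOperator f d⁻¹) (w k) = w k
    rw [hD, diagonalOperator_mul hf, show d * d⁻¹ = 1 from funext fun j => mul_inv_cancel₀ (hd0 j),
      diagonalOperator_one]
    rfl
  have huli : LinearIndependent ℂ u := by
    refine LinearIndependent.of_comp (D : H →ₗ[ℂ] H) ?_
    rw [show (D : H →ₗ[ℂ] H) ∘ u = w from funext hDu]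
    exact hwo.linearIndependent
  have hsu : ∀ k, (δ : ℂ) • s (u k) = w k := fun k => by
    have : ∀ i, ⟪w i, u k⟫_ℂ = if i = k then ((δ⁻¹ : ℝ) : ℂ) else 0 := fun i => by
      rw [← hVd, hw, inner_sum_basis]
      refine Finset.sum_congr rfl fun j _ => ?_
      rw [hu]
      beta_reduce
      rw [diagonalOperator_apply]
      simp only [smul_smul]
      rw [inner_basis_sum, fw]
      simp
    rw [hs_apply, Finset.sum_eq_single k, this, if_pos rfl, smul_smul, ← Complex.ofReal_mul,
      mul_inv_cancel₀ hδ, Complex.ofReal_one, one_smul]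
    · intro i _ hi
      rw [this, if_neg hi, zero_smul]
    · simp
  set T := D - (δ : ℂ) • s with hT
  have hTs : star T = T := by
    rw [hT, star_sub, star_smul, hD, hs, star_diagonalOperator, star_diagonalOperator]
    simp
  have hTu : ∀ k, T (u k) = 0 := fun k => by
    change D (u k) - (δ : ℂ) • s (u k) = 0
    rw [hDu, hsu, sub_self]
  have trs : LinearMap.trace ℂ H (s : H →ₗ[ℂ] H) = 2 := by
    rw [hs, trace_diagonalOperator hwo]; simp
  have t1 : LinearMap.trace ℂ H (T : H →ₗ[ℂ] H) = (((a 1 - a 0) + (a 2 - a 0) : ℝ) : ℂ) := by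
    rw [← htr, hT, ContinuousLinearMap.toLinearMap_sub, ContinuousLinearMap.toLinearMap_smul,
      map_sub, map_smul, trs, hD, trace_diagonalOperator hf]
    push_cast
    rw [smul_eq_mul, mul_comm]
  have tDs : LinearMap.trace ℂ H ((s * D : H →L[ℂ] H) : H →ₗ[ℂ] H) =
      ∑ j, d j * ∑ k, V j k * conj (V j k) := by
    rw [LinearMap.trace_eq_sum_inner _ f]
    refine Finset.sum_congr rfl fun j _ => ?_
    change ⟪f j, s (D (f j))⟫_ℂ = _
    rw [hD, diagonalOperator_apply_self hf, map_smul, inner_smul_right, fsf]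
  have t2 : LinearMap.trace ℂ H ((T : H →ₗ[ℂ] H) * (T : H →ₗ[ℂ] H)) =
      (((a 1 - a 0) ^ 2 + (a 2 - a 0) ^ 2 : ℝ) : ℂ) := by
    have e : T * T = D * D - (δ : ℂ) • (D * s + s * D) + ((δ : ℂ) ^ 2) • s := by
      rw [hT, sub_mul, mul_sub, mul_sub, smul_mul_smul_comm, hss, smul_mul_assoc, mul_smul_comm,
        smul_add, sq]
      abel
    have c : LinearMap.trace ℂ H ((D * s : H →L[ℂ] H) : H →ₗ[ℂ] H) =
      LinearMap.trace ℂ H ((s * D : H →L[ℂ] H) : H →ₗ[ℂ] H) := LinearMap.trace_mul_comm ℂ _ _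
    have tDD : LinearMap.trace ℂ H ((D * D : H →L[ℂ] H) : H →ₗ[ℂ] H) = ((∑ j, d j ^ 2 : ℝ) : ℂ) := by
      rw [hD, diagonalOperator_mul hf, trace_diagonalOperator hf]
      simp [sq]
    change LinearMap.trace ℂ H ((T * T : H →L[ℂ] H) : H →ₗ[ℂ] H) = _
    rw [e, ← htr2, ContinuousLinearMap.toLinearMap_add, ContinuousLinearMap.toLinearMap_sub,
      ContinuousLinearMap.toLinearMap_smul, ContinuousLinearMap.toLinearMap_smul,
      ContinuousLinearMap.toLinearMap_add, map_add, map_sub, map_smul, map_smul, map_add, c, tDs,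
      tDD, trs, smul_eq_mul, smul_eq_mul]
    ring
  obtain ⟨v, lam, hTv, hlam, l1, l2⟩ := exists_eigenbasis_of_trace hH
    ((ContinuousLinearMap.isSelfAdjoint_iff_isSymmetric).1 hTs) huli hTu t1 t2
  have hv := v.orthonormal
  set a' : Fin 3 → ℝ := fun k => a k - a 0 with ha'
  have ha'i : Function.Injective a' := fun i j h => ha (by simpa [ha'] using h)
  have hlam' : ∀ i, lam i = a' 0 ∨ lam i = a' 1 ∨ lam i = a' 2 := fun i => by
    simpa [ha'] using hlam i
  have hTd : T = diagonalOperator v lam := by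
    refine ContinuousLinearMap.coe_injective (v.toBasis.ext fun i => ?_)
    rw [v.coe_toBasis]
    exact (hTv i).trans (diagonalOperator_apply_self hv _ _).symm
  -- The E k will be the spectral projections of T at a' k = a k − a 0, where a' 0 = 0.
  set χ : Fin 3 → Fin 4 → ℝ := fun k i => if lam i = a' k then 1 else 0 with hχ
  set E : Fin 3 → H →L[ℂ] H := fun k => diagonalOperator v (χ k) with hE
  set F : Fin 4 → H →L[ℂ] H := fun j => diagonalOperator f (Pi.single j 1) with hF
  have hFf : ∀ i x, F i x = ⟪f i, x⟫_ℂ • f i := fun i x => by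
    rw [hF]
    beta_reduce
    rw [diagonalOperator_apply, Finset.sum_eq_single i]
    · simp
    · intro j _ hj; simp [hj]
    · simp
  have trE : ∀ k, LinearMap.trace ℂ H (E k : H →ₗ[ℂ] H) = ((∑ i, χ k i : ℝ) : ℂ) := fun k =>
    trace_diagonalOperator hv _
  have E_mul : ∀ i j, E i * E j = if i = j then E i else 0 := fun i j => by
    rw [hE]
    beta_reduce
    rw [diagonalOperator_mul hv]
    split_ifs with h
    · subst h
      congr 1
      ext l
      simp [hχ]
    · rw [← diagonalOperator_zero v]
      congr 1
      ext l
      simp only [hχ, Pi.mul_apply, mul_ite, mul_one, mul_zero, Pi.zero_apply]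
      split_ifs with h1 h2
      · exact absurd (ha'i (h2.symm.trans h1)) h
      · rfl
      · rfl
  have E_sum : ∑ k, E k = 1 := by
    rw [hE, sum_diagonalOperator, ← diagonalOperator_one v]
    congr 1
    ext i
    rw [Finset.sum_apply, Pi.one_apply]
    rw [← sum_spectral_indicator ha'i (hlam' i) (f := 1) (y := 1) (fun _ _ => rfl)]
    exact Finset.sum_congr rfl fun k _ => (one_mul _).symm
  have F_mul : ∀ i j, F i * F j = if i = j then F i else 0 := fun i j => by
    rw [hF]
    beta_reduce
    rw [diagonalOperator_mul hf]
    split_ifs with h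
    · subst h
      rw [← Pi.single_mul, one_mul]
    · rw [← diagonalOperator_zero f]
      congr 1
      ext l
      by_cases hl : l = i
      · subst hl; simp [h]
      · simp [hl]
  have F_sum : ∑ j, F j = 1 := by
    rw [hF, sum_diagonalOperator, ← diagonalOperator_one f]
    congr 1
    exact Finset.univ_sum_single 1
  have aE : ∑ k, (a k : ℂ) • E k = (a 0 : ℂ) • 1 + T := by
    have : ∑ k, (a' k : ℂ) • E k = T := by
      simp only [hE, smul_diagonalOperator]
      rw [sum_diagonalOperator, hTd]
      congr 1
      ext i
      rw [Finset.sum_apply]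
      exact sum_spectral_indicator ha'i (hlam' i) (fun k hk => hk.symm)
    rw [← this, ← E_sum, Finset.smul_sum, ← Finset.sum_add_distrib]
    refine Finset.sum_congr rfl fun k _ => ?_
    rw [← add_smul]
    simp [ha']
  have bF : ∑ j, (b j : ℂ) • F j = ((γ - a 0 : ℝ) : ℂ) • 1 - D := by
    have : D = ∑ j, (d j : ℂ) • F j := by
      simp only [hF, smul_diagonalOperator]
      rw [sum_diagonalOperator, hD]
      congr 1
      ext i
      simp [Finset.sum_apply, Pi.single_apply]
    rw [this, ← F_sum, Finset.smul_sum, ← Finset.sum_sub_distrib]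
    refine Finset.sum_congr rfl fun j _ => ?_
    rw [← sub_smul, ← Complex.ofReal_sub, hd]
    congr 2
    ring
  have a10 : a' 1 ≠ 0 := sub_ne_zero.2 (ha.ne (by decide))
  have a20 : a' 2 ≠ 0 := sub_ne_zero.2 (ha.ne (by decide))
  have a12 : a' 1 ≠ a' 2 := ha'i.ne (by decide)
  have a00 : a' 0 = 0 := sub_self _
  -- On the three possible eigenvalues the indicator of 0 is a quadratic polynomial, so the
  -- multiplicity of 0 follows from the two traces.
  have χ0 : ∑ i, χ 0 i = 2 := by
    have : ∀ i, χ 0 i = (lam i ^ 2 - (a' 1 + a' 2) * lam i + a' 1 * a' 2) / (a' 1 * a' 2) := by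
      intro i
      simp only [hχ, a00]
      rcases hlam i with h | h | h
      · rw [if_pos h, h]; field_simp; ring
      · rw [if_neg (by rw [h]; exact a10), h]; field_simp; simp [ha']; ring
      · rw [if_neg (by rw [h]; exact a20), h]; field_simp; simp [ha']; ring
    simp only [this]
    rw [← Finset.sum_div, Finset.sum_add_distrib, Finset.sum_sub_distrib, l2, ← Finset.mul_sum, l1]
    rw [div_eq_iff (mul_ne_zero a10 a20)]
    simp [ha']; ring
  have rE : Module.finrank ℂ (E 0).range = 2 := by
    have := trace_eq_finrank_range (T := E 0) fun x => by
      have := congrArg (fun A : H →L[ℂ] H => A x) (E_mul 0 0)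
      simpa using this
    rw [trE, χ0] at this
    exact_mod_cast this.symm
  have χ_zero : ∀ k, E k = 0 → ∀ i, lam i ≠ a' k := fun k hk i h => by
    have h1 : E k (v i) = (χ k i : ℂ) • v i := diagonalOperator_apply_self hv _ _
    rw [hk, hχ] at h1
    beta_reduce at h1
    rw [if_pos h, Complex.ofReal_one, one_smul] at h1
    exact hv.ne_zero i h1.symm
  -- If one nonzero eigenvalue were missing, the sum of squares would be y times the sum, which is
  -- incompatible with a' 1 and a' 2 being distinct and nonzero.
  have two_values : ∀ y, (∀ i, lam i = 0 ∨ lam i = y) →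
      (a 1 - a 0) ^ 2 + (a 2 - a 0) ^ 2 = y * ((a 1 - a 0) + (a 2 - a 0)) := fun y hy => by
    rw [← l1, ← l2, Finset.mul_sum]
    refine Finset.sum_congr rfl fun i _ => ?_
    rcases hy i with h | h <;> rw [h] <;> ring
  -- A nonzero off-diagonal entry excludes both.
  have sne : s ≠ 0 ∧ s ≠ 1 := by
    have h01 := hVij 0 1 (by decide)
    rw [← fsf] at h01
    constructor <;> rintro h <;> rw [h] at h01 <;> refine h01 ?_
    · simp
    · exact (orthonormal_iff_ite.1 hf 0 1).trans (by simp)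
  refine ⟨E, F, s, ⟨⟨?_, ?_, ?_, ?_, ?_, ?_⟩, ?_, ?_, ?_, ?_, ?_, sne.1, sne.2, ?_⟩, rE⟩
  · intro i j
    refine (congrArg ContinuousLinearMap.toLinearMap (E_mul i j)).trans ?_
    split_ifs <;> rfl
  · simpa using congrArg ContinuousLinearMap.toLinearMap E_sum
  · intro i j
    refine (congrArg ContinuousLinearMap.toLinearMap (F_mul i j)).trans ?_
    split_ifs <;> rfl
  · simpa using congrArg ContinuousLinearMap.toLinearMap F_sum
  · exact congrArg ContinuousLinearMap.toLinearMap hss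
  · have : ∑ k, (a k : ℂ) • E k + ∑ j, (b j : ℂ) • F j + (δ : ℂ) • s = (γ : ℂ) • 1 := by
      rw [aE, bF, hT]
      push_cast
      rw [sub_smul]
      abel
    simpa using congrArg ContinuousLinearMap.toLinearMap this
  · exact fun k => star_diagonalOperator _ _
  · exact fun j => star_diagonalOperator _ _
  · exact star_diagonalOperator _ _
  · intro k hk
    have h := χ_zero k hk
    fin_cases k
    · rw [show E 0 = 0 from hk] at rE
      have : (0 : H →L[ℂ] H).range = ⊥ := LinearMap.range_zero
      rw [this, finrank_bot] at rE
      omega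
    · have := two_values (a 2 - a 0) fun i => (hlam i).imp_right fun o => o.resolve_left (h i)
      exact mul_ne_zero a10 (sub_ne_zero.2 a12) (by simp only [ha']; linear_combination this)
    · have := two_values (a 1 - a 0) fun i => (hlam i).imp_right fun o => o.resolve_right (h i)
      exact mul_ne_zero a20 (sub_ne_zero.2 a12) (by simp only [ha']; linear_combination -this)
  · intro j hj
    have := hFf j (f j)
    rw [hj, orthonormal_iff_ite.1 hf, if_pos rfl, one_smul] at this
    exact hf.ne_zero j this.symm
  -- A nonzero K invariant under the Fⱼ contains some f j; since all off-diagonal entries of s are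
  -- nonzero, applying s and then the projections yields every f i.
  · intro K _ _ hKF hKs
    refine or_iff_not_imp_left.2 fun hK => ?_
    have mem_of : ∀ j, ∀ x ∈ K, ⟪f j, x⟫_ℂ ≠ 0 → f j ∈ K := fun j x hx h => by
      have := hKF j x hx
      rw [hFf] at this
      exact (K.smul_mem_iff h).1 this
    obtain ⟨x, hx, hx0⟩ := K.ne_bot_iff.1 hK
    obtain ⟨j, hj⟩ : ∃ j, ⟪f j, x⟫_ℂ ≠ 0 := by
      by_contra hc
      push Not at hc
      exact hx0 (by rw [← f.sum_repr' x]; simp [hc])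
    have hjK := mem_of j x hx hj
    have hall : ∀ i, f i ∈ K := fun i => by
      by_cases hij : i = j
      · rwa [hij]
      · exact mem_of i _ (hKs _ hjK) (by rw [fsf]; exact hVij i j hij)
    rw [eq_top_iff, ← f.toBasis.span_eq, Submodule.span_le]
    rintro _ ⟨i, rfl⟩
    rw [f.coe_toBasis]
    exact hall i

end Construction

end SpectralProblem

namespace SpectralProblem

/-! ### Explicit weights and coordinates from the sextic -/

section Weights

open scoped ComplexConjugate

/-- Coordinates of an orthonormal pair with prescribed weights. -/
theorem exists_coordinates_of_weights {d ω : Fin 4 → ℝ} {η : Fin 4 → ℂ} {δ : ℝ} (hδ : 0 < δ)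
    (hω : ∀ j, 0 < d j * ω j) (hη : ∀ j, η j * conj (η j) = (ω j : ℂ) ^ 2)
    (ω0 : ∑ j, ω j = 1) (ω1 : ∑ j, d j * ω j = δ) (η0 : ∑ j, η j = 0)
    (η1 : ∑ j, (d j : ℂ) * η j = 0)
    (hij : ∀ i j, i ≠ j → (ω i : ℂ) * ω j + η i * conj (η j) ≠ 0) :
    ∃ V : Fin 4 → Fin 2 → ℂ,
      (∀ i k, ∑ j, conj (V j i) * V j k = if i = k then 1 else 0) ∧
      (∀ i k, ∑ j, conj (V j i) * (((d j)⁻¹ : ℝ) * V j k) =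
        if i = k then ((δ⁻¹ : ℝ) : ℂ) else 0) ∧
      (∀ i j, i ≠ j → ∑ k, V i k * conj (V j k) ≠ 0) ∧
      ∀ j, ∑ k, V j k * conj (V j k) = (2 * (d j * ω j) / δ : ℝ) := by
  have hd0 : ∀ j, (d j : ℂ) ≠ 0 := fun j =>
    Complex.ofReal_ne_zero.2 (left_ne_zero_of_mul (hω j).ne')
  have hω0 : ∀ j, (ω j : ℂ) ≠ 0 := fun j =>
    Complex.ofReal_ne_zero.2 (right_ne_zero_of_mul (hω j).ne')
  have hδ0 : (δ : ℂ) ≠ 0 := Complex.ofReal_ne_zero.2 hδ.ne'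
  set r : Fin 4 → ℝ := fun j => √(d j * ω j / δ) with hr
  have hr2 : ∀ j, (r j : ℂ) * r j = d j * ω j / δ := fun j => by
    rw [← Complex.ofReal_mul, hr, Real.mul_self_sqrt (div_pos (hω j) hδ).le]
    push_cast
    rfl
  have hr0 : ∀ j, (r j : ℂ) ≠ 0 := fun j =>
    Complex.ofReal_ne_zero.2 (Real.sqrt_pos.2 (div_pos (hω j) hδ)).ne'
  -- The factor η j / ω j has modulus one, so both entries of a row have the same modulus r j. Two
  -- squares in Q suffice, and the coordinate τ is taken to be zero.
  set V : Fin 4 → Fin 2 → ℂ := fun j => ![(r j : ℂ), r j * (η j / ω j)] with hV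
  have V0 : ∀ j, V j 0 = r j := fun j => rfl
  have V1 : ∀ j, V j 1 = r j * (η j / ω j) := fun j => rfl
  have p00 : ∀ j, conj (V j 0) * V j 0 = d j * ω j / δ := fun j => by
    rw [V0, Complex.conj_ofReal, hr2]
  have p01 : ∀ j, conj (V j 0) * V j 1 = d j * η j / δ := fun j => by
    rw [V0, V1, Complex.conj_ofReal, ← mul_assoc, hr2]
    field_simp [hω0 j]
  have p11 : ∀ j, conj (V j 1) * V j 1 = d j * ω j / δ := fun j => by
    rw [V1, map_mul, map_div₀, Complex.conj_ofReal, Complex.conj_ofReal, mul_mul_mul_comm, hr2,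
      div_mul_div_comm, mul_comm (conj _), hη, ← sq, div_self (pow_ne_zero 2 (hω0 j)), mul_one]
  have p10 : ∀ j, conj (V j 1) * V j 0 = conj (d j * η j / δ) := fun j => by
    rw [← p01, map_mul, Complex.conj_conj, mul_comm]
  have ω0' : ∑ j, (ω j : ℂ) = 1 := by exact_mod_cast ω0
  have ω1' : ∑ j, (d j : ℂ) * ω j = δ := by exact_mod_cast ω1
  have q : ∀ i k j, conj (V j i) * (((d j)⁻¹ : ℝ) * V j k) =
      (d j : ℂ)⁻¹ * (conj (V j i) * V j k) := fun i k j => by push_cast; ring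
  have c : ∀ j (z : ℂ), (d j : ℂ)⁻¹ * (d j * z / δ) = z / δ := fun j z => by
    field_simp [hd0 j]
  have c' : ∀ j (z : ℂ), (d j : ℂ)⁻¹ * conj (d j * z / δ) = conj (z / δ) := fun j z => by
    rw [← c j z, map_mul, map_inv₀, Complex.conj_ofReal]
  refine ⟨V, ?_, ?_, ?_, ?_⟩
  · intro i k
    fin_cases i <;> fin_cases k
    · change ∑ j, conj (V j 0) * V j 0 = 1
      simp only [p00]
      rw [← Finset.sum_div, ω1', div_self hδ0]
    · change ∑ j, conj (V j 0) * V j 1 = 0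
      simp only [p01]
      rw [← Finset.sum_div, η1, zero_div]
    · change ∑ j, conj (V j 1) * V j 0 = 0
      simp only [p10]
      rw [← map_sum, ← Finset.sum_div, η1, zero_div, map_zero]
    · change ∑ j, conj (V j 1) * V j 1 = 1
      simp only [p11]
      rw [← Finset.sum_div, ω1', div_self hδ0]
  · intro i k
    simp only [q]
    fin_cases i <;> fin_cases k
    · change ∑ j, (d j : ℂ)⁻¹ * (conj (V j 0) * V j 0) = ((δ⁻¹ : ℝ) : ℂ)
      simp only [p00, c]
      rw [← Finset.sum_div, ω0', one_div, Complex.ofReal_inv]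
    · change ∑ j, (d j : ℂ)⁻¹ * (conj (V j 0) * V j 1) = 0
      simp only [p01, c]
      rw [← Finset.sum_div, η0, zero_div]
    · change ∑ j, (d j : ℂ)⁻¹ * (conj (V j 1) * V j 0) = 0
      simp only [p10, c']
      rw [← map_sum, ← Finset.sum_div, η0, zero_div, map_zero]
    · change ∑ j, (d j : ℂ)⁻¹ * (conj (V j 1) * V j 1) = ((δ⁻¹ : ℝ) : ℂ)
      simp only [p11, c]
      rw [← Finset.sum_div, ω0', one_div, Complex.ofReal_inv]
  · intro i j h
    have e : ∑ k, V i k * conj (V j k) =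
        (r i * r j / (ω i * ω j)) * ((ω i : ℂ) * ω j + η i * conj (η j)) := by
      rw [Fin.sum_univ_two, V0, V0, V1, V1, map_mul, map_div₀, Complex.conj_ofReal,
        Complex.conj_ofReal]
      field_simp [hω0 i, hω0 j]
    rw [e]
    exact mul_ne_zero (div_ne_zero (mul_ne_zero (hr0 i) (hr0 j)) (mul_ne_zero (hω0 i) (hω0 j)))
      (hij i j h)
  · intro j
    rw [Fin.sum_univ_two, mul_comm, mul_comm (V j 1), p00, p11]
    push_cast
    ring

/-- Divided differences of the first powers at four points. -/
theorem sum_pow_div_prod_sub {x₁ x₂ x₃ x₄ : ℝ} (h12 : x₁ - x₂ ≠ 0) (h13 : x₁ - x₃ ≠ 0)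
    (h14 : x₁ - x₄ ≠ 0) (h23 : x₂ - x₃ ≠ 0) (h24 : x₂ - x₄ ≠ 0) (h34 : x₃ - x₄ ≠ 0)
    (g₀ g₁ g₂ g₃ g₄ g₅ : ℝ) {p₁ p₂ p₃ p₄ : ℝ} (e₁ : p₁ = (x₁ - x₂) * (x₁ - x₃) * (x₁ - x₄))
    (e₂ : p₂ = (x₂ - x₁) * (x₂ - x₃) * (x₂ - x₄)) (e₃ : p₃ = (x₃ - x₁) * (x₃ - x₂) * (x₃ - x₄))
    (e₄ : p₄ = (x₄ - x₁) * (x₄ - x₂) * (x₄ - x₃)) :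
    (g₅ * x₁ ^ 5 + g₄ * x₁ ^ 4 + g₃ * x₁ ^ 3 + g₂ * x₁ ^ 2 + g₁ * x₁ + g₀) / p₁ +
      (g₅ * x₂ ^ 5 + g₄ * x₂ ^ 4 + g₃ * x₂ ^ 3 + g₂ * x₂ ^ 2 + g₁ * x₂ + g₀) / p₂ +
      (g₅ * x₃ ^ 5 + g₄ * x₃ ^ 4 + g₃ * x₃ ^ 3 + g₂ * x₃ ^ 2 + g₁ * x₃ + g₀) / p₃ +
      (g₅ * x₄ ^ 5 + g₄ * x₄ ^ 4 + g₃ * x₄ ^ 3 + g₂ * x₄ ^ 2 + g₁ * x₄ + g₀) / p₄ =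
    g₃ + g₄ * (x₁ + x₂ + x₃ + x₄) + g₅ * (x₁ ^ 2 + x₂ ^ 2 + x₃ ^ 2 + x₄ ^ 2 + x₁ * x₂ + x₁ * x₃ +
      x₁ * x₄ + x₂ * x₃ + x₂ * x₄ + x₃ * x₄) := by
  have k₂ : p₂ = -((x₁ - x₂) * (x₂ - x₃) * (x₂ - x₄)) := by rw [e₂]; ring
  have k₃ : p₃ = (x₁ - x₃) * (x₂ - x₃) * (x₃ - x₄) := by rw [e₃]; ring
  have k₄ : p₄ = -((x₁ - x₄) * (x₂ - x₄) * (x₃ - x₄)) := by rw [e₄]; ring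
  rw [e₁, k₂, k₃, k₄]
  field_simp
  ring

/-- The weights that belong to a splitting of the sextic with roots `d₀, …, d₃, a₁, a₂`. -/
theorem SexticSplit.exists_weights {c₀ c₁ c₂ q₀ q₁ q₂ a₁ a₂ δ : ℝ} {d : Fin 4 → ℝ}
    (h : SexticSplit c₀ c₁ c₂ q₀ q₁ q₂ (d 0) (d 1) (d 2) (d 3) a₁ a₂) (hq : 0 < q₂)
    (hdisc : 0 < q₂ * q₀ - q₁ ^ 2) (hd : StrictMono d) (hδ : ∑ j, d j - 2 * δ = a₁ + a₂)
    (s1 : d 0 * (d 0 ^ 3 + c₂ * d 0 ^ 2 + c₁ * d 0 + c₀) < 0)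
    (s2 : 0 < d 1 * (d 1 ^ 3 + c₂ * d 1 ^ 2 + c₁ * d 1 + c₀))
    (s3 : d 2 * (d 2 ^ 3 + c₂ * d 2 ^ 2 + c₁ * d 2 + c₀) < 0)
    (s4 : 0 < d 3 * (d 3 ^ 3 + c₂ * d 3 ^ 2 + c₁ * d 3 + c₀)) :
    ∃ (ω : Fin 4 → ℝ) (η : Fin 4 → ℂ), (∀ j, 0 < d j * ω j) ∧
      (∀ j, η j * conj (η j) = (ω j : ℂ) ^ 2) ∧ ∑ j, ω j = 1 ∧ ∑ j, d j * ω j = δ ∧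
      ∑ j, η j = 0 ∧ ∑ j, (d j : ℂ) * η j = 0 ∧
      (∀ i j, i ≠ j → (ω i : ℂ) * ω j + η i * conj (η j) ≠ 0) ∧
      ∑ j, d j ^ 2 - 4 * ∑ j, d j * (d j * ω j) + 2 * δ ^ 2 = a₁ ^ 2 + a₂ ^ 2 := by
  obtain ⟨k5, k4, -⟩ := h.coeffs
  have h01 := hd (show (0 : Fin 4) < 1 by decide)
  have h12 := hd (show (1 : Fin 4) < 2 by decide)
  have h23 := hd (show (2 : Fin 4) < 3 by decide)
  have h02 := h01.trans h12
  have h13 := h12.trans h23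
  have h03 := h01.trans h13
  set p : Fin 4 → ℝ := ![(d 0 - d 1) * (d 0 - d 2) * (d 0 - d 3),
    (d 1 - d 0) * (d 1 - d 2) * (d 1 - d 3), (d 2 - d 0) * (d 2 - d 1) * (d 2 - d 3),
    (d 3 - d 0) * (d 3 - d 1) * (d 3 - d 2)] with hp
  have p0 : p 0 < 0 := mul_neg_of_pos_of_neg
    (mul_pos_of_neg_of_neg (sub_neg.2 h01) (sub_neg.2 h02)) (sub_neg.2 h03)
  have p1 : 0 < p 1 := mul_pos_of_neg_of_neg
    (mul_neg_of_pos_of_neg (sub_pos.2 h01) (sub_neg.2 h12)) (sub_neg.2 h13)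
  have p2 : p 2 < 0 := mul_neg_of_pos_of_neg
    (mul_pos (sub_pos.2 h02) (sub_pos.2 h12)) (sub_neg.2 h23)
  have p3 : 0 < p 3 := mul_pos (mul_pos (sub_pos.2 h03) (sub_pos.2 h13)) (sub_pos.2 h23)
  have hpne : ∀ j, p j ≠ 0 := by
    intro j; fin_cases j
    exacts [p0.ne, p1.ne', p2.ne, p3.ne']
  have key := fun g₀ g₁ g₂ g₃ g₄ g₅ => sum_pow_div_prod_sub (sub_neg.2 h01).ne (sub_neg.2 h02).ne
    (sub_neg.2 h03).ne (sub_neg.2 h12).ne (sub_neg.2 h13).ne (sub_neg.2 h23).ne g₀ g₁ g₂ g₃ g₄ g₅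
    (p₁ := p 0) (p₂ := p 1) (p₃ := p 2) (p₄ := p 3) rfl rfl rfl rfl
  -- Completing the square: Q(t) = (At + B)² + C² with A and C nonzero because Q is positive
  -- definite.
  obtain ⟨A, B, C, hA, hC, e2, e1, e0⟩ : ∃ A B C : ℝ, A ≠ 0 ∧ C ≠ 0 ∧ A ^ 2 = q₂ ∧ A * B = q₁ ∧
      B ^ 2 + C ^ 2 = q₀ := by
    have hA := (Real.sqrt_pos.2 hq).ne'
    have hA2 := Real.sq_sqrt hq.le
    have hC2 := Real.sq_sqrt hdisc.le
    refine ⟨√q₂, q₁ / √q₂, √(q₂ * q₀ - q₁ ^ 2) / √q₂, hA,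
      div_ne_zero (Real.sqrt_pos.2 hdisc).ne' hA, hA2, mul_div_cancel₀ _ hA, ?_⟩
    rw [div_pow, div_pow, ← add_div, hA2, hC2]
    field_simp
    ring
  have hR : ∀ j, (d j ^ 3 + c₂ * d j ^ 2 + c₁ * d j + c₀) ^ 2 = (A * d j + B) ^ 2 + C ^ 2 := by
    intro j
    have : (d j ^ 3 + c₂ * d j ^ 2 + c₁ * d j + c₀) ^ 2 -
        (q₂ * d j ^ 2 + 2 * q₁ * d j + q₀) = 0 := by
      rw [h (d j)]
      fin_cases j <;> simp
    linear_combination this - d j ^ 2 * e2 - 2 * d j * e1 - e0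
  -- With these quotients by p j = ∏_{k≠j}(dⱼ − dₖ), every moment is a divided difference at four
  -- points and can be read off from leading coefficients through `key`.
  refine ⟨fun j => (d j ^ 3 + c₂ * d j ^ 2 + c₁ * d j + c₀) / p j,
    fun j => ⟨(A * d j + B) / p j, -C / p j⟩, ?_, ?_, ?_, ?_, ?_, ?_, ?_, ?_⟩
  · intro j
    rw [← mul_div_assoc]
    fin_cases j
    exacts [div_pos_of_neg_of_neg s1 p0, div_pos s2 p1, div_pos_of_neg_of_neg s3 p2, div_pos s4 p3]
  · intro j
    rw [Complex.mul_conj, Complex.normSq_apply]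
    norm_cast
    field_simp [hpne j]
    linear_combination -hR j
  · rw [Fin.sum_univ_four]
    linear_combination key c₀ c₁ c₂ 1 0 0
  · rw [Fin.sum_univ_four] at hδ ⊢
    linear_combination key 0 c₀ c₁ c₂ 1 0 + hδ / 2 + k5 / 2
  · rw [Fin.sum_univ_four]
    refine Complex.ext ?_ ?_
    · change (A * d 0 + B) / p 0 + (A * d 1 + B) / p 1 + (A * d 2 + B) / p 2 +
        (A * d 3 + B) / p 3 = 0
      linear_combination key B A 0 0 0 0
    · change -C / p 0 + -C / p 1 + -C / p 2 + -C / p 3 = 0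
      linear_combination key (-C) 0 0 0 0 0
  · rw [Fin.sum_univ_four]
    refine Complex.ext ?_ ?_
    · simp only [Complex.add_re, Complex.re_ofReal_mul, Complex.zero_re]
      linear_combination key 0 B A 0 0 0
    · simp only [Complex.add_im, Complex.im_ofReal_mul, Complex.zero_im]
      linear_combination key 0 (-C) 0 0 0 0
  -- The imaginary part is CA(dᵢ − dⱼ) divided by p i p j.
  · intro i j hij h0
    have := congrArg Complex.im h0
    rw [← Complex.ofReal_mul, Complex.add_im, Complex.ofReal_im, Complex.mul_im, Complex.conj_re,
      Complex.conj_im, Complex.zero_im] at this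
    field_simp [hpne i, hpne j] at this
    have : C * A * (d i - d j) = 0 := by linear_combination this
    exact mul_ne_zero (mul_ne_zero hC hA) (sub_ne_zero.2 (hd.injective.ne hij)) this
  · rw [Fin.sum_univ_four] at hδ
    simp only [Fin.sum_univ_four]
    have hδ' : δ = (d 0 + d 1 + d 2 + d 3 - a₁ - a₂) / 2 := by linarith
    have hc₂ : c₂ = -(d 0 + d 1 + d 2 + d 3 + a₁ + a₂) / 2 := by linarith
    have hk := key 0 0 c₀ c₁ c₂ 1
    rw [hδ']
    linear_combination -4 * hk - 2 * k4 + (2 * c₂ - (d 0 + d 1 + d 2 + d 3 + a₁ + a₂) - 4 * (d 0 + d 1 + d 2 + d 3)) * (hc₂)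

end Weights

end SpectralProblem

namespace SpectralProblem

/-! ### Sufficiency of the inequalities -/

section Existence

variable {H : Type*} [NormedAddCommGroup H] [InnerProductSpace ℂ H] [CompleteSpace H]

/-- The inequalities for the three sign patterns are sufficient for the existence of a projection
system. -/
theorem exists_projectionSystem_of_inequalities (f : OrthonormalBasis (Fin 4) ℂ H)
    {a : Fin 3 → ℝ} (ha : Function.Injective a) {b : Fin 4 → ℝ} (hb : StrictAnti b) {δ γ : ℝ}
    (hδ : 0 < δ) {d₁ d₂ d₃ d₄ a₁ a₂ : ℝ} (e1 : d₁ = γ - a 0 - b 0)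
    (e2 : d₂ = γ - a 0 - b 1) (e3 : d₃ = γ - a 0 - b 2) (e4 : d₄ = γ - a 0 - b 3)
    (ea1 : a₁ = a 1 - a 0) (ea2 : a₂ = a 2 - a 0)
    (htr : d₁ + d₂ + d₃ + d₄ - 2 * δ = a₁ + a₂)
    (k : (0 < d₁ ∧ a₁ + a₂ + d₂ < d₄ + d₃ + d₁ ∧ d₃ + a₂ + d₂ < d₄ + a₁ + d₁ ∧
        d₃ + a₁ + d₁ < d₄ + a₂ + d₂ ∧ d₄ + d₁ + a₂ < d₂ + a₁ + d₃ ∧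
        d₄ + d₁ + d₂ < a₁ + a₂ + d₃) ∨
      (d₁ < 0 ∧ 0 < d₂ ∧ a₁ + d₂ + d₁ < d₄ + d₃ + a₂ ∧
        d₃ + d₂ + d₁ < d₄ + a₁ + a₂ ∧ d₃ + a₁ + a₂ < d₄ + d₂ + d₁ ∧
        d₄ + d₂ + a₂ < d₃ + a₁ + d₁ ∧ d₄ + d₁ + a₂ < d₂ + a₁ + d₃) ∨
      (d₂ < 0 ∧ 0 < d₃ ∧ d₃ + a₁ + d₁ < d₄ + d₂ + a₂ ∧ d₂ + a₁ + d₁ < d₄ + d₃ + a₂ ∧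
        d₃ + d₂ + a₂ < d₄ + a₁ + d₁ ∧ d₄ + a₁ + a₂ < d₃ + d₂ + d₁ ∧
        d₄ + d₁ + a₂ < d₂ + a₁ + d₃)) :
    ∃ (E : Fin 3 → H →L[ℂ] H) (F : Fin 4 → H →L[ℂ] H) (s : H →L[ℂ] H),
      IsProjectionSystem E F s a b δ γ ∧ Module.finrank ℂ (E 0).range = 2 := by
  subst e1 e2 e3 e4 ea1 ea2
  set d : Fin 4 → ℝ := fun j => γ - a 0 - b j with hd
  have hdm : StrictMono d := fun i j hij => sub_lt_sub_left (hb hij) _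
  obtain ⟨c₀, c₁, c₂, q₀, q₁, q₂, h⟩ :=
    exists_sexticSplit (d 0) (d 1) (d 2) (d 3) (a 1 - a 0) (a 2 - a 0)
  obtain ⟨hq, hdisc, s1, s2, s3, s4⟩ := h.weights_of_inequalities k
    (hdm (by decide)) (hdm (by decide)) (hdm (by decide))
  have htr' : ∑ j, d j - 2 * δ = (a 1 - a 0) + (a 2 - a 0) := by rw [Fin.sum_univ_four]; exact htr
  obtain ⟨ω, η, hω, hη, ω0, ω1, η0, η1, hij, hsq⟩ :=
    h.exists_weights hq hdisc hdm htr' s1 s2 s3 s4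
  obtain ⟨V, hV, hVd, hVij, hVjj⟩ := exists_coordinates_of_weights hδ hω hη ω0 ω1 η0 η1 hij
  refine exists_projectionSystem f ha (d := d) hδ.ne' (fun _ => rfl)
    (fun j => left_ne_zero_of_mul (hω j).ne') hV hVd hVij htr' ?_
  simp only [hVjj]
  rw [← hsq]
  have : 2 * δ * ∑ j, d j * (2 * (d j * ω j) / δ) = 4 * ∑ j, d j * (d j * ω j) := by
    rw [Finset.mul_sum, Finset.mul_sum]
    refine Finset.sum_congr rfl fun j _ => ?_
    field_simp
    ring
  rw [← this]
  push_cast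
  rfl

end Existence

/-! ### Passing between representations and projection systems -/

section Representation

variable {H : Type*} [NormedAddCommGroup H] [InnerProductSpace ℂ H] [CompleteSpace H]

/-- Moves the projection of rank 2 to position 0, where the analysis of the weights expects it. -/
theorem IsProjectionSystem.permE {E : Fin 3 → H →L[ℂ] H} {F : Fin 4 → H →L[ℂ] H} {s : H →L[ℂ] H}
    {a : Fin 3 → ℝ} {b : Fin 4 → ℝ} {δ γ : ℝ} (h : IsProjectionSystem E F s a b δ γ)
    (e : Equiv.Perm (Fin 3)) : IsProjectionSystem (E ∘ e) F s (a ∘ e) b δ γ where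
  sys :=
    { E_mul := fun i j => by
        refine (h.sys.E_mul (e i) (e j)).trans ?_
        simp
      E_sum := (Equiv.sum_comp e fun i => (E i : H →ₗ[ℂ] H)).trans h.sys.E_sum
      F_mul := h.sys.F_mul
      F_sum := h.sys.F_sum
      s_mul := h.sys.s_mul
      rel := by
        rw [← h.sys.rel, ← Equiv.sum_comp e (fun i => (a i : ℂ) • (E i : H →ₗ[ℂ] H))]
        rfl }
  E_star i := h.E_star _
  F_star := h.F_star
  s_star := h.s_star
  E_ne i := h.E_ne _
  F_ne := h.F_ne
  s_ne_zero := h.s_ne_zero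
  s_ne_one := h.s_ne_one
  irr K hK hE hF hs := h.irr K hK (fun i x hx => by
    have := hE (e.symm i) x hx
    rwa [Function.comp_apply, Equiv.apply_symm_apply] at this) hF hs

variable {α₁ α₂ β₁ β₂ β₃ δ γ : ℝ}

/-- The projections `π(pᵢ)` and the complement of their sum. -/
noncomputable def StarRep.resolutionP (π : StarRep ![α₁, α₂] ![β₁, β₂, β₃] ![δ] γ H) : Fin 3 → H →L[ℂ] H :=
  ![π.op (.p 0), π.op (.p 1), 1 - (π.op (.p 0) + π.op (.p 1))]

/-- The projections `π(qⱼ)` and the complement of their sum. -/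
noncomputable def StarRep.resolutionQ (π : StarRep ![α₁, α₂] ![β₁, β₂, β₃] ![δ] γ H) : Fin 4 → H →L[ℂ] H :=
  ![π.op (.q 0), π.op (.q 1), π.op (.q 2), 1 - (π.op (.q 0) + π.op (.q 1) + π.op (.q 2))]

/-- The complements enter with coefficient 0, so the relation is unchanged; they are nonzero exactly
because the representation is non-degenerate. -/
theorem StarRep.isProjectionSystem {π : StarRep ![α₁, α₂] ![β₁, β₂, β₃] ![δ] γ H}
    (hπ : π.IsIrreducible) (hn : π.IsNondegenerate) :
    IsProjectionSystem π.resolutionP π.resolutionQ (π.op (.s 0)) ![α₁, α₂, 0] ![β₁, β₂, β₃, 0]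
      δ γ := by
  have pm := π.op_p_mul
  have qm := π.op_q_mul
  have p00 : π.op (.p 0) * π.op (.p 0) = π.op (.p 0) := pm 0 0
  have p01 : π.op (.p 0) * π.op (.p 1) = 0 := pm 0 1
  have p10 : π.op (.p 1) * π.op (.p 0) = 0 := pm 1 0
  have p11 : π.op (.p 1) * π.op (.p 1) = π.op (.p 1) := pm 1 1
  have q00 : π.op (.q 0) * π.op (.q 0) = π.op (.q 0) := qm 0 0
  have q01 : π.op (.q 0) * π.op (.q 1) = 0 := qm 0 1
  have q02 : π.op (.q 0) * π.op (.q 2) = 0 := qm 0 2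
  have q10 : π.op (.q 1) * π.op (.q 0) = 0 := qm 1 0
  have q11 : π.op (.q 1) * π.op (.q 1) = π.op (.q 1) := qm 1 1
  have q12 : π.op (.q 1) * π.op (.q 2) = 0 := qm 1 2
  have q20 : π.op (.q 2) * π.op (.q 0) = 0 := qm 2 0
  have q21 : π.op (.q 2) * π.op (.q 1) = 0 := qm 2 1
  have q22 : π.op (.q 2) * π.op (.q 2) = π.op (.q 2) := qm 2 2
  obtain ⟨hne, hp, hq, hs⟩ := hn
  rw [Fin.sum_univ_two] at hp
  rw [Fin.sum_univ_three] at hq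
  rw [Fin.sum_univ_one] at hs
  have hsum := π.op_sum
  rw [Fin.sum_univ_two, Fin.sum_univ_three, Fin.sum_univ_one] at hsum
  have E_mul : ∀ i j, π.resolutionP i * π.resolutionP j = if i = j then π.resolutionP i else 0 := by
    intro i j
    fin_cases i <;> fin_cases j <;>
      simp [StarRep.resolutionP, mul_sub, sub_mul, mul_add, add_mul, p00, p01, p10, p11]
  have F_mul : ∀ i j, π.resolutionQ i * π.resolutionQ j = if i = j then π.resolutionQ i else 0 := by
    intro i j
    fin_cases i <;> fin_cases j <;>
      simp [StarRep.resolutionQ, mul_sub, sub_mul, mul_add, add_mul, q00, q01, q02, q10, q11, q12,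
        q20, q21, q22]
  have rel : ∑ i, ((![α₁, α₂, 0] i : ℝ) : ℂ) • π.resolutionP i +
      ∑ j, ((![β₁, β₂, β₃, 0] j : ℝ) : ℂ) • π.resolutionQ j + (δ : ℂ) • π.op (.s 0) =
      (γ : ℂ) • 1 := by
    rw [← hsum, Fin.sum_univ_three, Fin.sum_univ_four]
    simp [StarRep.resolutionP, StarRep.resolutionQ]
  have star_one_sub : ∀ T : H →L[ℂ] H, star T = T → star (1 - T) = 1 - T := fun T hT => by
    rw [star_sub, star_one, hT]
  refine ⟨⟨?_, ?_, ?_, ?_, ?_, ?_⟩, ?_, ?_, π.op_star _, ?_, ?_, hne _, hs, ?_⟩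
  · intro i j
    refine (congrArg ContinuousLinearMap.toLinearMap (E_mul i j)).trans ?_
    split_ifs <;> rfl
  · have : ∑ i, π.resolutionP i = 1 := by
      rw [Fin.sum_univ_three]; simp [StarRep.resolutionP]
    simpa using congrArg ContinuousLinearMap.toLinearMap this
  · intro i j
    refine (congrArg ContinuousLinearMap.toLinearMap (F_mul i j)).trans ?_
    split_ifs <;> rfl
  · have : ∑ i, π.resolutionQ i = 1 := by
      rw [Fin.sum_univ_four]; simp [StarRep.resolutionQ]
    simpa using congrArg ContinuousLinearMap.toLinearMap this
  · exact congrArg ContinuousLinearMap.toLinearMap (π.op_s_mul 0 0)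
  · simpa using congrArg ContinuousLinearMap.toLinearMap rel
  · intro i
    fin_cases i
    · exact π.op_star _
    · exact π.op_star _
    · exact star_one_sub _ (by rw [star_add, π.op_star, π.op_star])
  · intro i
    fin_cases i
    · exact π.op_star _
    · exact π.op_star _
    · exact π.op_star _
    · exact star_one_sub _ (by rw [star_add, star_add, π.op_star, π.op_star, π.op_star])
  · intro i
    fin_cases i
    · exact hne _
    · exact hne _
    · exact sub_ne_zero.2 hp.symm
  · intro i
    fin_cases i
    · exact hne _
    · exact hne _
    · exact hne _
    · exact sub_ne_zero.2 hq.symm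
  · intro K hK hKE hKF hKs
    refine hπ.eq_bot_or_top K fun x => ?_
    rcases x with i | j | l
    · fin_cases i
      · exact hKE 0
      · exact hKE 1
    · fin_cases j
      · exact hKF 0
      · exact hKF 1
      · exact hKF 2
    · fin_cases l
      exact hKs

/-- A projection system defines an irreducible non-degenerate representation. -/
theorem IsProjectionSystem.exists_starRep {E : Fin 3 → H →L[ℂ] H} {F : Fin 4 → H →L[ℂ] H}
    {s : H →L[ℂ] H} [FiniteDimensional ℂ H]
    (h : IsProjectionSystem E F s ![α₁, α₂, 0] ![β₁, β₂, β₃, 0] δ γ) :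
    ∃ π : StarRep ![α₁, α₂] ![β₁, β₂, β₃] ![δ] γ H, π.IsIrreducible ∧ π.IsNondegenerate ∧
      π.op (.p 0) = E 0 ∧ π.op (.p 1) = E 1 := by
  have hE : E 0 + E 1 + E 2 = 1 := by
    ext x; simpa [Fin.sum_univ_three] using h.E_sum_apply x
  have hF : F 0 + F 1 + F 2 + F 3 = 1 := by
    ext x; simpa [Fin.sum_univ_four] using h.F_sum_apply x
  have E_mul : ∀ i j, E i * E j = if i = j then E i else 0 := fun i j => by
    ext x; refine (h.E_apply i j x).trans ?_; split_ifs <;> rfl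
  have F_mul : ∀ i j, F i * F j = if i = j then F i else 0 := fun i j => by
    ext x; refine (h.F_apply i j x).trans ?_; split_ifs <;> rfl
  have hs : s * s = s := by ext x; exact h.s_apply x
  obtain ⟨π, hπ⟩ := StarRep.exists_of_relations (α := ![α₁, α₂]) (β := ![β₁, β₂, β₃])
    (δ := ![δ]) (γ := γ)
    (fun x => match x with
      | .p i => E i.castSucc
      | .q j => F j.castSucc
      | .s _ => s)
    (fun x => by rcases x with i | j | l; exacts [h.E_star _, h.F_star _, h.s_star])
    (fun i j => by simp [E_mul]) (fun i j => by simp [F_mul])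
    (fun i j => by simp [hs, Subsingleton.elim i j])
    (by
      ext x
      have := h.rel_apply x
      simpa [Fin.sum_univ_two, Fin.sum_univ_three, Fin.sum_univ_four] using this)
  have hp : ∀ i, π.op (.p i) = E i.castSucc := fun i => hπ _
  have hq : ∀ j, π.op (.q j) = F j.castSucc := fun j => hπ _
  have hs' : ∀ l, π.op (.s l) = s := fun l => hπ _
  refine ⟨π, ⟨?_, ?_⟩, ⟨?_, ?_, ?_, ?_⟩, hp 0, hp 1⟩
  · by_contra hc
    rw [not_nontrivial_iff_subsingleton] at hc
    exact h.s_ne_zero (Subsingleton.elim _ _)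
  · intro K _ hK
    have kE : ∀ i : Fin 2, ∀ x ∈ K, E i.castSucc x ∈ K := fun i x hx => by
      rw [← hp]; exact hK _ x hx
    have kF : ∀ j : Fin 3, ∀ x ∈ K, F j.castSucc x ∈ K := fun j x hx => by
      rw [← hq]; exact hK _ x hx
    refine h.irr K inferInstance (Fin.forall_fin_succ'.2 ⟨kE, fun x hx => ?_⟩)
      (Fin.forall_fin_succ'.2 ⟨kF, fun x hx => ?_⟩) fun x hx => by rw [← hs' 0]; exact hK _ x hx
    · change E 2 x ∈ K
      rw [eq_sub_of_add_eq' hE]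
      exact K.sub_mem hx (K.add_mem (kE 0 x hx) (kE 1 x hx))
    · change F 3 x ∈ K
      rw [eq_sub_of_add_eq' hF]
      exact K.sub_mem hx (K.add_mem (K.add_mem (kF 0 x hx) (kF 1 x hx)) (kF 2 x hx))
  · rintro (i | j | l)
    · rw [hp]; exact h.E_ne _
    · rw [hq]; exact h.F_ne _
    · rw [hs']; exact h.s_ne_zero
  · rw [Fin.sum_univ_two, hp, hp]
    exact fun k => h.E_ne 2 (by rw [eq_sub_of_add_eq' hE]; exact sub_eq_zero.2 k.symm)
  · rw [Fin.sum_univ_three, hq, hq, hq]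
    exact fun k => h.F_ne 3 (by rw [eq_sub_of_add_eq' hF]; exact sub_eq_zero.2 k.symm)
  · rw [Fin.sum_univ_one, hs']
    exact h.s_ne_one

end Representation

end SpectralProblem

namespace SpectralProblem

/-! ### Generalized dimensions and the position of the rank-two projection -/

section Classification

variable {H : Type*} [NormedAddCommGroup H] [InnerProductSpace ℂ H] [CompleteSpace H]
variable {H' : Type*} [NormedAddCommGroup H'] [InnerProductSpace ℂ H'] [CompleteSpace H']

variable {α₁ α₂ β₁ β₂ β₃ δ γ : ℝ}

/-- A generalized dimension `(4; x, y; 1, 1, 1; 2)` only depends on the ranks of the `π(pᵢ)`. -/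
theorem StarRep.hasGeneralizedDimension_iff {π : StarRep ![α₁, α₂] ![β₁, β₂, β₃] ![δ] γ H}
    (ha : Function.Injective ![α₁, α₂, 0]) (hb : Function.Injective ![β₁, β₂, β₃, 0]) (hδ : δ ≠ 0)
    (hπ : π.IsIrreducible) (hn : π.IsNondegenerate) {x y : ℕ} :
    π.HasGeneralizedDimension 4 ![x, y] ![1, 1, 1] ![2] ↔
      Module.finrank ℂ (π.op (.p 1)).range = x ∧ Module.finrank ℂ (π.op (.p 0)).range = y := by
  have h := isProjectionSystem hπ hn
  refine ⟨fun k => ⟨k.2.2.1 0, k.2.2.1 1⟩, fun k =>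
    ⟨h.finiteDimensional ha hb hδ, h.finrank_eq ha hb hδ, ?_, ?_, ?_⟩⟩
  · intro i
    fin_cases i
    exacts [k.1, k.2]
  · intro j
    fin_cases j
    exacts [h.finrank_range_F ha hb hδ 2, h.finrank_range_F ha hb hδ 1,
      h.finrank_range_F ha hb hδ 0]
  · intro l
    fin_cases l
    exact h.finrank_range_s ha hb hδ

/-- The generalized dimensions that can occur. -/
theorem StarRep.hasGeneralizedDimension_cases {π : StarRep ![α₁, α₂] ![β₁, β₂, β₃] ![δ] γ H}
    (ha : Function.Injective ![α₁, α₂, 0]) (hb : Function.Injective ![β₁, β₂, β₃, 0]) (hδ : δ ≠ 0)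
    (hπ : π.IsIrreducible) (hn : π.IsNondegenerate) :
    π.HasGeneralizedDimension 4 ![1, 1] ![1, 1, 1] ![2] ∨
      π.HasGeneralizedDimension 4 ![1, 2] ![1, 1, 1] ![2] ∨
      π.HasGeneralizedDimension 4 ![2, 1] ![1, 1, 1] ![2] := by
  simp only [hasGeneralizedDimension_iff ha hb hδ hπ hn]
  have h := isProjectionSystem hπ hn
  have := h.finiteDimensional ha hb hδ
  have hs := h.sum_finrank_range_E
  rw [h.finrank_eq ha hb hδ, Fin.sum_univ_three] at hs
  have h0 : 0 < Module.finrank ℂ (π.op (.p 0)).range := h.finrank_range_E_pos 0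
  have h1 : 0 < Module.finrank ℂ (π.op (.p 1)).range := h.finrank_range_E_pos 1
  have h2 := h.finrank_range_E_pos 2
  change Module.finrank ℂ (π.op (.p 0)).range + Module.finrank ℂ (π.op (.p 1)).range + _ = 4 at hs
  omega

/-- The position of the two dimensional projection among `p₁`, `p₂`, `1 - p₁ - p₂` determines the
generalized dimension. -/
theorem StarRep.hasGeneralizedDimension_iff_finrank
    {π : StarRep ![α₁, α₂] ![β₁, β₂, β₃] ![δ] γ H}
    (ha : Function.Injective ![α₁, α₂, 0]) (hb : Function.Injective ![β₁, β₂, β₃, 0]) (hδ : δ ≠ 0)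
    (hπ : π.IsIrreducible) (hn : π.IsNondegenerate) (i : Fin 3) :
    π.HasGeneralizedDimension 4 ![if i = 1 then 2 else 1, if i = 0 then 2 else 1] ![1, 1, 1] ![2] ↔
      Module.finrank ℂ (π.resolutionP i).range = 2 := by
  rw [hasGeneralizedDimension_iff ha hb hδ hπ hn]
  have h := isProjectionSystem hπ hn
  have := h.finiteDimensional ha hb hδ
  have hs := h.sum_finrank_range_E
  rw [h.finrank_eq ha hb hδ, Fin.sum_univ_three] at hs
  have h0 : 0 < Module.finrank ℂ (π.op (.p 0)).range := h.finrank_range_E_pos 0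
  have h1 : 0 < Module.finrank ℂ (π.op (.p 1)).range := h.finrank_range_E_pos 1
  have h2 := h.finrank_range_E_pos 2
  change Module.finrank ℂ (π.op (.p 0)).range + Module.finrank ℂ (π.op (.p 1)).range + _ = 4 at hs
  fin_cases i
  · change _ ∧ _ ↔ Module.finrank ℂ (π.op (.p 0)).range = 2
    simp
    omega
  · change _ ∧ _ ↔ Module.finrank ℂ (π.op (.p 1)).range = 2
    simp
    omega
  · change _ ∧ _ ↔ Module.finrank ℂ (π.resolutionP 2).range = 2
    simp
    omega

/-- Representations with a two dimensional projection in the same position are equivalent. -/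
theorem StarRep.unitarilyEquivalent_of_finrank (ha : Function.Injective ![α₁, α₂, 0])
    (hb : Function.Injective ![β₁, β₂, β₃, 0]) (hδ : 0 < δ) (e : Equiv.Perm (Fin 3))
    {π : StarRep ![α₁, α₂] ![β₁, β₂, β₃] ![δ] γ H} (hπ : π.IsIrreducible) (hn : π.IsNondegenerate)
    (h2 : Module.finrank ℂ (π.resolutionP (e 0)).range = 2)
    {π' : StarRep ![α₁, α₂] ![β₁, β₂, β₃] ![δ] γ H'} (hπ' : π'.IsIrreducible)
    (hn' : π'.IsNondegenerate) (h2' : Module.finrank ℂ (π'.resolutionP (e 0)).range = 2) :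
    π.UnitarilyEquivalent π' := by
  have h := isProjectionSystem hπ hn
  have h' := isProjectionSystem hπ' hn'
  obtain ⟨r, hr, hr'⟩ := (h.permE e).exists_common_weight (h'.permE e) (ha.comp e.injective) hb hδ
    h2 h2'
  refine h.unitarilyEquivalent h' ?_ ha hb hδ.ne' hπ hπ' hr hr'
  rintro (i | j | l)
  · fin_cases i
    exacts [Or.inl ⟨0, rfl, rfl⟩, Or.inl ⟨1, rfl, rfl⟩]
  · refine Or.inr (Or.inl ?_)
    fin_cases j
    exacts [⟨0, rfl, rfl⟩, ⟨1, rfl, rfl⟩, ⟨2, rfl, rfl⟩]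
  · fin_cases l
    exact Or.inr (Or.inr ⟨rfl, rfl⟩)

/-- Existence in a generalized dimension in terms of projection systems. -/
theorem existsInDimension_iff (ha : Function.Injective ![α₁, α₂, 0])
    (hb : Function.Injective ![β₁, β₂, β₃, 0]) (hδ : δ ≠ 0) (e : Equiv.Perm (Fin 3)) :
    ExistsInDimension.{u} ![α₁, α₂] ![β₁, β₂, β₃] ![δ] γ 4
        ![if e 0 = 1 then 2 else 1, if e 0 = 0 then 2 else 1] ![1, 1, 1] ![2] ↔
      ∃ (H : Type u) (_ : NormedAddCommGroup H) (_ : InnerProductSpace ℂ H) (_ : CompleteSpace H)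
        (E : Fin 3 → H →L[ℂ] H) (F : Fin 4 → H →L[ℂ] H) (s : H →L[ℂ] H),
        IsProjectionSystem E F s (![α₁, α₂, 0] ∘ e) ![β₁, β₂, β₃, 0] δ γ ∧
          Module.finrank ℂ (E 0).range = 2 := by
  constructor
  · rintro ⟨H, _, _, _, π, hπ, hn, hdim⟩
    exact ⟨H, _, _, _, _, _, _, (π.isProjectionSystem hπ hn).permE e,
      (StarRep.hasGeneralizedDimension_iff_finrank ha hb hδ hπ hn _).1 hdim⟩
  · rintro ⟨H, _, _, _, E, F, s, h, h2⟩
    have := h.finiteDimensional (ha.comp e.injective) hb hδ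
    have h' := h.permE e.symm
    rw [Function.comp_assoc, Equiv.self_comp_symm, Function.comp_id] at h'
    obtain ⟨π, hπ, hn, hp0, hp1⟩ := h'.exists_starRep
    refine ⟨H, _, _, _, π, hπ, hn,
      (StarRep.hasGeneralizedDimension_iff_finrank ha hb hδ hπ hn _).2 ?_⟩
    have hr : π.resolutionP = E ∘ e.symm := by
      have hE : E (e.symm 0) + E (e.symm 1) + E (e.symm 2) = 1 := by
        ext x; simpa [Fin.sum_univ_three] using h'.E_sum_apply x
      funext i
      fin_cases i
      · exact hp0
      · exact hp1
      · change 1 - (π.op (.p 0) + π.op (.p 1)) = E (e.symm 2)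
        rw [hp0, hp1]
        exact (eq_sub_of_add_eq' hE).symm
    rw [hr, Function.comp_apply, Equiv.symm_apply_apply]
    exact h2

end Classification

end SpectralProblem

/-! ### The three cases -/

theorem theorem4 (α₁ α₂ β₁ β₂ β₃ δ γ : ℝ)
    (hα₂ : 0 < α₂) (hα : α₂ < α₁)
    (hβ₃ : 0 < β₃) (hβ₂ : β₃ < β₂) (hβ₁ : β₂ < β₁)
    (hδ : 0 < δ) (hγ : 0 < γ) :
    (∀ (H : Type u) [NormedAddCommGroup H] [InnerProductSpace ℂ H] [CompleteSpace H]
        (π : StarRep ![α₁, α₂] ![β₁, β₂, β₃] ![δ] γ H),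
        π.IsIrreducible → π.IsNondegenerate →
          π.HasGeneralizedDimension 4 ![1, 1] ![1, 1, 1] ![2] ∨
          π.HasGeneralizedDimension 4 ![1, 2] ![1, 1, 1] ![2] ∨
          π.HasGeneralizedDimension 4 ![2, 1] ![1, 1, 1] ![2]) ∧
    ((ExistsInDimension.{u} ![α₁, α₂] ![β₁, β₂, β₃] ![δ] γ 4 ![1, 1] ![1, 1, 1] ![2] ↔
        δ + β₃ < γ ∧ 2 * γ < δ + α₁ + β₁ ∧ γ < δ + β₂ ∧
        δ + α₂ + β₁ < 2 * γ ∧ β₁ < γ ∧ δ + α₁ + β₂ < 2 * γ ∧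
        4 * γ = α₁ + α₂ + β₁ + β₂ + β₃ + 2 * δ) ∧
      UniqueInDimension.{u, v} ![α₁, α₂] ![β₁, β₂, β₃] ![δ] γ 4 ![1, 1] ![1, 1, 1] ![2]) ∧
    ((ExistsInDimension.{u} ![α₁, α₂] ![β₁, β₂, β₃] ![δ] γ 4 ![1, 2] ![1, 1, 1] ![2] ↔
        γ < α₁ + β₂ ∧ α₁ + β₁ + δ < 2 * γ ∧ α₁ + β₃ < γ ∧
        δ + α₁ + β₂ + β₃ < 2 * γ ∧ γ < δ + α₁ ∧ 2 * γ < δ + α₁ + β₁ + β₃ ∧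
        4 * γ = 2 * α₁ + α₂ + β₁ + β₂ + β₃ + 2 * δ) ∧
      UniqueInDimension.{u, v} ![α₁, α₂] ![β₁, β₂, β₃] ![δ] γ 4 ![1, 2] ![1, 1, 1] ![2]) ∧
    ((ExistsInDimension.{u} ![α₁, α₂] ![β₁, β₂, β₃] ![δ] γ 4 ![2, 1] ![1, 1, 1] ![2] ↔
        α₂ + β₂ < γ ∧ γ < δ + α₂ + β₃ ∧ γ < α₂ + β₁ ∧
        2 * γ < δ + α₂ + β₁ + β₂ ∧ δ + α₂ < γ ∧ δ + α₂ + β₁ + β₃ < 2 * γ ∧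
        4 * γ = α₁ + 2 * α₂ + β₁ + β₂ + β₃ + 2 * δ) ∧
      UniqueInDimension.{u, v} ![α₁, α₂] ![β₁, β₂, β₃] ![δ] γ 4 ![2, 1] ![1, 1, 1] ![2]) := by
  have hb : StrictAnti ![β₁, β₂, β₃, 0] := by
    intro i j hij
    fin_cases i <;> fin_cases j <;> simp at hij ⊢ <;> linarith
  have ha : Function.Injective ![α₁, α₂, 0] := by
    have : StrictAnti ![α₁, α₂, 0] := by
      intro i j hij
      fin_cases i <;> fin_cases j <;> simp at hij ⊢ <;> linarith
    exact this.injective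
  -- The lift places the four dimensional model space in the universe u.
  have f : OrthonormalBasis (Fin 4) ℂ (EuclideanSpace ℂ (ULift.{u} (Fin 4))) :=
    (EuclideanSpace.basisFun _ ℂ).reindex Equiv.ulift
  -- The permutations list the coefficients as (0, α₁, α₂), (α₁, α₂, 0) and (α₂, α₁, 0): the first
  -- belongs to the projection of rank 2, and the third is smaller than the second. The differences
  -- a₁, a₂ to the first are then both positive, both negative, or of opposite signs, which selects
  -- the sign pattern; the trace identity becomes the equation for 4γ.
  refine ⟨fun H _ _ _ π hπ hn =>
    StarRep.hasGeneralizedDimension_cases ha hb.injective hδ.ne' hπ hn,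
    ⟨(existsInDimension_iff ha hb.injective hδ.ne' (Equiv.addRight 2)).trans ⟨?_, ?_⟩, ?_⟩,
    ⟨(existsInDimension_iff ha hb.injective hδ.ne' (Equiv.refl _)).trans ⟨?_, ?_⟩, ?_⟩,
    ⟨(existsInDimension_iff ha hb.injective hδ.ne' (Equiv.swap 0 1)).trans ⟨?_, ?_⟩, ?_⟩⟩
  · rintro ⟨H, _, _, _, E, F, s, h, h2⟩
    obtain ⟨htr, k, -, -⟩ := h.inequalities (ha.comp (Equiv.injective _)) hb hδ h2 hα
      (d₁ := γ - 0 - β₁) (d₂ := γ - 0 - β₂) (d₃ := γ - 0 - β₃) (d₄ := γ - 0 - 0) (a₁ := α₁ - 0)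
      (a₂ := α₂ - 0) rfl rfl rfl rfl rfl rfl
    obtain ⟨k0, k1, k2, k3, k4, k5⟩ := k (by linarith)
    refine ⟨?_, ?_, ?_, ?_, ?_, ?_, ?_⟩ <;> linarith
  · rintro ⟨k0, k1, k2, k3, k4, k5, k6⟩
    refine ⟨_, _, _, inferInstance, exists_projectionSystem_of_inequalities f
      (ha.comp (Equiv.injective _)) hb hδ
      (d₁ := γ - 0 - β₁) (d₂ := γ - 0 - β₂) (d₃ := γ - 0 - β₃) (d₄ := γ - 0 - 0) (a₁ := α₁ - 0)
      (a₂ := α₂ - 0) rfl rfl rfl rfl rfl rfl (by linarith) (Or.inl ?_)⟩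
    refine ⟨?_, ?_, ?_, ?_, ?_, ?_⟩ <;> linarith
  · intro H _ _ _ H' _ _ _ π π' hπ hn hd hπ' hn' hd'
    exact StarRep.unitarilyEquivalent_of_finrank ha hb.injective hδ (Equiv.addRight 2) hπ hn
      ((StarRep.hasGeneralizedDimension_iff_finrank ha hb.injective hδ.ne' hπ hn 2).1 hd) hπ' hn'
      ((StarRep.hasGeneralizedDimension_iff_finrank ha hb.injective hδ.ne' hπ' hn' 2).1 hd')
  · rintro ⟨H, _, _, _, E, F, s, h, h2⟩
    obtain ⟨htr, -, -, k⟩ := h.inequalities (ha.comp (Equiv.injective _)) hb hδ h2 hα₂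
      (d₁ := γ - α₁ - β₁) (d₂ := γ - α₁ - β₂) (d₃ := γ - α₁ - β₃) (d₄ := γ - α₁ - 0)
      (a₁ := α₂ - α₁) (a₂ := 0 - α₁) rfl rfl rfl rfl rfl rfl
    obtain ⟨k0, k1, k2, k3, k4, k5, k6⟩ := k (by linarith)
    refine ⟨?_, ?_, ?_, ?_, ?_, ?_, ?_⟩ <;> linarith
  · rintro ⟨k0, k1, k2, k3, k4, k5, k6⟩
    refine ⟨_, _, _, inferInstance, exists_projectionSystem_of_inequalities f
      (ha.comp (Equiv.injective _)) hb hδ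
      (d₁ := γ - α₁ - β₁) (d₂ := γ - α₁ - β₂) (d₃ := γ - α₁ - β₃) (d₄ := γ - α₁ - 0)
      (a₁ := α₂ - α₁) (a₂ := 0 - α₁) rfl rfl rfl rfl rfl rfl (by linarith) (Or.inr (Or.inr ?_))⟩
    refine ⟨?_, ?_, ?_, ?_, ?_, ?_, ?_⟩ <;> linarith
  · intro H _ _ _ H' _ _ _ π π' hπ hn hd hπ' hn' hd'
    exact StarRep.unitarilyEquivalent_of_finrank ha hb.injective hδ (Equiv.refl _) hπ hn
      ((StarRep.hasGeneralizedDimension_iff_finrank ha hb.injective hδ.ne' hπ hn 0).1 hd) hπ' hn'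
      ((StarRep.hasGeneralizedDimension_iff_finrank ha hb.injective hδ.ne' hπ' hn' 0).1 hd')
  · rintro ⟨H, _, _, _, E, F, s, h, h2⟩
    obtain ⟨htr, -, k, -⟩ := h.inequalities (ha.comp (Equiv.injective _)) hb hδ h2
      (show 0 < α₁ by linarith)
      (d₁ := γ - α₂ - β₁) (d₂ := γ - α₂ - β₂) (d₃ := γ - α₂ - β₃) (d₄ := γ - α₂ - 0)
      (a₁ := α₁ - α₂) (a₂ := 0 - α₂) rfl rfl rfl rfl rfl rfl
    obtain ⟨k0, k1, k2, k3, k4, k5, k6⟩ := k (by linarith) (by linarith)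
    refine ⟨?_, ?_, ?_, ?_, ?_, ?_, ?_⟩ <;> linarith
  · rintro ⟨k0, k1, k2, k3, k4, k5, k6⟩
    refine ⟨_, _, _, inferInstance, exists_projectionSystem_of_inequalities f
      (ha.comp (Equiv.injective _)) hb hδ
      (d₁ := γ - α₂ - β₁) (d₂ := γ - α₂ - β₂) (d₃ := γ - α₂ - β₃) (d₄ := γ - α₂ - 0)
      (a₁ := α₁ - α₂) (a₂ := 0 - α₂) rfl rfl rfl rfl rfl rfl (by linarith) (Or.inr (Or.inl ?_))⟩
    refine ⟨?_, ?_, ?_, ?_, ?_, ?_, ?_⟩ <;> linarith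
  · intro H _ _ _ H' _ _ _ π π' hπ hn hd hπ' hn' hd'
    exact StarRep.unitarilyEquivalent_of_finrank ha hb.injective hδ (Equiv.swap 0 1) hπ hn
      ((StarRep.hasGeneralizedDimension_iff_finrank ha hb.injective hδ.ne' hπ hn 1).1 hd) hπ' hn'
      ((StarRep.hasGeneralizedDimension_iff_finrank ha hb.injective hδ.ne' hπ' hn' 1).1 hd')
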